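/- Let $\Omega\subset\mathbb R^d$ be open, let $T\in\mathbb R$, and let $u:\Omega\times(0,T)\to\mathbb R^d$ be a measurable vector field (no equation and no divergence condition is imposed). Let $\rho:\mathbb R^d\to\mathbb R$ be smooth, even and compactly supported, put $\rho_\ell(y)=\ell^{-d}\rho(y/\ell)$ and $f_\ell=\rho_\ell * f$ (convolution in $x$), $\delta_{\ell z}u(x,t)=u(x+\ell z,t)-u(x,t)$, and $$D^\ell_{\rm DR}=\int \nabla\rho(z)\cdot\frac{\delta_{\ell z}u(x,t)}{4\ell}\,|\delta_{\ell z}u(x,t)|^2\,dz,\qquad D^\ell_{\rm CET}=\big(u_\ell\otimes u_\ell-(u\otimes u)_\ell\big):\nabla u_\ell .$$ For $D^\ell_{\rm CET}$ assume moreover $\int\rho=1$. Write $Eu=\frac12(\nabla u+\nabla u^T)$ for the distributional symmetric gradient in $x$. All function spaces are local in $\Omega\times(0,T)$: $u\in L^p_tX_x$ means that $u(\cdot,t)\in X(O)$ for a.e. $t$ and that $t\mapsto\|u(\cdot,t)\|_{X(O)}$ is bounded by a function in $L^p(J)$, for every open $O\subset\subset\Omega$ and every compact $J\subset(0,T)$;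 similarly for $Eu\in L^p_tL^q_x$. Likewise "$F^\ell\to0$ in $L^1_{x,t}$" means $F^\ell\in L^1(K)$ for all small $\ell>0$ and $\|F^\ell\|_{L^1(K)}\to0$ as $\ell\to0^+$, for every compact $K\subset\Omega\times(0,T)$. The spaces are: - $BD(O)$: $v\in L^1(O;\mathbb R^d)$ such that $Ev$ is a finite matrix-valued measure on $O$, with norm $\|v\|_{L^1(O)}+|Ev|(O)$; - $C^0$: continuous fields (up to a.e. equality), with the supremum norm; - $VMO(O)$: $\sup_{B_\ell(x)\subset O,\ \ell>0}\frac{1}{|B_\ell|}\int_{B_\ell(x)}|v-\frac{1}{|B_\ell|}\int_{B_\ell(x)}v|<\infty$ (this supremum is the norm) and $\lim_{\ell\to0}\sup_{x:\,B_\ell(x)\subset O}\frac{1}{|B_\ell|}\int_{B_\ell(x)}|v-\frac{1}{|B_\ell|}\int_{B_\ell(x)}v|=0$; - $B^{1/3}_{3,VMO}(O)$: with $m_\ell(v)=\ell^{-1/3}\Big(\int_O\frac1{|B_\ell|}\int_{\{y\in B_\ell(0):\,x+y\in O\}}|v(x+y)-v(x)|^3\,dy\,dx\Big)^{1/3}$,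 the norm $\|v\|_{L^3(O)}+\sup_{\ell>0}m_\ell(v)$ is finite and $m_\ell(v)\to0$ as $\ell\to0$. Let $p_1,p_2\in[1,\infty]$ satisfy $\frac1{p_1}+\frac2{p_2}=1$. Then $D^\ell_{\rm DR}\to0$ in $L^1_{x,t}$ under any of the following assumptions: (i) $u\in L^3_tB^{1/3}_{3,VMO}$; (ii) $u\in L^{p_1}_tBD_x\cap L^{p_2}_tC^0_x$; (iii) $u\in L^{p_2}_tL^\infty_x$ and $Eu\in L^{p_1}_tL^1_x$; (iv) $u\in L^{p_2}_tL^2_x$ and $Eu\in L^{p_1}_tL^\infty_x$. Similarly, $D^\ell_{\rm CET}\to0$ in $L^1_{x,t}$ under any of the following assumptions: (v) $u\in L^3_tB^{1/3}_{3,VMO}$; (vi) $u\in L^{p_1}_tBD_x\cap L^{p_2}_tVMO_x$; (vii) $u\in L^{p_2}_tL^2_x$ and $Eu\in L^{p_1}_tL^\infty_x$. In each case the integrals (and, for $D^\ell_{\rm CET}$, the gradient $\nabla u_\ell$) that define $D^\ell$ exist at almost every point of each compact $K\subset\Omega\times(0,T)$, once $\ell$ is small enough. -/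

import Mathlib

open MeasureTheory Set Filter Metric
open scoped Topology ENNReal ContDiff Convolution Gradient

noncomputable section

namespace Onsager

/-- The Euclidean space `ℝ^d`. -/
abbrev Sp (d : ℕ) := EuclideanSpace ℝ (Fin d)

/-- `d × d` real matrices, with the Euclidean (Frobenius) norm. -/
abbrev Mat (d : ℕ) := EuclideanSpace ℝ (Fin d × Fin d)

variable {d : ℕ}

/-! ### The two approximations of the dissipation -/

/-- The space increment `δ_{ℓz} u(x,t) = u(x + ℓz, t) - u(x, t)`. -/
def increment (u : Sp d → ℝ → Sp d) (ℓ : ℝ) (z x : Sp d) (t : ℝ) : Sp d :=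
  u (x + ℓ • z) t - u x t

/-- The integrand (in `z`) of the Duchon--Robert approximation at `p = (x,t)`. -/
def integrandDR (ρ : Sp d → ℝ) (u : Sp d → ℝ → Sp d) (ℓ : ℝ) (p : Sp d × ℝ) (z : Sp d) : ℝ :=
  inner ℝ (∇ ρ z) ((1 / (4 * ℓ)) • increment u ℓ z p.1 p.2) * ‖increment u ℓ z p.1 p.2‖ ^ 2

/-- The Duchon--Robert approximation
`D^ℓ_DR (x,t) = ∫ ∇ρ(z) · δ_{ℓz}u(x,t) / (4ℓ) |δ_{ℓz}u(x,t)|² dz`. -/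
def dissDR (ρ : Sp d → ℝ) (u : Sp d → ℝ → Sp d) (ℓ : ℝ) (p : Sp d × ℝ) : ℝ :=
  ∫ z, integrandDR ρ u ℓ p z

/-- The rescaled kernel `ρ_ℓ(y) = ℓ^{-d} ρ(y/ℓ)`. -/
def scaledKernel (ρ : Sp d → ℝ) (ℓ : ℝ) (y : Sp d) : ℝ :=
  (ℓ ^ d)⁻¹ * ρ (ℓ⁻¹ • y)

/-- The regularization `f_ℓ = ρ_ℓ * f` in the space variable. -/
def mollify {F : Type*} [NormedAddCommGroup F] [NormedSpace ℝ F]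
    (ρ : Sp d → ℝ) (ℓ : ℝ) (f : Sp d → F) : Sp d → F :=
  scaledKernel ρ ℓ ⋆[ContinuousLinearMap.lsmul ℝ ℝ] f

/-- The `(i,j)` entry of `v_ℓ ⊗ v_ℓ - (v ⊗ v)_ℓ`. -/
def stress (ρ : Sp d → ℝ) (ℓ : ℝ) (v : Sp d → Sp d) (i j : Fin d) (x : Sp d) : ℝ :=
  mollify ρ ℓ v x i * mollify ρ ℓ v x j - mollify ρ ℓ (fun y => v y i * v y j) x

/-- The Constantin--E--Titi approximation `D^ℓ_CET = R_ℓ : ∇u_ℓ`, where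
`R_ℓ = u_ℓ ⊗ u_ℓ - (u ⊗ u)_ℓ`. -/
def dissCET (ρ : Sp d → ℝ) (u : Sp d → ℝ → Sp d) (ℓ : ℝ) (p : Sp d × ℝ) : ℝ :=
  ∑ i, ∑ j, stress ρ ℓ (fun y => u y p.2) i j p.1 *
    (fderiv ℝ (mollify ρ ℓ (fun y => u y p.2)) p.1 (EuclideanSpace.single j 1)) i

/-- The space-time cylinder `Ω × (0,T)`. -/
def cylinder (Ω : Set (Sp d)) (T : ℝ) : Set (Sp d × ℝ) := Ω ×ˢ Ioo 0 T

/-- `F^ℓ → 0` in `L^1(K)` as `ℓ → 0⁺`, for every compact `K ⊆ Ω × (0,T)`. -/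
def TendstoZeroL1 (Ω : Set (Sp d)) (T : ℝ) (F : ℝ → Sp d × ℝ → ℝ) : Prop :=
  ∀ K : Set (Sp d × ℝ), IsCompact K → K ⊆ cylinder Ω T →
    (∀ᶠ ℓ in 𝓝[>] (0 : ℝ), MemLp (F ℓ) 1 (volume.restrict K)) ∧
    Tendsto (fun ℓ => eLpNorm (F ℓ) 1 (volume.restrict K)) (𝓝[>] 0) (𝓝 0)

/-- The integral that defines `D^ℓ_DR` converges absolutely at almost every point of each compact
set, once `ℓ` is small. -/
def WellDefinedDR (Ω : Set (Sp d)) (T : ℝ) (ρ : Sp d → ℝ) (u : Sp d → ℝ → Sp d) : Prop :=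
  ∀ K : Set (Sp d × ℝ), IsCompact K → K ⊆ cylinder Ω T → ∀ᶠ ℓ in 𝓝[>] (0 : ℝ),
    ∀ᵐ p ∂(volume.restrict K), Integrable (integrandDR ρ u ℓ p)

/-- The integrals and the derivative that define `D^ℓ_CET` exist at almost every point of each
compact set, once `ℓ` is small. -/
def WellDefinedCET (Ω : Set (Sp d)) (T : ℝ) (ρ : Sp d → ℝ) (u : Sp d → ℝ → Sp d) : Prop :=
  ∀ K : Set (Sp d × ℝ), IsCompact K → K ⊆ cylinder Ω T → ∀ᶠ ℓ in 𝓝[>] (0 : ℝ),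
    ∀ᵐ p ∂(volume.restrict K),
      ConvolutionExistsAt (scaledKernel ρ ℓ) (fun y => u y p.2) p.1
        (ContinuousLinearMap.lsmul ℝ ℝ) volume ∧
      (∀ i j, ConvolutionExistsAt (scaledKernel ρ ℓ) (fun y => u y p.2 i * u y p.2 j) p.1
        (ContinuousLinearMap.lsmul ℝ ℝ) volume) ∧
      DifferentiableAt ℝ (mollify ρ ℓ (fun y => u y p.2)) p.1

/-- `D^ℓ_DR` is well defined and tends to `0` in `L^1_{x,t}`, locally in `Ω × (0,T)`. -/
def VanishesDR (Ω : Set (Sp d)) (T : ℝ) (ρ : Sp d → ℝ) (u : Sp d → ℝ → Sp d) : Prop :=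
  WellDefinedDR Ω T ρ u ∧ TendstoZeroL1 Ω T (dissDR ρ u)

/-- `D^ℓ_CET` is well defined and tends to `0` in `L^1_{x,t}`, locally in `Ω × (0,T)`. -/
def VanishesCET (Ω : Set (Sp d)) (T : ℝ) (ρ : Sp d → ℝ) (u : Sp d → ℝ → Sp d) : Prop :=
  WellDefinedCET Ω T ρ u ∧ TendstoZeroL1 Ω T (dissCET ρ u)

/-! ### Norms on an open set `O`

Every norm takes values in `[0,∞]` and is `∞` off the space. -/

/-- The modulus `ℓ^{-α} (∫ ⨍_{B_ℓ(0)} |v(x+y) - v(x)|^p dy dx)^{1/p}`, where only the pairs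
`x, x + y ∈ O` are taken into account. -/
def besovModulus (α p : ℝ) (O : Set (Sp d)) (v : Sp d → Sp d) (ℓ : ℝ) : ℝ≥0∞ :=
  (ENNReal.ofReal (ℓ ^ α))⁻¹ *
    (∫⁻ x in O, (volume (ball (0 : Sp d) ℓ))⁻¹ *
      ∫⁻ y in ball (0 : Sp d) ℓ ∩ {y | x + y ∈ O}, ‖v (x + y) - v x‖ₑ ^ p) ^ (1 / p)

/-- The norm of `B^α_{p,BMO}(O)`. -/
def besovNorm (α p : ℝ) (O : Set (Sp d)) (v : Sp d → Sp d) : ℝ≥0∞ :=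
  eLpNorm v (ENNReal.ofReal p) (volume.restrict O) +
    ⨆ (ℓ : ℝ) (_ : 0 < ℓ), besovModulus α p O v ℓ

/-- The vanishing condition that singles out `B^α_{p,VMO}(O)` in `B^α_{p,BMO}(O)`. -/
def BesovVanishing (α p : ℝ) (O : Set (Sp d)) (v : Sp d → Sp d) : Prop :=
  Tendsto (besovModulus α p O v) (𝓝[>] 0) (𝓝 0)

/-- The largest mean oscillation of `v` over the balls of radius `ℓ` inside `O`. -/
def meanOsc (O : Set (Sp d)) (v : Sp d → Sp d) (ℓ : ℝ) : ℝ≥0∞ :=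
  ⨆ (x : Sp d) (_ : ball x ℓ ⊆ O),
    laverage (volume.restrict (ball x ℓ)) fun y => ‖v y - ⨍ z in ball x ℓ, v z‖ₑ

/-- The `BMO(O)` (semi)norm. -/
def bmoNorm (O : Set (Sp d)) (v : Sp d → Sp d) : ℝ≥0∞ :=
  ⨆ (ℓ : ℝ) (_ : 0 < ℓ), meanOsc O v ℓ

/-- The vanishing condition that singles out `VMO(O)` in `BMO(O)`. -/
def VMOVanishing (O : Set (Sp d)) (v : Sp d → Sp d) : Prop :=
  Tendsto (meanOsc O v) (𝓝[>] 0) (𝓝 0)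

/-- The partial derivative `∂_i φ (x)`. -/
def partialDeriv (i : Fin d) (φ : Sp d → ℝ) (x : Sp d) : ℝ :=
  fderiv ℝ φ x (EuclideanSpace.single i 1)

/-- Test functions: smooth functions with compact support in `O`. -/
def IsTest (O : Set (Sp d)) (φ : Sp d → ℝ) : Prop :=
  ContDiff ℝ ∞ φ ∧ HasCompactSupport φ ∧ tsupport φ ⊆ O

/-- The distributional pairing of `(Ev)_{ij} = (∂_j v_i + ∂_i v_j) / 2` with `φ`. -/
def symGradPairing (v : Sp d → Sp d) (φ : Sp d → ℝ) (i j : Fin d) : ℝ :=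
  -(1 / 2) * ∫ x, (v x i * partialDeriv j φ x + v x j * partialDeriv i φ x)

/-- On `O`, the distributional symmetric gradient `Ev` is the finite matrix-valued measure `μ`. -/
def IsSymGradMeasure (O : Set (Sp d)) (v : Sp d → Sp d) (μ : VectorMeasure (Sp d) (Mat d)) :
    Prop :=
  LocallyIntegrableOn v O ∧ ∀ φ, IsTest O φ → ∀ i j,
    (VectorMeasure.integral μ φ (ContinuousLinearMap.lsmul ℝ ℝ)) (i, j) = symGradPairing v φ i j

/-- On `O`, the distributional symmetric gradient `Ev` is the locally integrable function `G`. -/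
def IsSymGradFun (O : Set (Sp d)) (v : Sp d → Sp d) (G : Sp d → Mat d) : Prop :=
  LocallyIntegrableOn v O ∧ LocallyIntegrableOn G O ∧ ∀ φ, IsTest O φ → ∀ i j,
    (∫ x, φ x * G x (i, j)) = symGradPairing v φ i j

/-- The norm `‖v‖_{L^1(O)} + |Ev|(O)` of `BD(O)`, where `|Ev|` is the total variation of the
measure `Ev` (which is unique on `O`, so that the infimum only encodes its existence). -/
def bdNorm (O : Set (Sp d)) (v : Sp d → Sp d) : ℝ≥0∞ :=
  eLpNorm v 1 (volume.restrict O) +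
    ⨅ (μ : VectorMeasure (Sp d) (Mat d)) (_ : IsSymGradMeasure O v μ), μ.variation O

/-- The norm `‖Ev‖_{L^q(O)}`, for a function `Ev` (which is unique a.e. on `O`, so that the
infimum only encodes its existence). -/
def symGradNorm (q : ℝ≥0∞) (O : Set (Sp d)) (v : Sp d → Sp d) : ℝ≥0∞ :=
  ⨅ (G : Sp d → Mat d) (_ : IsSymGradFun O v G), eLpNorm G q (volume.restrict O)

/-- The norm of `L^q(O)`. -/
def lebNorm (q : ℝ≥0∞) (O : Set (Sp d)) (v : Sp d → Sp d) : ℝ≥0∞ :=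
  eLpNorm v q (volume.restrict O)

/-! ### Time-dependent classes, local in `Ω × (0,T)` -/

/-- `O ⊂⊂ Ω`, with `O` open. -/
def CompactlyInside (O Ω : Set (Sp d)) : Prop :=
  IsOpen O ∧ IsCompact (closure O) ∧ closure O ⊆ Ω

/-- The norms `‖u(t)‖_{X(O)}` are `L^p` in time on compact subsets of `(0,T)`, for each
`O ⊂⊂ Ω`. -/
def NormInLp (Ω : Set (Sp d)) (T : ℝ) (p : ℝ≥0∞) (X : Set (Sp d) → (Sp d → Sp d) → ℝ≥0∞)
    (u : Sp d → ℝ → Sp d) : Prop :=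
  ∀ O, CompactlyInside O Ω → ∀ J : Set ℝ, IsCompact J → J ⊆ Ioo 0 T →
    ∃ g : ℝ → ℝ, MemLp g p (volume.restrict J) ∧
      ∀ᵐ t ∂(volume.restrict J), X O (fun x => u x t) ≤ ENNReal.ofReal (g t)

/-- For almost every `t ∈ (0,T)`, the condition `P` holds for `u(t)` on each `O ⊂⊂ Ω`. -/
def AlmostAllTimes (Ω : Set (Sp d)) (T : ℝ) (P : Set (Sp d) → (Sp d → Sp d) → Prop)
    (u : Sp d → ℝ → Sp d) : Prop :=
  ∀ᵐ t ∂(volume.restrict (Ioo 0 T)), ∀ O, CompactlyInside O Ω → P O (fun x => u x t)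

/-- `v` agrees a.e. on `O` with a function that is continuous on `O`. -/
def HasContinuousRep (O : Set (Sp d)) (v : Sp d → Sp d) : Prop :=
  ∃ w : Sp d → Sp d, ContinuousOn w O ∧ v =ᵐ[volume.restrict O] w

/-- `u ∈ L^p_t B^α_{q,VMO}`. -/
def InLpBesovVMO (Ω : Set (Sp d)) (T : ℝ) (p : ℝ≥0∞) (α q : ℝ) (u : Sp d → ℝ → Sp d) : Prop :=
  NormInLp Ω T p (besovNorm α q) u ∧ AlmostAllTimes Ω T (BesovVanishing α q) u

/-- `u ∈ L^p_t BD_x`. -/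
def InLpBD (Ω : Set (Sp d)) (T : ℝ) (p : ℝ≥0∞) (u : Sp d → ℝ → Sp d) : Prop :=
  NormInLp Ω T p bdNorm u

/-- `u ∈ L^p_t C^0_x` (on continuous functions the supremum over the open set `O` is the essential
supremum). -/
def InLpC0 (Ω : Set (Sp d)) (T : ℝ) (p : ℝ≥0∞) (u : Sp d → ℝ → Sp d) : Prop :=
  NormInLp Ω T p (lebNorm ∞) u ∧ AlmostAllTimes Ω T HasContinuousRep u

/-- `u ∈ L^p_t VMO_x`. -/
def InLpVMO (Ω : Set (Sp d)) (T : ℝ) (p : ℝ≥0∞) (u : Sp d → ℝ → Sp d) : Prop :=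
  NormInLp Ω T p bmoNorm u ∧ AlmostAllTimes Ω T VMOVanishing u

/-- `u ∈ L^p_t L^q_x`. -/
def InLpLq (Ω : Set (Sp d)) (T : ℝ) (p q : ℝ≥0∞) (u : Sp d → ℝ → Sp d) : Prop :=
  NormInLp Ω T p (lebNorm q) u

/-- `Eu ∈ L^p_t L^q_x`. -/
def SymGradInLpLq (Ω : Set (Sp d)) (T : ℝ) (p q : ℝ≥0∞) (u : Sp d → ℝ → Sp d) : Prop :=
  NormInLp Ω T p (symGradNorm q) u

end Onsager

end

noncomputable section

namespace Onsager

variable {d : ℕ} {ρ : Sp d → ℝ} {R C : ℝ}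

/-! ### Measure-theoretic preliminaries -/

/-! The argument takes place at a fixed time. The kernel lives in a ball of radius `R`, so at a
point of a compact set only the values of `u` at distance at most `R * ℓ` matter, and `u` may be
replaced by its extension by zero from a slightly larger open set. For almost every time one proves
convergence to zero together with a bound by a function of time that does not depend on `ℓ`. That
function is integrable by Hölder, since `1/p₁ + 2/p₂ = 1`, and dominated convergence in time
concludes (`tendstoZeroL1_of_ae_time`).

Besov fields. Both approximations are bounded by `ℓ⁻¹` times the mean cubic increment. For
Duchon--Robert this is immediate. For Constantin--Energy flux terms, unit mass of the kernel makes
the stress quadratic in increments, and the zero mean of its derivative makes `∇u_ℓ` equal to `ℓ⁻¹`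
times a linear average of increments. The integral in space is then the cube of the Besov modulus at
scale `R * ℓ`.

Duchon--Robert and `Eu`. For a smooth field, integration by parts in `z` moves the derivative from
the kernel to the cubic expression; the chain rule gives a factor `ℓ` that cancels `1/ℓ`, and the
quadratic form in the increment sees only the symmetric gradient (`dissDR_eq_of_contDiff`). If `Eu`
is dominated by `M dx + ν`, mollification and Fatou give the bound `M ‖δu‖²_{L²} + (sup |δu|)² ν`
for bounded fields (`lintegral_dissDR_le`). Continuity makes the second term small when `M = 0`; for
integrable `Eu` one truncates at height `n`, with `M = n` and `ν` the tail; for bounded `Eu` one has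
`ν = 0`. In the last case local boundedness of the field is deduced from `Eu` itself
(`enorm_le_of_symGrad_bounded`).

Constantin--E--Titi and `Eu`. The stress is symmetric, so it meets only the symmetric part of
`∇u_ℓ`, which is the mollification of `Eu`. Either `Eu` is bounded and the stress is small in `L¹`,
or `Eu` has finite mass and the stress is uniformly small. The latter needs the mean square
oscillation to be controlled by the mean oscillation, that is, the John--Nirenberg inequality in
`L²` (`sq_oscillation_le`), proved by a Calderón--Zygmund covering and absorption. -/

theorem mul_pow_le_pow_add_pow (a b : ℝ≥0∞) (m n : ℕ) :
    a ^ m * b ^ n ≤ a ^ (m + n) + b ^ (m + n) := by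
  rcases le_total a b with h | h
  · calc a ^ m * b ^ n ≤ b ^ m * b ^ n := by gcongr
      _ = b ^ (m + n) := (pow_add _ _ _).symm
      _ ≤ _ := le_add_self
  · calc a ^ m * b ^ n ≤ a ^ m * a ^ n := by gcongr
      _ = a ^ (m + n) := (pow_add _ _ _).symm
      _ ≤ _ := le_self_add

/-- The product is a double integral of mixed powers, each at most the sum of the two pure powers.
This replaces Hölder at the cost of a factor `2`, which is harmless here. -/
theorem lintegral_pow_mul_lintegral_pow_le {α : Type*} [MeasurableSpace α] (μ : Measure α)
    {h : α → ℝ≥0∞} (hh : AEMeasurable h μ) (m n : ℕ) :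
    (∫⁻ a, h a ^ m ∂μ) * (∫⁻ b, h b ^ n ∂μ) ≤ 2 * μ univ * ∫⁻ a, h a ^ (m + n) ∂μ := by
  calc (∫⁻ a, h a ^ m ∂μ) * (∫⁻ b, h b ^ n ∂μ)
      = ∫⁻ a, ∫⁻ b, h a ^ m * h b ^ n ∂μ ∂μ :=
        (lintegral_lintegral_mul (hh.pow_const m) (hh.pow_const n)).symm
    _ ≤ ∫⁻ a, ∫⁻ b, (h a ^ (m + n) + h b ^ (m + n)) ∂μ ∂μ := by
        gcongr with a b; exact mul_pow_le_pow_add_pow _ _ _ _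
    _ = ∫⁻ a, (h a ^ (m + n) * μ univ + ∫⁻ b, h b ^ (m + n) ∂μ) ∂μ := by
        congr 1; ext a
        rw [lintegral_add_left measurable_const, lintegral_const]
    _ = 2 * μ univ * ∫⁻ a, h a ^ (m + n) ∂μ := by
        rw [lintegral_add_right _ measurable_const, lintegral_const,
          lintegral_mul_const'' _ (hh.pow_const _)]
        ring

theorem sq_lintegral_le {α : Type*} [MeasurableSpace α] (μ : Measure α)
    {h : α → ℝ≥0∞} (hh : AEMeasurable h μ) :
    (∫⁻ a, h a ∂μ) ^ 2 ≤ 2 * μ univ * ∫⁻ a, h a ^ 2 ∂μ := by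
  simpa [sq] using lintegral_pow_mul_lintegral_pow_le μ hh 1 1

/-! ### Continuity of translations in `L²`. -/

theorem tendsto_lintegral_translate_sub_sq {f : Sp d → Sp d} (hf : MemLp f 2) :
    Tendsto (fun h : Sp d => ∫⁻ x, ‖f (x + h) - f x‖ₑ ^ 2) (𝓝 0) (𝓝 0) := by
  have hmp : ∀ h : Sp d, MeasurePreserving (fun x : Sp d => x + h) volume volume :=
    fun h => measurePreserving_add_right _ h
  let g : Sp d → C(Sp d, Sp d) := fun h => ⟨fun x => x + h, by fun_prop⟩
  -- Translations depend continuously on the shift in the compact-open topology, which suffices for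
  -- continuity of composition in `L²`.
  have hg : Continuous g := by
    have : Continuous fun p : Sp d × Sp d => p.2 + p.1 := by fun_prop
    exact (ContinuousMap.curry ⟨fun p : Sp d × Sp d => p.2 + p.1, this⟩).continuous
  have key := (continuous_const (y := hf.toLp f)).compMeasurePreservingLp hg hmp (by simp)
  have k0 := (key.tendsto 0)
  have k1 := (tendsto_iff_edist_tendsto_0.1 k0)
  have k2 : Tendsto (fun h : Sp d => eLpNorm (fun x => f (x + h) - f x) 2 volume) (𝓝 0) (𝓝 0) := by
    refine k1.congr fun h => ?_
    rw [Lp.edist_def]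
    refine eLpNorm_congr_ae ?_
    have e1 := Lp.coeFn_compMeasurePreserving (hf.toLp f) (hmp h)
    have e2 := Lp.coeFn_compMeasurePreserving (hf.toLp f) (hmp 0)
    have e3 := hf.coeFn_toLp
    have e4 := (hmp h).quasiMeasurePreserving.ae_eq_comp e3
    filter_upwards [e1, e2, e3, e4] with x h1 h2 h3 h4
    simp only [Pi.sub_apply]
    refine congr_arg₂ _ (h1.trans h4) (h2.trans ?_)
    simp [h3]
  have k3 : Tendsto (fun h : Sp d => eLpNorm (fun x => f (x + h) - f x) 2 volume ^ 2)
      (𝓝 0) (𝓝 0) := by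
    simpa using ENNReal.Tendsto.pow (n := 2) k2
  refine k3.congr fun h => ?_
  rw [eLpNorm_eq_lintegral_rpow_enorm_toReal (by simp) (by simp), ← ENNReal.rpow_natCast,
    ← ENNReal.rpow_mul]
  simp

/-- The squared `L²` size of the increments at scale `ℓ`. -/
def incrementSq (f : Sp d → Sp d) (R ℓ : ℝ) : ℝ≥0∞ :=
  ∫⁻ z in closedBall (0 : Sp d) R, ∫⁻ x, ‖f (x + ℓ • z) - f x‖ₑ ^ 2

theorem tendsto_incrementSq {f : Sp d → Sp d} (hf : MemLp f 2) (R : ℝ) :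
    Tendsto (incrementSq f R) (𝓝[>] 0) (𝓝 0) := by
  have h0 := tendsto_lintegral_translate_sub_sq hf
  set V := volume (closedBall (0 : Sp d) R) with hV
  have hVt : V ≠ ⊤ := measure_closedBall_lt_top.ne
  rw [ENNReal.tendsto_nhds_zero]
  intro ε hε
  obtain ⟨η, hη, hηε⟩ : ∃ η : ℝ≥0∞, 0 < η ∧ η * V ≤ ε := by
    by_cases hε' : ε = ⊤
    · exact ⟨1, by simp, by simp [hε']⟩
    -- The denominator is `V + 1` because `V` vanishes when `R` is negative.
    refine ⟨ε / (V + 1), ENNReal.div_pos hε.ne' (by simp [hVt]), ?_⟩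
    calc ε / (V + 1) * V ≤ ε / (V + 1) * (V + 1) := by gcongr; exact le_self_add
      _ = ε := ENNReal.div_mul_cancel (by simp) (by simp [hVt])
  obtain ⟨r, hr, hball⟩ := Metric.eventually_nhds_iff.1 ((ENNReal.tendsto_nhds_zero.1 h0) η hη)
  have hev : ∀ᶠ ℓ in 𝓝[>] (0 : ℝ), |ℓ| * (|R| + 1) < r := by
    have : Tendsto (fun ℓ : ℝ => |ℓ| * (|R| + 1)) (𝓝[>] 0) (𝓝 0) := by
      have : Continuous (fun ℓ : ℝ => |ℓ| * (|R| + 1)) := by fun_prop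
      simpa using (this.tendsto 0).mono_left nhdsWithin_le_nhds
    exact this.eventually_lt_const hr
  filter_upwards [hev] with ℓ hℓ
  calc incrementSq f R ℓ ≤ ∫⁻ z in closedBall (0 : Sp d) R, η := by
        refine setLIntegral_mono' measurableSet_closedBall fun z hz => hball ?_
        rw [dist_zero_right, norm_smul, Real.norm_eq_abs]
        refine lt_of_le_of_lt ?_ hℓ
        have := mem_closedBall_zero_iff.1 hz
        gcongr
        exact this.trans ((le_abs_self R).trans (by linarith))
    _ = η * V := by rw [setLIntegral_const]
    _ ≤ ε := hηε

theorem enorm_sub_sq_le (a b : Sp d) : ‖a - b‖ₑ ^ 2 ≤ 2 * (‖a‖ₑ ^ 2 + ‖b‖ₑ ^ 2) := by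
  have h : ‖a - b‖ ^ 2 ≤ 2 * (‖a‖ ^ 2 + ‖b‖ ^ 2) := by
    nlinarith [norm_sub_le a b, norm_nonneg (a - b), sq_nonneg (‖a‖ - ‖b‖)]
  simp only [← ofReal_norm, ← ENNReal.ofReal_pow (norm_nonneg _)]
  rw [← ENNReal.ofReal_add (by positivity) (by positivity)]
  refine (ENNReal.ofReal_le_ofReal h).trans_eq ?_
  rw [ENNReal.ofReal_mul (by norm_num), ENNReal.ofReal_ofNat]

theorem incrementSq_le {f : Sp d → Sp d} (hf : AEStronglyMeasurable f volume) (R ℓ : ℝ) :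
    incrementSq f R ℓ ≤ 4 * volume (closedBall (0 : Sp d) R) * ∫⁻ x, ‖f x‖ₑ ^ 2 := by
  calc incrementSq f R ℓ
      ≤ ∫⁻ z in closedBall (0 : Sp d) R, 4 * ∫⁻ x, ‖f x‖ₑ ^ 2 := by
        unfold incrementSq
        gcongr with z
        calc ∫⁻ x, ‖f (x + ℓ • z) - f x‖ₑ ^ 2
            ≤ ∫⁻ x, 2 * (‖f (x + ℓ • z)‖ₑ ^ 2 + ‖f x‖ₑ ^ 2) := by
              gcongr with x; exact enorm_sub_sq_le _ _
          _ = 2 * ((∫⁻ x, ‖f (x + ℓ • z)‖ₑ ^ 2) + ∫⁻ x, ‖f x‖ₑ ^ 2) := by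
              rw [lintegral_const_mul' _ _ (by simp), lintegral_add_right' _ (hf.enorm.pow_const 2)]
          _ = 4 * ∫⁻ x, ‖f x‖ₑ ^ 2 := by
              rw [lintegral_add_right_eq_self (fun x => ‖f x‖ₑ ^ 2)]; ring
    _ = _ := by rw [setLIntegral_const]; ring

/-! ### Dominated convergence in time -/

theorem tendsto_lintegral_filter_of_dominated_convergence_aemeasurable {α ι : Type*}
    [MeasurableSpace α] {μ : Measure α} {l : Filter ι} [l.IsCountablyGenerated]
    {F : ι → α → ℝ≥0∞} {f : α → ℝ≥0∞} (bound : α → ℝ≥0∞)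
    (hF : ∀ᶠ n in l, AEMeasurable (F n) μ) (hb : ∀ᶠ n in l, ∀ᵐ a ∂μ, F n a ≤ bound a)
    (hfin : ∫⁻ a, bound a ∂μ ≠ ⊤) (hlim : ∀ᵐ a ∂μ, Tendsto (fun n => F n a) l (𝓝 (f a))) :
    Tendsto (fun n => ∫⁻ a, F n a ∂μ) l (𝓝 (∫⁻ a, f a ∂μ)) := by
  refine tendsto_of_seq_tendsto fun x hx => ?_
  obtain ⟨N, hN⟩ := eventually_atTop.1 (hx.eventually (hF.and hb))
  -- The hypotheses hold only eventually along the filter, so the sequence is shifted past the index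
  -- where they start.
  rw [← tendsto_add_atTop_iff_nat N]
  refine tendsto_lintegral_of_dominated_convergence' bound
    (fun n => (hN _ (Nat.le_add_left N n)).1) (fun n => (hN _ (Nat.le_add_left N n)).2) hfin ?_
  filter_upwards [hlim] with a ha
  exact ha.comp (hx.comp (tendsto_add_atTop_nat N))

theorem exists_compact_prod {Ω : Set (Sp d)} {T : ℝ} {K : Set (Sp d × ℝ)} (hK : IsCompact K)
    (hKΩ : K ⊆ cylinder Ω T) :
    ∃ (A : Set (Sp d)) (J : Set ℝ), IsCompact A ∧ A ⊆ Ω ∧ IsCompact J ∧ J ⊆ Ioo 0 T ∧ K ⊆ A ×ˢ J := by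
  refine ⟨Prod.fst '' K, Prod.snd '' K, hK.image continuous_fst, ?_, hK.image continuous_snd, ?_, ?_⟩
  · rintro _ ⟨p, hp, rfl⟩; exact (hKΩ hp).1
  · rintro _ ⟨p, hp, rfl⟩; exact (hKΩ hp).2
  · intro p hp; exact ⟨⟨p, hp, rfl⟩, ⟨p, hp, rfl⟩⟩

/-- Tonelli writes the `L¹` norm over a product as the time integral of the norms of the slices, to
which dominated convergence with the majorant `g` applies. A compact `K` is enclosed in the product
of its projections. -/
theorem tendstoZeroL1_of_ae_time {Ω : Set (Sp d)} {T : ℝ} {F : ℝ → Sp d × ℝ → ℝ}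
    (h : ∀ (A : Set (Sp d)) (J : Set ℝ), IsCompact A → A ⊆ Ω → IsCompact J → J ⊆ Ioo 0 T →
      ∃ g : ℝ → ℝ≥0∞, ∫⁻ t in J, g t ≠ ⊤ ∧
        (∀ᶠ ℓ in 𝓝[>] (0 : ℝ), AEStronglyMeasurable (F ℓ) (volume.restrict (A ×ˢ J)) ∧
          ∀ᵐ t ∂(volume.restrict J), ∫⁻ x in A, ‖F ℓ (x, t)‖ₑ ≤ g t) ∧
        ∀ᵐ t ∂(volume.restrict J),
          Tendsto (fun ℓ => ∫⁻ x in A, ‖F ℓ (x, t)‖ₑ) (𝓝[>] 0) (𝓝 0)) :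
    TendstoZeroL1 Ω T F := by
  intro K hK hKΩ
  obtain ⟨A, J, hA, hAΩ, hJ, hJT, hKAJ⟩ := exists_compact_prod hK hKΩ
  obtain ⟨g, hg, hb, hlim⟩ := h A J hA hAΩ hJ hJT
  have hprod : (volume : Measure (Sp d × ℝ)).restrict (A ×ˢ J)
      = (volume.restrict A).prod (volume.restrict J) := by
    rw [Measure.volume_eq_prod, Measure.prod_restrict]
  have hrepr : ∀ ℓ, AEStronglyMeasurable (F ℓ) (volume.restrict (A ×ˢ J)) →
      ∫⁻ p in A ×ˢ J, ‖F ℓ p‖ₑ = ∫⁻ t in J, ∫⁻ x in A, ‖F ℓ (x, t)‖ₑ := by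
    intro ℓ hm
    rw [hprod] at hm ⊢
    exact lintegral_prod_symm _ hm.enorm
  have hT : Tendsto (fun ℓ => ∫⁻ t in J, ∫⁻ x in A, ‖F ℓ (x, t)‖ₑ) (𝓝[>] 0) (𝓝 0) := by
    have := tendsto_lintegral_filter_of_dominated_convergence_aemeasurable (μ := volume.restrict J)
      (l := 𝓝[>] (0 : ℝ)) (F := fun ℓ t => ∫⁻ x in A, ‖F ℓ (x, t)‖ₑ) (f := fun _ => 0) g ?_
      (hb.mono fun ℓ h => h.2) hg hlim
    · simpa using this
    · filter_upwards [hb] with ℓ hℓ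
      have := hℓ.1
      rw [hprod] at this
      exact this.enorm.lintegral_prod_left'
  have hle : ∀ ℓ, eLpNorm (F ℓ) 1 (volume.restrict K) ≤ ∫⁻ p in A ×ˢ J, ‖F ℓ p‖ₑ := fun ℓ => by
    rw [eLpNorm_one_eq_lintegral_enorm]
    exact lintegral_mono_set hKAJ
  constructor
  · filter_upwards [hb] with ℓ hℓ
    refine ⟨hℓ.1.mono_measure (Measure.restrict_mono hKAJ le_rfl), ?_⟩
    refine (hle ℓ).trans_lt ?_
    rw [hrepr ℓ hℓ.1]
    exact (lintegral_mono_ae hℓ.2).trans_lt hg.lt_top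
  · refine tendsto_of_tendsto_of_tendsto_of_le_of_le' tendsto_const_nhds hT
      (Eventually.of_forall fun _ => zero_le) ?_
    filter_upwards [hb] with ℓ hℓ
    exact (hle ℓ).trans (hrepr ℓ hℓ.1).le

/-! ### Measurability in space-time -/

theorem quasiMeasurePreserving_add_smul (x : Sp d) {ℓ : ℝ} (hℓ : ℓ ≠ 0) :
    Measure.QuasiMeasurePreserving (fun z : Sp d => x + ℓ • z) volume volume := by
  have h1 : Measure.QuasiMeasurePreserving (fun z : Sp d => ℓ • z) volume volume := by
    refine ⟨by fun_prop, Measure.AbsolutelyContinuous.mk fun s hs h0 => ?_⟩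
    rw [Measure.map_apply (by fun_prop) hs, Measure.addHaar_preimage_smul _ hℓ, h0, mul_zero]
  exact (measurePreserving_add_left volume x).quasiMeasurePreserving.comp h1

theorem ae_time_ae_space {Ω : Set (Sp d)} {T : ℝ} {P : Sp d × ℝ → Prop}
    (h : ∀ᵐ p ∂(volume.restrict (cylinder Ω T)), P p) :
    ∀ᵐ t ∂(volume.restrict (Ioo 0 T)), ∀ᵐ y ∂(volume.restrict Ω), P (y, t) := by
  rw [cylinder, Measure.volume_eq_prod, ← Measure.prod_restrict] at h
  have h' := (Measure.measurePreserving_swap (μ := volume.restrict (Ioo 0 T))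
    (ν := (volume : Measure (Sp d)).restrict Ω)).quasiMeasurePreserving.ae h
  exact Measure.ae_ae_of_ae_prod h'

theorem ae_aestronglyMeasurable_slice {Ω : Set (Sp d)} {T : ℝ} {u : Sp d → ℝ → Sp d}
    (hu : AEStronglyMeasurable (fun p : Sp d × ℝ => u p.1 p.2) (volume.restrict (cylinder Ω T))) :
    ∀ᵐ t ∂(volume.restrict (Ioo 0 T)),
      AEStronglyMeasurable (fun y => u y t) (volume.restrict Ω) := by
  filter_upwards [ae_time_ae_space hu.ae_eq_mk] with t ht
  exact ⟨fun y => hu.mk _ (y, t),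
    hu.stronglyMeasurable_mk.comp_measurable measurable_prodMk_right, ht⟩

theorem ae_restrict_prod_of_ae_time {A : Set (Sp d)} {J : Set ℝ} {P : ℝ → Prop}
    (h : ∀ᵐ t ∂(volume.restrict J), P t) : ∀ᵐ p ∂(volume.restrict (A ×ˢ J)), P p.2 := by
  rw [Measure.volume_eq_prod, ← Measure.prod_restrict]
  exact Measure.quasiMeasurePreserving_snd.ae h

/-- One replaces `u` by a strongly measurable representative. For almost every time the two agree
almost everywhere in `Ω`, and `z ↦ x + ℓ • z` pulls null sets back to null sets, so the integrals
over `z` coincide. Since `Φ` vanishes off the ball of radius `R`, values of `u` outside `Ω` play no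
role. -/
theorem aestronglyMeasurable_integral_comp_increment {Ω : Set (Sp d)} {T : ℝ}
    {u : Sp d → ℝ → Sp d} (hΩ : IsOpen Ω)
    (hu : AEStronglyMeasurable (fun p : Sp d × ℝ => u p.1 p.2) (volume.restrict (cylinder Ω T)))
    {A : Set (Sp d)} {J : Set ℝ} (hA : IsCompact A) (hAΩ : A ⊆ Ω) (hJ : IsCompact J)
    (hJT : J ⊆ Ioo 0 T) {R ℓ : ℝ} (hℓ : ℓ ≠ 0)
    (hR : ∀ x ∈ A, ∀ z ∈ closedBall (0 : Sp d) R, x + ℓ • z ∈ Ω)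
    {Φ : Sp d × Sp d × Sp d → ℝ} (hΦ : Continuous Φ)
    (hΦR : ∀ z ∉ closedBall (0 : Sp d) R, ∀ a b, Φ (z, a, b) = 0) :
    AEStronglyMeasurable (fun p : Sp d × ℝ => ∫ z, Φ (z, u (p.1 + ℓ • z) p.2, u p.1 p.2))
      (volume.restrict (A ×ˢ J)) := by
  set w : Sp d × ℝ → Sp d := hu.mk _ with hw
  have hwm : StronglyMeasurable w := hu.stronglyMeasurable_mk
  refine ⟨fun p => ∫ z, Φ (z, w (p.1 + ℓ • z, p.2), w p), ?_, ?_⟩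
  · apply StronglyMeasurable.integral_prod_right'
      (f := fun q : (Sp d × ℝ) × Sp d => Φ (q.2, w (q.1.1 + ℓ • q.2, q.1.2), w q.1))
    apply hΦ.comp_stronglyMeasurable
    refine (stronglyMeasurable_id.comp_measurable measurable_snd).prodMk
      ((hwm.comp_measurable ?_).prodMk (hwm.comp_measurable measurable_fst))
    fun_prop
  · have h1 : ∀ᵐ p ∂(volume.restrict (A ×ˢ J)), u p.1 p.2 = w p :=
      ae_restrict_of_ae_restrict_of_subset (prod_mono hAΩ hJT) hu.ae_eq_mk
    have h2 : ∀ᵐ p ∂(volume.restrict (A ×ˢ J)),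
        ∀ᵐ y ∂((volume : Measure (Sp d)).restrict Ω), u y p.2 = w (y, p.2) :=
      ae_restrict_prod_of_ae_time
        (ae_restrict_of_ae_restrict_of_subset hJT (ae_time_ae_space hu.ae_eq_mk))
    have h3 := ae_restrict_mem (μ := (volume : Measure (Sp d × ℝ)))
      (hA.measurableSet.prod hJ.measurableSet)
    filter_upwards [h1, h2, h3] with p hp1 hp2 hp3
    rw [ae_restrict_iff' hΩ.measurableSet] at hp2
    refine integral_congr_ae ?_
    filter_upwards [(quasiMeasurePreserving_add_smul p.1 hℓ).ae hp2] with z hz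
    by_cases hzR : z ∈ closedBall (0 : Sp d) R
    · rw [hz (hR _ hp3.1 _ hzR), hp1]
    · rw [hΦR _ hzR, hΦR _ hzR]


/-! ### The kernel and its averages -/

/-- An even smooth kernel supported in the ball of radius `R`, which is bounded by `C` together with
its derivative. -/
structure IsKernel (ρ : Sp d → ℝ) (R C : ℝ) : Prop where
  smooth : ContDiff ℝ ∞ ρ
  even : ∀ z, ρ (-z) = ρ z
  pos : 0 < R
  tsupport_subset : tsupport ρ ⊆ closedBall 0 R
  bound : ∀ z, ‖ρ z‖ ≤ C
  bound_fderiv : ∀ z, ‖fderiv ℝ ρ z‖ ≤ C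

theorem exists_isKernel {ρ : Sp d → ℝ} (h1 : ContDiff ℝ ∞ ρ) (h2 : HasCompactSupport ρ)
    (h3 : ∀ z, ρ (-z) = ρ z) : ∃ R C, IsKernel ρ R C := by
  obtain ⟨R, hR⟩ := h2.isCompact.isBounded.subset_closedBall 0
  obtain ⟨C₁, hC₁⟩ := h2.exists_bound_of_continuous h1.continuous
  obtain ⟨C₂, hC₂⟩ := (h2.fderiv ℝ).exists_bound_of_continuous (h1.continuous_fderiv (by simp))
  exact ⟨max R 1, max C₁ C₂, h1, h3, by positivity,
    hR.trans (closedBall_subset_closedBall (le_max_left _ _)),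
    fun z => (hC₁ z).trans (le_max_left _ _), fun z => (hC₂ z).trans (le_max_right _ _)⟩

namespace IsKernel
variable {ρ : Sp d → ℝ} {R C : ℝ}

theorem hasCompactSupport (h : IsKernel ρ R C) : HasCompactSupport ρ :=
  HasCompactSupport.of_support_subset_isCompact (isCompact_closedBall 0 R)
    ((subset_tsupport ρ).trans h.tsupport_subset)

theorem eq_zero (h : IsKernel ρ R C) {z : Sp d} (hz : z ∉ closedBall (0 : Sp d) R) : ρ z = 0 :=
  image_eq_zero_of_notMem_tsupport fun h' => hz (h.tsupport_subset h')

theorem fderiv_eq_zero (h : IsKernel ρ R C) {z : Sp d} (hz : z ∉ closedBall (0 : Sp d) R) :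
    fderiv ℝ ρ z = 0 :=
  image_eq_zero_of_notMem_tsupport
    fun h' => hz (h.tsupport_subset (tsupport_fderiv_subset ℝ h'))

theorem fderiv_neg (h : IsKernel ρ R C) (z : Sp d) : fderiv ℝ ρ (-z) = -fderiv ℝ ρ z := by
  have h1 : (fun y => ρ (-y)) = ρ := funext h.even
  have h2 := ((h.smooth.differentiable (by simp) (-z)).hasFDerivAt.comp z
    (hasFDerivAt_id (𝕜 := ℝ) z).fun_neg).fderiv
  rw [show ρ ∘ Neg.neg = ρ from h1] at h2
  ext v
  simp [h2]

theorem continuous_fderiv (h : IsKernel ρ R C) : Continuous (fderiv ℝ ρ) :=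
  h.smooth.continuous_fderiv (by simp)

theorem partialDeriv_eq_zero (h : IsKernel ρ R C) (j : Fin d) {z : Sp d}
    (hz : z ∉ closedBall (0 : Sp d) R) : partialDeriv j ρ z = 0 := by
  simp [partialDeriv, h.fderiv_eq_zero hz]

theorem continuous_partialDeriv (h : IsKernel ρ R C) (j : Fin d) :
    Continuous (partialDeriv j ρ) := by
  unfold partialDeriv; exact h.continuous_fderiv.clm_apply continuous_const

theorem bound_partialDeriv (h : IsKernel ρ R C) (j : Fin d) (z : Sp d) :
    ‖partialDeriv j ρ z‖ ≤ C := by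
  refine ((fderiv ℝ ρ z).le_opNorm _).trans ?_
  simpa using h.bound_fderiv z

theorem nonneg (h : IsKernel ρ R C) : 0 ≤ C := (norm_nonneg _).trans (h.bound 0)

/-- The derivative of an even function is odd. Mean zero is what allows a constant to be subtracted
from the field in `enorm_fderiv_mollify_le`. -/
theorem integral_partialDeriv (h : IsKernel ρ R C) (j : Fin d) : ∫ z, partialDeriv j ρ z = 0 := by
  have h1 := integral_neg_eq_self (partialDeriv j ρ) (volume : Measure (Sp d))
  have h2 : ∀ z, partialDeriv j ρ (-z) = -partialDeriv j ρ z := fun z => by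
    simp [partialDeriv, h.fderiv_neg]
  simp only [h2, integral_neg] at h1
  linarith

end IsKernel

/-- The average `∫ k(z) h(x + ℓz) dz`. -/
def kernelAvg (k : Sp d → ℝ) (ℓ : ℝ) (h : Sp d → ℝ) (x : Sp d) : ℝ := ∫ z, k z * h (x + ℓ • z)

theorem integral_comp_sub_smul {F : Type*} [NormedAddCommGroup F] [NormedSpace ℝ F]
    (G : Sp d → F) {ℓ : ℝ} (hℓ : 0 < ℓ) : ∫ t, G t = (ℓ ^ d) • ∫ z, G (-(ℓ • z)) := by
  have h1 := Measure.integral_comp_smul (volume : Measure (Sp d)) G (-ℓ)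
  have h2 : |((-ℓ) ^ d)⁻¹| = (ℓ ^ d)⁻¹ := by
    rw [abs_inv, abs_pow, abs_neg, abs_of_pos hℓ]
  simp only [neg_smul, finrank_euclideanSpace, Fintype.card_fin, h2] at h1
  rw [h1, smul_inv_smul₀ (by positivity)]

/-- The substitution `t = -(ℓ • z)` and the evenness of the kernel turn the convolution into an
average of `f (x + ℓ • z)`, the form in which increments appear. -/
theorem mollify_apply {F : Type*} [NormedAddCommGroup F] [NormedSpace ℝ F]
    {ρ : Sp d → ℝ} (hρ : ∀ z, ρ (-z) = ρ z) {ℓ : ℝ} (hℓ : 0 < ℓ) (f : Sp d → F) (x : Sp d) :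
    mollify ρ ℓ f x = ∫ z, ρ z • f (x + ℓ • z) := by
  rw [mollify, convolution_def, integral_comp_sub_smul _ hℓ, ← integral_smul]
  congr 1; ext z
  simp only [scaledKernel, ContinuousLinearMap.lsmul_apply, smul_smul, sub_neg_eq_add, smul_neg,
    inv_mul_cancel₀ hℓ.ne', one_smul, hρ]
  rw [mul_inv_cancel_left₀ (by positivity)]

theorem integrable_kernel_smul_comp {F : Type*} [NormedAddCommGroup F] [NormedSpace ℝ F]
    {k : Sp d → ℝ} (hk : Continuous k) {C : ℝ} (hC : ∀ z, ‖k z‖ ≤ C) {f : Sp d → F}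
    (hf : Integrable f) {ℓ : ℝ} (hℓ : ℓ ≠ 0) (x : Sp d) :
    Integrable (fun z => k z • f (x + ℓ • z)) := by
  have h1 : Integrable (fun z => f (x + ℓ • z)) :=
    ((integrable_comp_smul_iff volume (fun z => f (x + z)) hℓ).2 (hf.comp_add_left x))
  exact h1.bdd_smul C hk.aestronglyMeasurable (Eventually.of_forall hC)

theorem mollify_coord {ρ : Sp d → ℝ} {R C : ℝ} (hρ : IsKernel ρ R C) {ℓ : ℝ} (hℓ : 0 < ℓ)
    {f : Sp d → Sp d} (hf : Integrable f) (x : Sp d) (i : Fin d) :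
    mollify ρ ℓ f x i = kernelAvg ρ ℓ (fun y => f y i) x := by
  rw [mollify_apply hρ.even hℓ, kernelAvg]
  exact ((EuclideanSpace.proj i : Sp d →L[ℝ] ℝ).integral_comp_comm
    (integrable_kernel_smul_comp hρ.smooth.continuous hρ.bound hf hℓ.ne' x)).symm

theorem contDiff_scaledKernel {ρ : Sp d → ℝ} (h : ContDiff ℝ ∞ ρ) (ℓ : ℝ) :
    ContDiff ℝ ∞ (scaledKernel ρ ℓ) := by
  unfold scaledKernel; fun_prop

theorem tsupport_scaledKernel_subset {ρ : Sp d → ℝ} {R C : ℝ} (h : IsKernel ρ R C) {ℓ : ℝ}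
    (hℓ : 0 < ℓ) : tsupport (scaledKernel ρ ℓ) ⊆ closedBall 0 (R * ℓ) := by
  refine closure_minimal (fun y hy => ?_) isClosed_closedBall
  by_contra hy'
  refine hy ?_
  have : ℓ⁻¹ • y ∉ closedBall (0 : Sp d) R := by
    rw [mem_closedBall_zero_iff, not_le] at hy' ⊢
    rw [norm_smul, norm_inv, Real.norm_of_nonneg hℓ.le, ← div_eq_inv_mul]
    exact (lt_div_iff₀ hℓ).2 hy'
  simp [scaledKernel, h.eq_zero this]

theorem hasCompactSupport_scaledKernel {ρ : Sp d → ℝ} {R C : ℝ} (h : IsKernel ρ R C) {ℓ : ℝ}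
    (hℓ : 0 < ℓ) : HasCompactSupport (scaledKernel ρ ℓ) :=
  (isCompact_closedBall 0 (R * ℓ)).of_isClosed_subset (isClosed_tsupport _)
    (tsupport_scaledKernel_subset h hℓ)

theorem fderiv_convolution_apply {k : Sp d → ℝ} (hk : ContDiff ℝ ∞ k) (hkc : HasCompactSupport k)
    {f : Sp d → Sp d} (hf : LocallyIntegrable f) (x e : Sp d) :
    HasFDerivAt (k ⋆[ContinuousLinearMap.lsmul ℝ ℝ] f)
      (fderiv ℝ (k ⋆[ContinuousLinearMap.lsmul ℝ ℝ] f) x) x ∧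
    ∀ i, (fderiv ℝ (k ⋆[ContinuousLinearMap.lsmul ℝ ℝ] f) x e) i
      = ∫ t, fderiv ℝ k t e * f (x - t) i := by
  have h := hkc.hasFDerivAt_convolution_left (ContinuousLinearMap.lsmul ℝ ℝ (E := Sp d))
    (hk.of_le (by simp)) hf x
  refine ⟨h.differentiableAt.hasFDerivAt, fun i => ?_⟩
  rw [h.fderiv, convolution_def]
  have hint := (hkc.fderiv ℝ).convolutionExists_left
    ((ContinuousLinearMap.lsmul ℝ ℝ (E := Sp d)).precompL (Sp d))
    (hk.continuous_fderiv (by simp)) hf x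
  rw [ContinuousLinearMap.integral_apply hint]
  have h2 := (EuclideanSpace.proj i : Sp d →L[ℝ] ℝ).integral_comp_comm
    (hint.apply_continuousLinearMap e)
  exact h2.symm

/-- The derivative falls on the kernel, and its scaling produces `ℓ⁻¹`. The minus sign comes from
the oddness of `fderiv ℝ ρ` under `t = -(ℓ • z)`. -/
theorem fderiv_mollify_coord {ρ : Sp d → ℝ} {R C : ℝ} (hρ : IsKernel ρ R C) {ℓ : ℝ} (hℓ : 0 < ℓ)
    {f : Sp d → Sp d} (hf : Integrable f) (x : Sp d) (i j : Fin d) :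
    (fderiv ℝ (mollify ρ ℓ f) x (EuclideanSpace.single j 1)) i
      = -ℓ⁻¹ * kernelAvg (partialDeriv j ρ) ℓ (fun y => f y i) x := by
  have h := (fderiv_convolution_apply (contDiff_scaledKernel hρ.smooth ℓ)
    (hasCompactSupport_scaledKernel hρ hℓ) hf.locallyIntegrable x
    (EuclideanSpace.single j 1)).2 i
  rw [mollify, h, integral_comp_sub_smul _ hℓ, kernelAvg, ← integral_const_mul, ← integral_smul]
  congr 1; ext z
  have h1 : fderiv ℝ (scaledKernel ρ ℓ) (-(ℓ • z)) (EuclideanSpace.single j 1)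
      = -((ℓ ^ d)⁻¹ * ℓ⁻¹ * partialDeriv j ρ z) := by
    have h2 : HasFDerivAt (scaledKernel ρ ℓ)
        ((ℓ ^ d)⁻¹ • (fderiv ℝ ρ (ℓ⁻¹ • -(ℓ • z))).comp (ℓ⁻¹ • ContinuousLinearMap.id ℝ (Sp d)))
        (-(ℓ • z)) := by
      have h3 : HasFDerivAt (fun y : Sp d => ℓ⁻¹ • y) (ℓ⁻¹ • ContinuousLinearMap.id ℝ (Sp d))
          (-(ℓ • z)) := (hasFDerivAt_id (𝕜 := ℝ) (-(ℓ • z))).fun_const_smul ℓ⁻¹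
      exact (((hρ.smooth.differentiable (by simp)) _).hasFDerivAt.comp _ h3).const_mul _
    rw [h2.fderiv]
    simp only [smul_neg, smul_smul, inv_mul_cancel₀ hℓ.ne', one_smul, hρ.fderiv_neg, partialDeriv]
    simp; ring
  rw [h1, sub_neg_eq_add, smul_eq_mul]
  have : ℓ ^ d ≠ 0 := by positivity
  field_simp


/-! ### Pointwise bounds by increments -/

theorem enorm_kernelAvg_le {k : Sp d → ℝ} {C R : ℝ} (hC : ∀ z, ‖k z‖ ≤ C)
    (hk : ∀ z ∉ closedBall (0 : Sp d) R, k z = 0) (ℓ : ℝ) (h : Sp d → ℝ) (x : Sp d) :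
    ‖kernelAvg k ℓ h x‖ₑ ≤ ENNReal.ofReal C * ∫⁻ z in closedBall (0 : Sp d) R, ‖h (x + ℓ • z)‖ₑ := by
  calc ‖kernelAvg k ℓ h x‖ₑ ≤ ∫⁻ z, ‖k z * h (x + ℓ • z)‖ₑ := enorm_integral_le_lintegral_enorm _
    _ = ∫⁻ z in closedBall (0 : Sp d) R, ‖k z * h (x + ℓ • z)‖ₑ := by
        refine (setLIntegral_eq_of_support_subset fun z hz => ?_).symm
        by_contra hz'
        exact hz (by simp [hk z hz'])
    _ ≤ ∫⁻ z in closedBall (0 : Sp d) R, ENNReal.ofReal C * ‖h (x + ℓ • z)‖ₑ := by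
        gcongr with z
        rw [enorm_mul]
        gcongr
        rw [← ofReal_norm]
        exact ENNReal.ofReal_le_ofReal (hC z)
    _ = _ := lintegral_const_mul' _ _ (by simp)

theorem integrable_kernel_mul_comp {k : Sp d → ℝ} (hk : Continuous k) {C : ℝ}
    (hC : ∀ z, ‖k z‖ ≤ C) {f : Sp d → ℝ} (hf : Integrable f) {ℓ : ℝ} (hℓ : ℓ ≠ 0) (x : Sp d) :
    Integrable (fun z => k z * f (x + ℓ • z)) :=
  integrable_kernel_smul_comp hk hC hf hℓ x

theorem kernelAvg_sub_const {k : Sp d → ℝ} (hk : Continuous k) (hki : Integrable k) {C : ℝ}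
    (hC : ∀ z, ‖k z‖ ≤ C) {f : Sp d → ℝ} (hf : Integrable f) {ℓ : ℝ} (hℓ : ℓ ≠ 0) (x : Sp d)
    (c : ℝ) : kernelAvg k ℓ (fun y => f y - c) x = kernelAvg k ℓ f x - c * ∫ z, k z := by
  unfold kernelAvg
  rw [← integral_const_mul, ← integral_sub (integrable_kernel_mul_comp hk hC hf hℓ x)
    (hki.const_mul c)]
  congr 1; ext z; ring

theorem IsKernel.integrable {ρ : Sp d → ℝ} {R C : ℝ} (h : IsKernel ρ R C) : Integrable ρ :=
  h.smooth.continuous.integrable_of_hasCompactSupport h.hasCompactSupport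

theorem integrable_coord {f : Sp d → Sp d} (hf : Integrable f) (i : Fin d) :
    Integrable (fun y => f y i) :=
  (EuclideanSpace.proj i : Sp d →L[ℝ] ℝ).integrable_comp hf

theorem memLp_coord {f : Sp d → Sp d} {p : ℝ≥0∞} {μ : Measure (Sp d)} (hf : MemLp f p μ)
    (i : Fin d) : MemLp (fun y => f y i) p μ :=
  (EuclideanSpace.proj i : Sp d →L[ℝ] ℝ).comp_memLp' hf

theorem integrable_coord_mul {f : Sp d → Sp d} (hf : MemLp f 2) (i j : Fin d) :
    Integrable (fun y => f y i * f y j) :=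
  (memLp_coord hf i).integrable_mul (memLp_coord hf j)

theorem enorm_coord_le (a : Sp d) (i : Fin d) : ‖a i‖ₑ ≤ ‖a‖ₑ := by
  rw [← ofReal_norm, ← ofReal_norm]
  exact ENNReal.ofReal_le_ofReal (PiLp.norm_apply_le a i)

variable {ρ : Sp d → ℝ} {R C : ℝ}

/-- The kernel has mass one, so averaging fixes constants and all terms containing `c` cancel in the
commutator. -/
theorem stress_eq (hρ : IsKernel ρ R C) (h1 : ∫ z, ρ z = 1) {f : Sp d → Sp d} (hf : Integrable f)
    (hf2 : MemLp f 2) {ℓ : ℝ} (hℓ : 0 < ℓ) (x c : Sp d) (i j : Fin d) :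
    stress ρ ℓ f i j x = kernelAvg ρ ℓ (fun y => (f y - c) i) x * kernelAvg ρ ℓ (fun y => (f y - c) j) x
      - kernelAvg ρ ℓ (fun y => (f y - c) i * (f y - c) j) x := by
  have hs := fun i => kernelAvg_sub_const hρ.smooth.continuous hρ.integrable hρ.bound
    (integrable_coord hf i) hℓ.ne' x (c i)
  simp only [h1, mul_one] at hs
  simp only [PiLp.sub_apply, hs]
  have hI := fun i => integrable_kernel_mul_comp hρ.smooth.continuous hρ.bound
    (integrable_coord hf i) hℓ.ne' x
  have hII := integrable_kernel_mul_comp hρ.smooth.continuous hρ.bound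
    (integrable_coord_mul hf2 i j) hℓ.ne' x
  have hprod : kernelAvg ρ ℓ (fun y => (f y i - c i) * (f y j - c j)) x
      = kernelAvg ρ ℓ (fun y => f y i * f y j) x - c i * kernelAvg ρ ℓ (fun y => f y j) x
        - c j * kernelAvg ρ ℓ (fun y => f y i) x + c i * c j := by
    have : c i * c j = ∫ z, c i * c j * ρ z := by rw [integral_const_mul, h1, mul_one]
    rw [this]
    unfold kernelAvg
    have e1 := integral_sub hII ((hI j).const_mul (c i))
    have e2 := integral_sub (hII.sub ((hI j).const_mul (c i))) ((hI i).const_mul (c j))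
    have e3 := integral_add ((hII.sub ((hI j).const_mul (c i))).sub ((hI i).const_mul (c j)))
        (hρ.integrable.const_mul (c i * c j))
    simp only [Pi.sub_apply] at e2 e3
    rw [← integral_const_mul, ← integral_const_mul, ← e1, ← e2, ← e3]
    congr 1; ext z; ring
  rw [hprod, stress, mollify_coord hρ hℓ hf, mollify_coord hρ hℓ hf, mollify_apply hρ.even hℓ]
  simp only [smul_eq_mul]
  change _ - kernelAvg ρ ℓ (fun y => f y i * f y j) x = _
  ring

theorem aemeasurable_enorm_comp_sub {f : Sp d → Sp d} (hf : AEStronglyMeasurable f volume) {ℓ : ℝ}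
    (hℓ : ℓ ≠ 0) (x c : Sp d) (s : Set (Sp d)) :
    AEMeasurable (fun z => ‖f (x + ℓ • z) - c‖ₑ) (volume.restrict s) :=
  (((hf.comp_quasiMeasurePreserving (quasiMeasurePreserving_add_smul x hℓ)).sub
    aestronglyMeasurable_const).enorm).restrict

/-- The constant `c` is left free: `c = f x` gives increments, and `c` equal to a mean of `f` gives
the mean square oscillation. -/
theorem enorm_stress_le (hρ : IsKernel ρ R C) (h1 : ∫ z, ρ z = 1) :
    ∃ C' : ℝ≥0∞, C' ≠ ⊤ ∧ ∀ (f : Sp d → Sp d), Integrable f → MemLp f 2 → ∀ ℓ : ℝ, 0 < ℓ →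
      ∀ x c i j, ‖stress ρ ℓ f i j x‖ₑ
        ≤ C' * ∫⁻ z in closedBall (0 : Sp d) R, ‖f (x + ℓ • z) - c‖ₑ ^ 2 := by
  set A := ENNReal.ofReal C
  set V := volume (closedBall (0 : Sp d) R)
  have hV : V ≠ ⊤ := measure_closedBall_lt_top.ne
  -- The first summand comes from the product of two averages, by `sq_lintegral_le`; the second from
  -- the average of the product.
  refine ⟨A ^ 2 * (2 * V) + A, by finiteness, fun f hf hf2 ℓ hℓ x c i j => ?_⟩
  have hb : ∀ i, ‖kernelAvg ρ ℓ (fun y => (f y - c) i) x‖ₑ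
      ≤ A * ∫⁻ z in closedBall (0 : Sp d) R, ‖f (x + ℓ • z) - c‖ₑ := fun i => by
    refine (enorm_kernelAvg_le hρ.bound (fun z hz => hρ.eq_zero hz) _ _ _).trans ?_
    gcongr with z
    exact enorm_coord_le _ _
  have hm := aemeasurable_enorm_comp_sub hf.aestronglyMeasurable hℓ.ne' x c (closedBall 0 R)
  rw [stress_eq hρ h1 hf hf2 hℓ x c]
  refine (enorm_sub_le).trans ?_
  rw [add_mul, enorm_mul]
  refine add_le_add ?_ ?_
  · calc _ ≤ (A * ∫⁻ z in closedBall (0 : Sp d) R, ‖f (x + ℓ • z) - c‖ₑ) *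
          (A * ∫⁻ z in closedBall (0 : Sp d) R, ‖f (x + ℓ • z) - c‖ₑ) := by gcongr <;> exact hb _
      _ = A ^ 2 * (∫⁻ z in closedBall (0 : Sp d) R, ‖f (x + ℓ • z) - c‖ₑ) ^ 2 := by ring
      _ ≤ _ := by
        rw [mul_assoc (A ^ 2)]
        refine mul_le_mul_right ?_ _
        simpa using sq_lintegral_le _ hm
  · refine (enorm_kernelAvg_le hρ.bound (fun z hz => hρ.eq_zero hz) _ _ _).trans ?_
    gcongr with z
    rw [enorm_mul, sq]
    gcongr <;> exact enorm_coord_le _ _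

theorem enorm_fderiv_mollify_le (hρ : IsKernel ρ R C) {f : Sp d → Sp d} (hf : Integrable f) {ℓ : ℝ}
    (hℓ : 0 < ℓ) (x c : Sp d) (i j : Fin d) :
    ‖(fderiv ℝ (mollify ρ ℓ f) x (EuclideanSpace.single j 1)) i‖ₑ
      ≤ ENNReal.ofReal ℓ⁻¹ * (ENNReal.ofReal C *
        ∫⁻ z in closedBall (0 : Sp d) R, ‖f (x + ℓ • z) - c‖ₑ) := by
  have hki : Integrable (partialDeriv j ρ) :=
    (hρ.continuous_partialDeriv j).integrable_of_hasCompactSupport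
      (HasCompactSupport.intro (isCompact_closedBall 0 R) fun z hz => hρ.partialDeriv_eq_zero j hz)
  have h2 := kernelAvg_sub_const (hρ.continuous_partialDeriv j) hki (hρ.bound_partialDeriv j)
    (integrable_coord hf i) hℓ.ne' x (c i)
  rw [hρ.integral_partialDeriv, mul_zero, sub_zero] at h2
  rw [fderiv_mollify_coord hρ hℓ hf, ← h2, enorm_mul, enorm_neg]
  gcongr
  · rw [← ofReal_norm, Real.norm_of_nonneg (by positivity)]
  · refine (enorm_kernelAvg_le (hρ.bound_partialDeriv j)
      (fun z hz => hρ.partialDeriv_eq_zero j hz) _ _ _).trans ?_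
    gcongr with z
    exact enorm_coord_le (f (x + ℓ • z) - c) i

/-- The Constantin--E--Titi approximation is bounded by the mean cubic increment. -/
theorem enorm_dissCET_le_cubic (hρ : IsKernel ρ R C) (h1 : ∫ z, ρ z = 1) :
    ∃ C' : ℝ≥0∞, C' ≠ ⊤ ∧ ∀ (f : Sp d → Sp d), Integrable f → MemLp f 2 → ∀ ℓ : ℝ, 0 < ℓ →
      ∀ x, ‖dissCET ρ (fun y _ => f y) ℓ (x, 0)‖ₑ
        ≤ C' * (ENNReal.ofReal ℓ⁻¹ *
          ∫⁻ z in closedBall (0 : Sp d) R, ‖f (x + ℓ • z) - f x‖ₑ ^ 3) := by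
  obtain ⟨C₁, hC₁, hs⟩ := enorm_stress_le hρ h1
  set V := volume (closedBall (0 : Sp d) R)
  have hV : V ≠ ⊤ := measure_closedBall_lt_top.ne
  refine ⟨d * (d * (C₁ * (ENNReal.ofReal C * (2 * V)))), by finiteness, fun f hf hf2 ℓ hℓ x => ?_⟩
  have hm := aemeasurable_enorm_comp_sub hf.aestronglyMeasurable hℓ.ne' x (f x) (closedBall 0 R)
  have hterm : ∀ i j, ‖stress ρ ℓ f i j x *
      (fderiv ℝ (mollify ρ ℓ f) x (EuclideanSpace.single j 1)) i‖ₑ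
      ≤ C₁ * (ENNReal.ofReal C * (2 * V)) * (ENNReal.ofReal ℓ⁻¹ *
          ∫⁻ z in closedBall (0 : Sp d) R, ‖f (x + ℓ • z) - f x‖ₑ ^ 3) := fun i j => by
    -- The stress contributes a quadratic mean and the gradient a linear mean of the same
    -- increments; together they give the cubic mean.
    have h3 := lintegral_pow_mul_lintegral_pow_le _ hm 2 1
    simp only [Measure.restrict_apply_univ, pow_one] at h3
    rw [enorm_mul]
    calc _ ≤ (C₁ * ∫⁻ z in closedBall (0 : Sp d) R, ‖f (x + ℓ • z) - f x‖ₑ ^ 2) *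
          (ENNReal.ofReal ℓ⁻¹ * (ENNReal.ofReal C *
        ∫⁻ z in closedBall (0 : Sp d) R, ‖f (x + ℓ • z) - f x‖ₑ)) := by
          gcongr
          · exact hs f hf hf2 ℓ hℓ x (f x) i j
          · exact enorm_fderiv_mollify_le hρ hf hℓ x (f x) i j
      _ = C₁ * ENNReal.ofReal C * ENNReal.ofReal ℓ⁻¹ *
          ((∫⁻ z in closedBall (0 : Sp d) R, ‖f (x + ℓ • z) - f x‖ₑ ^ 2) *
          ∫⁻ z in closedBall (0 : Sp d) R, ‖f (x + ℓ • z) - f x‖ₑ) := by ring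
      _ ≤ C₁ * ENNReal.ofReal C * ENNReal.ofReal ℓ⁻¹ * (2 * V *
          ∫⁻ z in closedBall (0 : Sp d) R, ‖f (x + ℓ • z) - f x‖ₑ ^ 3) := by gcongr
      _ = _ := by ring
  calc ‖dissCET ρ (fun y _ => f y) ℓ (x, 0)‖ₑ
      ≤ ∑ i, ∑ j, ‖stress ρ ℓ f i j x *
      (fderiv ℝ (mollify ρ ℓ f) x (EuclideanSpace.single j 1)) i‖ₑ :=
        (enorm_sum_le _ _).trans (Finset.sum_le_sum fun i _ => enorm_sum_le _ _)
    _ ≤ ∑ _i : Fin d, ∑ _j : Fin d, _ := Finset.sum_le_sum fun i _ => Finset.sum_le_sum fun j _ => hterm i j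
    _ = _ := by simp; ring

theorem inner_gradient_eq_fderiv (ρ : Sp d → ℝ) (z a : Sp d) : inner ℝ (∇ ρ z) a = fderiv ℝ ρ z a := by
  rw [gradient, InnerProductSpace.toDual_symm_apply]

theorem enorm_integrandDR_le (hρ : IsKernel ρ R C) (f : Sp d → Sp d) {ℓ : ℝ} (hℓ : 0 < ℓ)
    (x z : Sp d) :
    ‖integrandDR ρ (fun y _ => f y) ℓ (x, 0) z‖ₑ
      ≤ (closedBall (0 : Sp d) R).indicator
        (fun z => ENNReal.ofReal C * ENNReal.ofReal ℓ⁻¹ * ‖f (x + ℓ • z) - f x‖ₑ ^ 3) z := by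
  rw [integrandDR, inner_gradient_eq_fderiv]
  by_cases hz : z ∈ closedBall (0 : Sp d) R
  · rw [indicator_of_mem hz, enorm_mul]
    simp only [increment]
    set a := f (x + ℓ • z) - f x
    have h1 : ‖fderiv ℝ ρ z ((1 / (4 * ℓ)) • a)‖ₑ
        ≤ ENNReal.ofReal C * ENNReal.ofReal ℓ⁻¹ * ‖a‖ₑ := by
      rw [← ofReal_norm, ← ofReal_norm, ← ENNReal.ofReal_mul hρ.nonneg,
        ← ENNReal.ofReal_mul (mul_nonneg hρ.nonneg (by positivity))]
      refine ENNReal.ofReal_le_ofReal ?_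
      refine ((fderiv ℝ ρ z).le_opNorm _).trans ?_
      rw [norm_smul, mul_assoc]
      refine mul_le_mul (hρ.bound_fderiv z) ?_ (by positivity) hρ.nonneg
      refine mul_le_mul_of_nonneg_right ?_ (norm_nonneg _)
      rw [Real.norm_of_nonneg (by positivity), ← one_div]
      exact one_div_le_one_div_of_le hℓ (by linarith)
    calc _ ≤ ENNReal.ofReal C * ENNReal.ofReal ℓ⁻¹ * ‖a‖ₑ * ‖a‖ₑ ^ 2 := by
          gcongr
          rw [enorm_pow, enorm_norm]
      _ = _ := by ring
  · simp [hρ.fderiv_eq_zero hz]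

/-- The Duchon--Robert approximation is bounded by the mean cubic increment. -/
theorem enorm_dissDR_le_cubic (hρ : IsKernel ρ R C) (f : Sp d → Sp d) {ℓ : ℝ} (hℓ : 0 < ℓ)
    (x : Sp d) : ‖dissDR ρ (fun y _ => f y) ℓ (x, 0)‖ₑ
        ≤ ENNReal.ofReal C * (ENNReal.ofReal ℓ⁻¹ *
          ∫⁻ z in closedBall (0 : Sp d) R, ‖f (x + ℓ • z) - f x‖ₑ ^ 3) := by
  calc _ ≤ ∫⁻ z, ‖integrandDR ρ (fun y _ => f y) ℓ (x, 0) z‖ₑ := enorm_integral_le_lintegral_enorm _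
    _ ≤ _ := lintegral_mono (enorm_integrandDR_le hρ f hℓ x)
    _ = _ := by
      rw [lintegral_indicator measurableSet_closedBall, lintegral_const_mul' _ _ (by finiteness),
        mul_assoc]

theorem aestronglyMeasurable_integrandDR (hρ : IsKernel ρ R C) {f : Sp d → Sp d}
    (hf : AEStronglyMeasurable f volume) {ℓ : ℝ} (hℓ : ℓ ≠ 0) (x : Sp d) :
    AEStronglyMeasurable (integrandDR ρ (fun y _ => f y) ℓ (x, 0)) volume := by
  have h := (hf.comp_quasiMeasurePreserving (quasiMeasurePreserving_add_smul x hℓ)).sub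
    (aestronglyMeasurable_const (b := f x))
  have : integrandDR ρ (fun y _ => f y) ℓ (x, 0) = fun z =>
      fderiv ℝ ρ z ((1 / (4 * ℓ)) • (f (x + ℓ • z) - f x)) * ‖f (x + ℓ • z) - f x‖ ^ 2 := by
    ext z; rw [integrandDR, inner_gradient_eq_fderiv]; rfl
  rw [this]
  have hc : Continuous fun q : Sp d × Sp d => fderiv ℝ ρ q.1 ((1 / (4 * ℓ)) • q.2) * ‖q.2‖ ^ 2 := by
    have := hρ.continuous_fderiv
    fun_prop
  exact hc.comp_aestronglyMeasurable (aestronglyMeasurable_id.prodMk h)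

theorem integrable_integrandDR (hρ : IsKernel ρ R C) {f : Sp d → Sp d} (hf : MemLp f 3) {ℓ : ℝ}
    (hℓ : 0 < ℓ) (x : Sp d) : Integrable (integrandDR ρ (fun y _ => f y) ℓ (x, 0)) := by
  refine ⟨aestronglyMeasurable_integrandDR hρ hf.aestronglyMeasurable hℓ.ne' x, ?_⟩
  refine (lintegral_mono (enorm_integrandDR_le hρ f hℓ x)).trans_lt ?_
  rw [lintegral_indicator measurableSet_closedBall, lintegral_const_mul' _ _ (by finiteness)]
  refine ENNReal.mul_lt_top (by finiteness) ?_
  have hq := quasiMeasurePreserving_add_smul x hℓ.ne'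
  have h1 : MemLp (fun z => f (x + ℓ • z)) 3 := by
    refine ⟨hf.aestronglyMeasurable.comp_quasiMeasurePreserving hq, ?_⟩
    have hint : Integrable (fun y => ‖f y‖ ^ 3) := hf.integrable_norm_pow (by norm_num)
    have := (integrable_comp_smul_iff volume (fun z => ‖f (x + z)‖ ^ 3) hℓ.ne').2
      (hint.comp_add_left x)
    rw [eLpNorm_lt_top_iff_lintegral_rpow_enorm_lt_top (by norm_num) (by norm_num)]
    have h2 := this.2
    simpa [HasFiniteIntegral] using h2
  have h2 : MemLp (fun z => f (x + ℓ • z) - f x) 3 (volume.restrict (closedBall 0 R)) := by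
    have : IsFiniteMeasure ((volume : Measure (Sp d)).restrict (closedBall 0 R)) :=
      ⟨by simpa using measure_closedBall_lt_top⟩
    exact (h1.restrict _).sub (memLp_const _)
  have h3 := h2.2
  rw [eLpNorm_lt_top_iff_lintegral_rpow_enorm_lt_top (by norm_num) (by norm_num)] at h3
  simpa using h3


/-! ### Localization -/

theorem add_smul_mem_closedBall {δ ℓ : ℝ} (hℓ : 0 < ℓ) (hδ : R * ℓ ≤ δ) (x : Sp d) {z : Sp d}
    (hz : z ∈ closedBall (0 : Sp d) R) : x + ℓ • z ∈ closedBall x δ := by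
  rw [mem_closedBall_iff_norm, add_sub_cancel_left, norm_smul, Real.norm_of_nonneg hℓ.le]
  have := mem_closedBall_zero_iff.1 hz
  nlinarith

theorem integrandDR_congr (hρ : IsKernel ρ R C) {v f : Sp d → Sp d} {x : Sp d} {δ ℓ : ℝ}
    (hℓ : 0 < ℓ) (hδ : R * ℓ ≤ δ) (h : EqOn v f (closedBall x δ)) :
    integrandDR ρ (fun y _ => v y) ℓ (x, 0) = integrandDR ρ (fun y _ => f y) ℓ (x, 0) := by
  have hδ0 : 0 ≤ δ := (mul_nonneg hρ.pos.le hℓ.le).trans hδ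
  ext z
  by_cases hz : z ∈ closedBall (0 : Sp d) R
  · simp only [integrandDR, increment, h (add_smul_mem_closedBall hℓ hδ x hz),
      h (mem_closedBall_self hδ0)]
  · simp only [integrandDR, inner_gradient_eq_fderiv, hρ.fderiv_eq_zero hz,
      _root_.zero_apply, zero_mul]

theorem dissDR_congr (hρ : IsKernel ρ R C) {v f : Sp d → Sp d} {x : Sp d} {δ ℓ : ℝ}
    (hℓ : 0 < ℓ) (hδ : R * ℓ ≤ δ) (h : EqOn v f (closedBall x δ)) :
    dissDR ρ (fun y _ => v y) ℓ (x, 0) = dissDR ρ (fun y _ => f y) ℓ (x, 0) := by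
  rw [dissDR, dissDR, integrandDR_congr hρ hℓ hδ h]

theorem scaledKernel_smul_congr {F : Type*} [NormedAddCommGroup F] [NormedSpace ℝ F]
    (hρ : IsKernel ρ R C) {v f : Sp d → F} {x : Sp d} {δ ℓ : ℝ}
    (hℓ : 0 < ℓ) (hδ : R * ℓ ≤ δ) (h : EqOn v f (closedBall x δ)) :
    (fun t => ContinuousLinearMap.lsmul ℝ ℝ (scaledKernel ρ ℓ t) (v (x - t)))
      = fun t => ContinuousLinearMap.lsmul ℝ ℝ (scaledKernel ρ ℓ t) (f (x - t)) := by
  ext t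
  by_cases ht : t ∈ closedBall (0 : Sp d) (R * ℓ)
  · rw [h]
    rw [mem_closedBall_iff_norm, sub_sub_cancel_left, norm_neg]
    exact (mem_closedBall_zero_iff.1 ht).trans hδ
  · have : scaledKernel ρ ℓ t = 0 :=
      image_eq_zero_of_notMem_tsupport fun h' => ht (tsupport_scaledKernel_subset hρ hℓ h')
    simp [this]

theorem mollify_congr {F : Type*} [NormedAddCommGroup F] [NormedSpace ℝ F]
    (hρ : IsKernel ρ R C) {v f : Sp d → F} {x : Sp d} {δ ℓ : ℝ}
    (hℓ : 0 < ℓ) (hδ : R * ℓ ≤ δ) (h : EqOn v f (closedBall x δ)) :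
    mollify ρ ℓ v x = mollify ρ ℓ f x := by
  rw [mollify, mollify, convolution_def, convolution_def, scaledKernel_smul_congr hρ hℓ hδ h]

theorem convolutionExistsAt_congr {F : Type*} [NormedAddCommGroup F] [NormedSpace ℝ F]
    (hρ : IsKernel ρ R C) {v f : Sp d → F} {x : Sp d} {δ ℓ : ℝ}
    (hℓ : 0 < ℓ) (hδ : R * ℓ ≤ δ) (h : EqOn v f (closedBall x δ))
    (hf : ConvolutionExistsAt (scaledKernel ρ ℓ) f x (ContinuousLinearMap.lsmul ℝ ℝ) volume) :
    ConvolutionExistsAt (scaledKernel ρ ℓ) v x (ContinuousLinearMap.lsmul ℝ ℝ) volume := by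
  rw [ConvolutionExistsAt, scaledKernel_smul_congr hρ hℓ hδ h]; exact hf

/-- The strict inequality `R * ℓ < δ` leaves room to move `x`, so the two mollifications agree on a
neighbourhood and have the same derivative. -/
theorem mollify_eventuallyEq {F : Type*} [NormedAddCommGroup F] [NormedSpace ℝ F]
    (hρ : IsKernel ρ R C) {v f : Sp d → F} {x : Sp d} {δ ℓ : ℝ}
    (hℓ : 0 < ℓ) (hδ : R * ℓ < δ) (h : EqOn v f (closedBall x δ)) :
    mollify ρ ℓ v =ᶠ[𝓝 x] mollify ρ ℓ f := by
  filter_upwards [ball_mem_nhds x (sub_pos.2 hδ)] with y hy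
  refine mollify_congr hρ hℓ le_rfl (h.mono (closedBall_subset_closedBall' ?_))
  have := mem_ball.1 hy
  linarith

theorem dissCET_congr (hρ : IsKernel ρ R C) {v f : Sp d → Sp d} {x : Sp d} {δ ℓ : ℝ}
    (hℓ : 0 < ℓ) (hδ : R * ℓ < δ) (h : EqOn v f (closedBall x δ)) :
    dissCET ρ (fun y _ => v y) ℓ (x, 0) = dissCET ρ (fun y _ => f y) ℓ (x, 0) := by
  simp only [dissCET, stress]
  rw [(mollify_eventuallyEq hρ hℓ hδ h).fderiv_eq, mollify_congr hρ hℓ hδ.le h]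
  refine Finset.sum_congr rfl fun i _ => Finset.sum_congr rfl fun j _ => ?_
  rw [mollify_congr (f := fun y => f y i * f y j) hρ hℓ hδ.le fun _ hy => by
    simp only [h hy]]

/-- This passes from local hypotheses to fields integrable on the whole space: near `K`, the kernel
cannot distinguish `v` from its extension by zero. -/
theorem eqOn_indicator {O K : Set (Sp d)} {δ : ℝ} (hK : cthickening δ K ⊆ O) (v : Sp d → Sp d)
    {x : Sp d} (hx : x ∈ K) : EqOn v (O.indicator v) (closedBall x δ) := fun _ hy =>
  (indicator_of_mem (hK (closedBall_subset_cthickening hx δ hy)) v).symm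

/-! ### Besov fields -/

theorem lintegral_comp_smul_closedBall (G : Sp d → ℝ≥0∞) {ℓ : ℝ} (hℓ : 0 < ℓ) (hR : 0 < R) :
    ∫⁻ z in closedBall (0 : Sp d) R, G (ℓ • z)
      = (ENNReal.ofReal (ℓ ^ d))⁻¹ * ∫⁻ y in ball (0 : Sp d) (R * ℓ), G y := by
  let e : Sp d ≃ₜ Sp d := Homeomorph.smulOfNeZero ℓ hℓ.ne'
  have he : MeasurableEmbedding e := e.measurableEmbedding
  have h1 : Measure.map (fun z : Sp d => ℓ • z) volume
      = (ENNReal.ofReal (ℓ ^ d))⁻¹ • (volume : Measure (Sp d)) := by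
    rw [Measure.map_addHaar_smul _ hℓ.ne']
    simp only [finrank_euclideanSpace, Fintype.card_fin]
    rw [abs_inv, abs_of_pos (by positivity), ENNReal.ofReal_inv_of_pos (by positivity)]
  -- The kernel lives on a closed ball while `besovModulus` uses open balls; the sphere between them
  -- is null because `R ≠ 0`.
  have h2 : ball (0 : Sp d) R =ᵐ[volume] closedBall (0 : Sp d) R := by
    rw [← ball_union_sphere]
    exact (union_ae_eq_left_of_ae_eq_empty
      (by rw [ae_eq_empty]; exact Measure.addHaar_sphere_of_ne_zero _ _ hR.ne')).symm
  have h3 : e ⁻¹' ball (0 : Sp d) (R * ℓ) = ball 0 R := by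
    ext z
    change ℓ • z ∈ ball (0 : Sp d) (R * ℓ) ↔ _
    rw [mem_ball_zero_iff, mem_ball_zero_iff, norm_smul, Real.norm_of_nonneg hℓ.le, mul_comm R,
      mul_lt_mul_iff_right₀ hℓ]
  rw [← setLIntegral_congr h2, ← h3]
  change ∫⁻ z in e ⁻¹' ball (0 : Sp d) (R * ℓ), G (e z) = _
  rw [← he.lintegral_map, ← he.restrict_map, show (e : Sp d → Sp d) = fun z => ℓ • z from rfl, h1,
    Measure.restrict_smul, lintegral_smul_measure, smul_eq_mul]

/-- Setting `y = ℓ • z` and `r = R * ℓ` turns the integral over the ball of radius `R` into a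
multiple of a mean over the ball of radius `r`. Since `ℓ⁻¹ = R * r⁻¹` and the cube of `r ^ (1 / 3)`
is `r`, the prefactors match those of the cubed modulus. -/
theorem lintegral_cubic_increment_le (hR : 0 < R) {O K : Set (Sp d)} {δ : ℝ}
    (hK : cthickening δ K ⊆ O) (hKm : MeasurableSet K) {ℓ : ℝ} (hℓ : 0 < ℓ) (hδ : R * ℓ ≤ δ)
    (v : Sp d → Sp d) :
    ∫⁻ x in K, ENNReal.ofReal ℓ⁻¹ *
        ∫⁻ z in closedBall (0 : Sp d) R, ‖v (x + ℓ • z) - v x‖ₑ ^ 3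
      ≤ ENNReal.ofReal R * volume (ball (0 : Sp d) R) * besovModulus (1 / 3) 3 O v (R * ℓ) ^ 3 := by
  set r := R * ℓ with hr
  have hr0 : 0 < r := by positivity
  set W := volume (ball (0 : Sp d) r) with hW
  have hW0 : W ≠ 0 := (measure_ball_pos _ _ hr0).ne'
  have hWt : W ≠ ⊤ := measure_ball_lt_top.ne
  have hWR : (ENNReal.ofReal (ℓ ^ d))⁻¹ * W = volume (ball (0 : Sp d) R) := by
    rw [hW, Measure.addHaar_ball_of_pos _ _ hr0, Measure.addHaar_ball_of_pos _ _ hR, hr, mul_pow,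
      ENNReal.ofReal_mul (by positivity)]
    simp only [finrank_euclideanSpace, Fintype.card_fin]
    have h0 : ENNReal.ofReal (ℓ ^ d) ≠ 0 := by
      rw [Ne, ENNReal.ofReal_eq_zero, not_le]; positivity
    calc _ = ((ENNReal.ofReal (ℓ ^ d))⁻¹ * ENNReal.ofReal (ℓ ^ d)) *
          (ENNReal.ofReal (R ^ d) * volume (ball (0 : Sp d) 1)) := by ring
      _ = _ := by rw [ENNReal.inv_mul_cancel h0 ENNReal.ofReal_ne_top, one_mul]
  set I : ℝ≥0∞ := ∫⁻ x in O, W⁻¹ *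
      ∫⁻ y in ball (0 : Sp d) r ∩ {y | x + y ∈ O}, ‖v (x + y) - v x‖ₑ ^ (3 : ℝ) with hI
  have hmod : besovModulus (1 / 3) 3 O v r ^ 3 = ENNReal.ofReal r⁻¹ * I := by
    rw [besovModulus, ← hI, mul_pow]
    congr 1
    · rw [← ENNReal.ofReal_inv_of_pos (by positivity), ← ENNReal.ofReal_pow (by positivity), inv_pow,
        ← Real.rpow_natCast, ← Real.rpow_mul hr0.le]
      norm_num
    · rw [← ENNReal.rpow_natCast, ← ENNReal.rpow_mul]
      norm_num
  have hsub : K ⊆ O := (self_subset_cthickening K).trans hK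
  calc ∫⁻ x in K, ENNReal.ofReal ℓ⁻¹ *
        ∫⁻ z in closedBall (0 : Sp d) R, ‖v (x + ℓ • z) - v x‖ₑ ^ 3
      ≤ ∫⁻ x in K, ENNReal.ofReal ℓ⁻¹ * (volume (ball (0 : Sp d) R) * (W⁻¹ *
          ∫⁻ y in ball (0 : Sp d) r ∩ {y | x + y ∈ O}, ‖v (x + y) - v x‖ₑ ^ (3 : ℝ))) := by
        refine setLIntegral_mono' hKm fun x hx => ?_
        gcongr
        rw [lintegral_comp_smul_closedBall (fun y => ‖v (x + y) - v x‖ₑ ^ 3) hℓ hR, ← hWR]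
        -- For `x ∈ K` all of these points `x + y` lie in `O`, so the restriction on pairs in the
        -- modulus is void.
        have hset : ball (0 : Sp d) r ∩ {y | x + y ∈ O} = ball (0 : Sp d) r := by
          refine inter_eq_left.2 fun y hy => hK ?_
          refine closedBall_subset_cthickening hx δ ?_
          rw [mem_closedBall_iff_norm, add_sub_cancel_left]
          exact (mem_ball_zero_iff.1 hy).le.trans hδ
        rw [hset]
        have h3 : ∀ a : ℝ≥0∞, a ^ (3 : ℝ) = a ^ 3 := fun a => by
          rw [← ENNReal.rpow_natCast]; norm_num
        simp only [h3]
        refine le_of_eq ?_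
        rw [mul_assoc, ← mul_assoc W, ENNReal.mul_inv_cancel hW0 hWt, one_mul]
    _ = ENNReal.ofReal ℓ⁻¹ * (volume (ball (0 : Sp d) R) * ∫⁻ x in K, W⁻¹ *
          ∫⁻ y in ball (0 : Sp d) r ∩ {y | x + y ∈ O}, ‖v (x + y) - v x‖ₑ ^ (3 : ℝ)) := by
        rw [lintegral_const_mul' _ _ (by finiteness),
          lintegral_const_mul' _ _ measure_ball_lt_top.ne]
    _ ≤ ENNReal.ofReal ℓ⁻¹ * (volume (ball (0 : Sp d) R) * I) := by
        gcongr
        exact lintegral_mono_set hsub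
    _ = _ := by
        rw [hmod]
        have : ENNReal.ofReal ℓ⁻¹ = ENNReal.ofReal R * ENNReal.ofReal r⁻¹ := by
          rw [← ENNReal.ofReal_mul hR.le, hr]
          congr 1; field_simp
        rw [this]; ring

theorem lintegral_dissDR_le_besov (hρ : IsKernel ρ R C) {O K : Set (Sp d)} {δ : ℝ}
    (hK : cthickening δ K ⊆ O) (hKm : MeasurableSet K) :
    ∃ C' : ℝ≥0∞, C' ≠ ⊤ ∧ ∀ (v : Sp d → Sp d) (ℓ : ℝ), 0 < ℓ → R * ℓ ≤ δ →
      ∫⁻ x in K, ‖dissDR ρ (fun y _ => v y) ℓ (x, 0)‖ₑ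
        ≤ C' * besovModulus (1 / 3) 3 O v (R * ℓ) ^ 3 := by
  refine ⟨ENNReal.ofReal C * (ENNReal.ofReal R * volume (ball (0 : Sp d) R)),
    by have := measure_ball_lt_top (μ := volume) (x := (0 : Sp d)) (r := R); finiteness,
    fun v ℓ hℓ hδ => ?_⟩
  rw [mul_assoc]
  refine le_trans ?_ (mul_le_mul_right (lintegral_cubic_increment_le hρ.pos hK hKm hℓ hδ v) _)
  rw [← lintegral_const_mul' _ _ (by finiteness)]
  exact lintegral_mono fun x => enorm_dissDR_le_cubic hρ v hℓ x

theorem lintegral_dissCET_le_besov (hρ : IsKernel ρ R C) (h1 : ∫ z, ρ z = 1) {O K : Set (Sp d)}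
    {δ : ℝ} (hK : cthickening δ K ⊆ O) (hKm : MeasurableSet K) :
    ∃ C' : ℝ≥0∞, C' ≠ ⊤ ∧ ∀ (v : Sp d → Sp d), Integrable (O.indicator v) →
      MemLp (O.indicator v) 2 → ∀ (ℓ : ℝ), 0 < ℓ → R * ℓ < δ →
      ∫⁻ x in K, ‖dissCET ρ (fun y _ => v y) ℓ (x, 0)‖ₑ
        ≤ C' * besovModulus (1 / 3) 3 O v (R * ℓ) ^ 3 := by
  obtain ⟨C₁, hC₁, hb⟩ := enorm_dissCET_le_cubic hρ h1
  refine ⟨C₁ * (ENNReal.ofReal R * volume (ball (0 : Sp d) R)),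
    by have := measure_ball_lt_top (μ := volume) (x := (0 : Sp d)) (r := R); finiteness,
    fun v hv hv2 ℓ hℓ hδ => ?_⟩
  rw [mul_assoc]
  refine le_trans ?_ (mul_le_mul_right (lintegral_cubic_increment_le hρ.pos hK hKm hℓ hδ.le v) _)
  rw [← lintegral_const_mul' _ _ hC₁]
  refine setLIntegral_mono' hKm fun x hx => ?_
  have heq := eqOn_indicator hK v hx
  have hδ0 : 0 ≤ δ := (mul_nonneg hρ.pos.le hℓ.le).trans hδ.le
  rw [dissCET_congr hρ hℓ hδ heq]
  refine (hb _ hv hv2 ℓ hℓ x).trans_eq ?_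
  congr 2
  refine setLIntegral_congr_fun measurableSet_closedBall fun z hz => ?_
  simp only [heq (add_smul_mem_closedBall hℓ hδ.le x hz), heq (mem_closedBall_self hδ0)]


/-! ### Symmetric gradients -/

/-- On `O`, the distributional symmetric gradient of `v` is bounded by `M dx + ν`. -/
def SymGradBound (O : Set (Sp d)) (v : Sp d → Sp d) (M : ℝ≥0∞) (ν : Measure (Sp d)) : Prop :=
  ∀ φ, IsTest O φ → ∀ i j,
    ‖symGradPairing v φ i j‖ₑ ≤ M * (∫⁻ x, ‖φ x‖ₑ) + ∫⁻ x, ‖φ x‖ₑ ∂ν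

/-- The classical symmetric gradient. -/
def symGrad (w : Sp d → Sp d) (i j : Fin d) (x : Sp d) : ℝ :=
  ((fderiv ℝ w x (EuclideanSpace.single j 1)) i +
    (fderiv ℝ w x (EuclideanSpace.single i 1)) j) / 2

theorem partialDeriv_eq_zero_of_notMem {φ : Sp d → ℝ} {x : Sp d} (hx : x ∉ tsupport φ) (i : Fin d) :
    partialDeriv i φ x = 0 := by
  have : fderiv ℝ φ x = 0 :=
    image_eq_zero_of_notMem_tsupport fun h' => hx (tsupport_fderiv_subset ℝ h')
  simp [partialDeriv, this]

theorem symGradPairing_congr {v f : Sp d → Sp d} {φ : Sp d → ℝ} (h : EqOn v f (tsupport φ))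
    (i j : Fin d) : symGradPairing v φ i j = symGradPairing f φ i j := by
  unfold symGradPairing
  congr 2; ext x
  by_cases hx : x ∈ tsupport φ
  · rw [h hx]
  · simp [partialDeriv_eq_zero_of_notMem hx]

theorem SymGradBound.indicator {O O' : Set (Sp d)} {v : Sp d → Sp d} {M : ℝ≥0∞}
    {ν : Measure (Sp d)} (h : SymGradBound O v M ν) (hO : O' ⊆ O) :
    SymGradBound O' (O'.indicator v) M ν := fun φ hφ i j => by
  rw [← symGradPairing_congr (v := v) (fun x hx => (indicator_of_mem (hφ.2.2 hx) v).symm)]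
  exact h φ ⟨hφ.1, hφ.2.1, hφ.2.2.trans hO⟩ i j

/-- The convolution at `x` tests `f` against `y ↦ k (x - y)`. Differentiating in `x` rather than `y`
changes the sign, which matches the minus sign in the distributional pairing. -/
theorem symGrad_convolution {k : Sp d → ℝ} (hk : ContDiff ℝ ∞ k) (hkc : HasCompactSupport k)
    {f : Sp d → Sp d} (hf : Integrable f) (x : Sp d) (i j : Fin d) :
    symGrad (k ⋆[ContinuousLinearMap.lsmul ℝ ℝ] f) i j x
      = symGradPairing f (fun y => k (x - y)) i j := by
  have hD : ∀ i j : Fin d, (fderiv ℝ (k ⋆[ContinuousLinearMap.lsmul ℝ ℝ] f) x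
      (EuclideanSpace.single j 1)) i = -∫ y, f y i * partialDeriv j (fun y => k (x - y)) y := by
    intro i j
    rw [(fderiv_convolution_apply hk hkc hf.locallyIntegrable x _).2 i,
      ← integral_sub_left_eq_self _ volume x, ← integral_neg]
    congr 1; ext y
    have h1 : HasFDerivAt (fun y => k (x - y))
        ((fderiv ℝ k (x - y)).comp (-ContinuousLinearMap.id ℝ (Sp d))) y :=
      ((hk.differentiable (by simp)) (x - y)).hasFDerivAt.comp y
        ((hasFDerivAt_id (𝕜 := ℝ) y).const_sub x)
    rw [partialDeriv, h1.fderiv]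
    simp [mul_comm]
  have hI : ∀ i j : Fin d, Integrable fun y => f y i * partialDeriv j (fun y => k (x - y)) y := by
    intro i j
    have hk' : ContDiff ℝ ∞ (fun y => k (x - y)) := by fun_prop
    have hc : HasCompactSupport (fun y => k (x - y)) :=
      hkc.comp_homeomorph (Homeomorph.subLeft x)
    have hc' : Continuous (partialDeriv j (fun y => k (x - y))) := by
      unfold partialDeriv
      exact (hk'.continuous_fderiv (by simp)).clm_apply continuous_const
    have hs : HasCompactSupport (partialDeriv j (fun y => k (x - y))) :=
      hc.mono' fun y hy => by
        by_contra h'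
        exact hy (partialDeriv_eq_zero_of_notMem h' j)
    obtain ⟨B, hB⟩ := hs.exists_bound_of_continuous hc'
    exact (integrable_coord hf i).mul_bdd (c := B) hc'.aestronglyMeasurable (Eventually.of_forall hB)
  rw [symGrad, hD, hD, symGradPairing, integral_add (hI i j) (hI j i)]
  ring

/-- The function `k (x - ·)` is admissible as soon as the ball about `x` containing its support lies
in `O`. The Lebesgue part of the bound does not depend on `x`, by translation invariance. -/
theorem enorm_symGrad_convolution_le {O : Set (Sp d)} {f : Sp d → Sp d} {M : ℝ≥0∞}
    {ν : Measure (Sp d)} (h : SymGradBound O f M ν) (hf : Integrable f) {k : Sp d → ℝ}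
    (hk : ContDiff ℝ ∞ k) {r : ℝ} (hkr : tsupport k ⊆ closedBall 0 r) {x : Sp d}
    (hx : closedBall x r ⊆ O) (i j : Fin d) :
    ‖symGrad (k ⋆[ContinuousLinearMap.lsmul ℝ ℝ] f) i j x‖ₑ
      ≤ M * (∫⁻ y, ‖k y‖ₑ) + ∫⁻ y, ‖k (x - y)‖ₑ ∂ν := by
  have hkc : HasCompactSupport k :=
    (isCompact_closedBall 0 r).of_isClosed_subset (isClosed_tsupport _) hkr
  have hs : tsupport (fun y => k (x - y)) ⊆ closedBall x r := by
    refine closure_minimal (fun y hy => ?_) isClosed_closedBall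
    have := hkr (subset_tsupport _ (show x - y ∈ Function.support k from hy))
    rwa [mem_closedBall_zero_iff, ← mem_closedBall_iff_norm'] at this
  rw [symGrad_convolution hk hkc hf]
  have ht : IsTest O fun y => k (x - y) :=
    ⟨by fun_prop, hkc.comp_homeomorph (Homeomorph.subLeft x), hs.trans hx⟩
  refine (h _ ht i j).trans_eq ?_
  rw [lintegral_sub_left_eq_self (μ := volume) (fun y => ‖k y‖ₑ) x]

/-- By Tonelli and translation invariance, convolving a measure with a kernel multiplies its mass by
at most the `L¹` norm of the kernel. -/
theorem lintegral_lintegral_kernel_le {k : Sp d → ℝ} (hk : Continuous k) (ν : Measure (Sp d))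
    [SFinite ν] (A : Set (Sp d)) :
    ∫⁻ x in A, ∫⁻ y, ‖k (x - y)‖ₑ ∂ν ≤ (∫⁻ y, ‖k y‖ₑ) * ν univ := by
  calc ∫⁻ x in A, ∫⁻ y, ‖k (x - y)‖ₑ ∂ν ≤ ∫⁻ x, ∫⁻ y, ‖k (x - y)‖ₑ ∂ν :=
        lintegral_mono' Measure.restrict_le_self le_rfl
    _ = ∫⁻ y, (∫⁻ x, ‖k (x - y)‖ₑ) ∂ν := by
        refine lintegral_lintegral_swap (Measurable.aemeasurable ?_)
        exact (hk.comp (continuous_fst.sub continuous_snd)).measurable.enorm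
    _ = ∫⁻ _y, (∫⁻ x, ‖k x‖ₑ) ∂ν := by
        congr 1; ext y
        exact lintegral_sub_right_eq_self (μ := volume) (fun x => ‖k x‖ₑ) y
    _ = _ := lintegral_const _

theorem lintegral_scaledKernel (hρ : IsKernel ρ R C) {ℓ : ℝ} (hℓ : 0 < ℓ) :
    ∫⁻ y, ‖scaledKernel ρ ℓ y‖ₑ = ∫⁻ y, ‖ρ y‖ₑ := by
  have h1 : Integrable (scaledKernel ρ ℓ) :=
    (contDiff_scaledKernel hρ.smooth ℓ).continuous.integrable_of_hasCompactSupport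
      (hasCompactSupport_scaledKernel hρ hℓ)
  rw [← ofReal_integral_norm_eq_lintegral_enorm h1,
    ← ofReal_integral_norm_eq_lintegral_enorm hρ.integrable, integral_comp_sub_smul _ hℓ,
    ← integral_smul]
  congr 2; ext z
  simp only [scaledKernel, smul_neg, smul_smul, inv_mul_cancel₀ hℓ.ne', one_smul, hρ.even, norm_mul,
    smul_eq_mul]
  rw [Real.norm_of_nonneg (by positivity), mul_inv_cancel_left₀ (by positivity)]

theorem lintegral_enorm_kernel_ne_top (hρ : IsKernel ρ R C) : ∫⁻ y, ‖ρ y‖ₑ ≠ ⊤ :=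
  hρ.integrable.2.ne

/-! ### The Constantin--E--Titi approximation and the symmetric gradient -/

/-- The stress is symmetric, so exchanging the indices in the double sum shows that the
antisymmetric part of the gradient drops out. -/
theorem dissCET_eq_symGrad (f : Sp d → Sp d) (ℓ : ℝ) (x : Sp d) :
    dissCET ρ (fun y _ => f y) ℓ (x, 0)
      = ∑ i, ∑ j, stress ρ ℓ f i j x * symGrad (mollify ρ ℓ f) i j x := by
  have hsymm : ∀ i j, stress ρ ℓ f i j x = stress ρ ℓ f j i x := fun i j => by
    simp only [stress, mul_comm]
  set D : Fin d → Fin d → ℝ := fun i j =>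
    (fderiv ℝ (mollify ρ ℓ f) x (EuclideanSpace.single j 1)) i
  have h1 : dissCET ρ (fun y _ => f y) ℓ (x, 0) = ∑ i, ∑ j, stress ρ ℓ f i j x * D i j := rfl
  have h2 : ∑ i, ∑ j, stress ρ ℓ f i j x * D i j = ∑ i, ∑ j, stress ρ ℓ f i j x * D j i := by
    rw [Finset.sum_comm]
    exact Finset.sum_congr rfl fun i _ => Finset.sum_congr rfl fun j _ => by rw [hsymm]
  have h3 : ∑ i, ∑ j, stress ρ ℓ f i j x * symGrad (mollify ρ ℓ f) i j x
      = (∑ i, ∑ j, stress ρ ℓ f i j x * D i j + ∑ i, ∑ j, stress ρ ℓ f i j x * D j i) / 2 := by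
    rw [← Finset.sum_add_distrib, Finset.sum_div]
    refine Finset.sum_congr rfl fun i _ => ?_
    rw [← Finset.sum_add_distrib, Finset.sum_div]
    refine Finset.sum_congr rfl fun j _ => ?_
    simp only [symGrad, D]; ring
  rw [h1, h3, ← h2]; ring

theorem enorm_dissCET_le_symGrad (f : Sp d → Sp d) (ℓ : ℝ) (x : Sp d) {S E : ℝ≥0∞}
    (hS : ∀ i j, ‖stress ρ ℓ f i j x‖ₑ ≤ S) (hE : ∀ i j, ‖symGrad (mollify ρ ℓ f) i j x‖ₑ ≤ E) :
    ‖dissCET ρ (fun y _ => f y) ℓ (x, 0)‖ₑ ≤ d * d * (S * E) := by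
  rw [dissCET_eq_symGrad]
  calc _ ≤ ∑ i, ∑ j, ‖stress ρ ℓ f i j x * symGrad (mollify ρ ℓ f) i j x‖ₑ :=
        (enorm_sum_le _ _).trans (Finset.sum_le_sum fun i _ => enorm_sum_le _ _)
    _ ≤ ∑ _i : Fin d, ∑ _j : Fin d, S * E :=
        Finset.sum_le_sum fun i _ => Finset.sum_le_sum fun j _ => by
          rw [enorm_mul]; exact mul_le_mul' (hS i j) (hE i j)
    _ = _ := by simp; ring

theorem lintegral_lintegral_increment_le {f : Sp d → Sp d} (hf : AEStronglyMeasurable f volume)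
    (ℓ R : ℝ) (A : Set (Sp d)) :
    ∫⁻ x in A, ∫⁻ z in closedBall (0 : Sp d) R, ‖f (x + ℓ • z) - f x‖ₑ ^ 2 ≤ incrementSq f R ℓ := by
  -- At `ℓ = 0` the increments vanish; otherwise `z ↦ x + ℓ • z` preserves null sets, as needed for
  -- the joint measurability.
  rcases eq_or_ne ℓ 0 with rfl | hℓ
  · simp
  have hm : AEMeasurable (fun p : Sp d × Sp d => ‖f (p.1 + ℓ • p.2) - f p.1‖ₑ ^ 2)
      (volume.prod (volume.restrict (closedBall 0 R))) := by
    have hq : Measure.QuasiMeasurePreserving (fun p : Sp d × Sp d => p.1 + ℓ • p.2)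
        ((volume : Measure (Sp d)).prod volume) volume := by
      refine MeasureTheory.QuasiMeasurePreserving.prod_of_right (by fun_prop) ?_
      exact Eventually.of_forall fun x => quasiMeasurePreserving_add_smul x hℓ
    have h1 := hf.comp_quasiMeasurePreserving hq
    have h2 := (hf.comp_fst (ν := (volume : Measure (Sp d))))
    have h3 := ((h1.sub h2).enorm.pow_const 2)
    exact h3.mono_measure (Measure.prod_mono le_rfl Measure.restrict_le_self)
  calc _ ≤ ∫⁻ x, ∫⁻ z in closedBall (0 : Sp d) R, ‖f (x + ℓ • z) - f x‖ₑ ^ 2 :=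
        lintegral_mono' Measure.restrict_le_self le_rfl
    _ = _ := lintegral_lintegral_swap hm

/-- Here Hölder puts the symmetric gradient in `L^∞` and the stress in `L¹`, where it is bounded by
the squared `L²` increments. -/
theorem lintegral_dissCET_le_incrementSq (hρ : IsKernel ρ R C) (h1 : ∫ z, ρ z = 1) :
    ∃ C' : ℝ≥0∞, C' ≠ ⊤ ∧ ∀ (O K : Set (Sp d)) (δ : ℝ), cthickening δ K ⊆ O → MeasurableSet K →
      ∀ (v : Sp d → Sp d) (M : ℝ≥0∞), M ≠ ⊤ → Integrable (O.indicator v) →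
      MemLp (O.indicator v) 2 → SymGradBound O v M 0 → ∀ (ℓ : ℝ), 0 < ℓ → R * ℓ < δ →
      ∫⁻ x in K, ‖dissCET ρ (fun y _ => v y) ℓ (x, 0)‖ₑ
        ≤ C' * (M * incrementSq (O.indicator v) R ℓ) := by
  obtain ⟨C₁, hC₁, hs⟩ := enorm_stress_le hρ h1
  have hρt := lintegral_enorm_kernel_ne_top hρ
  refine ⟨d * d * (C₁ * ∫⁻ y, ‖ρ y‖ₑ), by finiteness,
    fun O K δ hK hKm v M hM hv hv2 hb ℓ hℓ hδ => ?_⟩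
  set f := O.indicator v
  have hb' := hb.indicator subset_rfl
  calc ∫⁻ x in K, ‖dissCET ρ (fun y _ => v y) ℓ (x, 0)‖ₑ
      ≤ ∫⁻ x in K, d * d * (C₁ * (∫⁻ y, ‖ρ y‖ₑ)) * M *
          ∫⁻ z in closedBall (0 : Sp d) R, ‖f (x + ℓ • z) - f x‖ₑ ^ 2 := by
        refine setLIntegral_mono' hKm fun x hx => ?_
        rw [dissCET_congr hρ hℓ hδ (eqOn_indicator hK v hx)]
        refine (enorm_dissCET_le_symGrad f ℓ x (hs f hv hv2 ℓ hℓ x (f x))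
          (E := M * ∫⁻ y, ‖ρ y‖ₑ) fun i j => ?_).trans_eq (by ring)
        have := enorm_symGrad_convolution_le hb' hv (contDiff_scaledKernel hρ.smooth ℓ)
          (tsupport_scaledKernel_subset hρ hℓ) (x := x)
          ((closedBall_subset_closedBall hδ.le).trans
            ((closedBall_subset_cthickening hx δ).trans hK)) i j
        rwa [lintegral_scaledKernel hρ hℓ, lintegral_zero_measure, add_zero] at this
    _ = d * d * (C₁ * (∫⁻ y, ‖ρ y‖ₑ)) * M * ∫⁻ x in K,
          ∫⁻ z in closedBall (0 : Sp d) R, ‖f (x + ℓ • z) - f x‖ₑ ^ 2 :=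
        lintegral_const_mul' _ _ (by finiteness)
    _ ≤ _ := by
        rw [← mul_assoc (d * d * (C₁ * ∫⁻ y, ‖ρ y‖ₑ) : ℝ≥0∞)]
        exact mul_le_mul_right (lintegral_lintegral_increment_le hv.aestronglyMeasurable ℓ R K) _

/-- The dual pairing: the stress is bounded uniformly, and the mollified symmetric gradient has `L¹`
norm at most a multiple of the mass of `ν`. -/
theorem lintegral_dissCET_le_of_stress_le (hρ : IsKernel ρ R C) :
    ∃ C' : ℝ≥0∞, C' ≠ ⊤ ∧ ∀ (O K : Set (Sp d)) (δ : ℝ), cthickening δ K ⊆ O → MeasurableSet K →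
      ∀ (v : Sp d → Sp d) (ν : Measure (Sp d)) [SFinite ν], Integrable (O.indicator v) →
      SymGradBound O v 0 ν → ∀ (ℓ : ℝ), 0 < ℓ → R * ℓ < δ →
      ∀ S : ℝ≥0∞, S ≠ ⊤ → (∀ x ∈ K, ∀ i j, ‖stress ρ ℓ (O.indicator v) i j x‖ₑ ≤ S) →
      ∫⁻ x in K, ‖dissCET ρ (fun y _ => v y) ℓ (x, 0)‖ₑ ≤ C' * (S * ν univ) := by
  have hρt := lintegral_enorm_kernel_ne_top hρ
  refine ⟨d * d * (∫⁻ y, ‖ρ y‖ₑ), by finiteness,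
    fun O K δ hK hKm v ν _ hv hb ℓ hℓ hδ S hSt hS => ?_⟩
  set f := O.indicator v
  have hb' := hb.indicator subset_rfl
  calc ∫⁻ x in K, ‖dissCET ρ (fun y _ => v y) ℓ (x, 0)‖ₑ
      ≤ ∫⁻ x in K, d * d * S * ∫⁻ y, ‖scaledKernel ρ ℓ (x - y)‖ₑ ∂ν := by
        refine setLIntegral_mono' hKm fun x hx => ?_
        rw [dissCET_congr hρ hℓ hδ (eqOn_indicator hK v hx)]
        refine (enorm_dissCET_le_symGrad f ℓ x (hS x hx)
          (E := ∫⁻ y, ‖scaledKernel ρ ℓ (x - y)‖ₑ ∂ν) fun i j => ?_).trans_eq (by ring)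
        have := enorm_symGrad_convolution_le hb' hv (contDiff_scaledKernel hρ.smooth ℓ)
          (tsupport_scaledKernel_subset hρ hℓ) (x := x)
          ((closedBall_subset_closedBall hδ.le).trans
            ((closedBall_subset_cthickening hx δ).trans hK)) i j
        rwa [zero_mul, zero_add] at this
    _ = d * d * S * ∫⁻ x in K, ∫⁻ y, ‖scaledKernel ρ ℓ (x - y)‖ₑ ∂ν :=
        lintegral_const_mul' _ _ (by finiteness)
    _ ≤ d * d * S * ((∫⁻ y, ‖scaledKernel ρ ℓ y‖ₑ) * ν univ) := by
        gcongr
        exact lintegral_lintegral_kernel_le (contDiff_scaledKernel hρ.smooth ℓ).continuous ν K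
    _ = _ := by rw [lintegral_scaledKernel hρ hℓ]; ring


/-! ### The Duchon--Robert approximation of a smooth field -/

theorem clm_apply_eq_sum (L : Sp d →L[ℝ] ℝ) (a : Sp d) :
    L a = ∑ i, L (EuclideanSpace.single i 1) * a i := by
  conv_lhs => rw [← (EuclideanSpace.basisFun (Fin d) ℝ).sum_repr a]
  simp [mul_comm]

theorem inner_eq_sum (a b : Sp d) : inner ℝ a b = ∑ j, a j * b j := by
  simp [PiLp.inner_apply, mul_comm]

/-- Both the trace term and the quadratic form are at most the entrywise sum of `|e i j|` times `‖a‖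
^ 2`, and `(1 + 2) / 4 ≤ 1`. -/
theorem abs_sum_flux_le (e : Fin d → Fin d → ℝ) (a : Sp d) :
    |(1 / 4) * ((∑ i, e i i) * ‖a‖ ^ 2 + 2 * ∑ i, ∑ j, a i * a j * e i j)|
      ≤ (∑ i, ∑ j, |e i j|) * ‖a‖ ^ 2 := by
  have h1 : |∑ i, e i i| ≤ ∑ i, ∑ j, |e i j| :=
    (Finset.abs_sum_le_sum_abs _ _).trans (Finset.sum_le_sum fun i _ =>
      Finset.single_le_sum (f := fun j => |e i j|) (fun _ _ => abs_nonneg _) (Finset.mem_univ i))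
  have h2 : |∑ i, ∑ j, a i * a j * e i j| ≤ (∑ i, ∑ j, |e i j|) * ‖a‖ ^ 2 := by
    rw [Finset.sum_mul]
    refine (Finset.abs_sum_le_sum_abs _ _).trans (Finset.sum_le_sum fun i _ => ?_)
    rw [Finset.sum_mul]
    refine (Finset.abs_sum_le_sum_abs _ _).trans (Finset.sum_le_sum fun j _ => ?_)
    rw [abs_mul, abs_mul, mul_comm, sq]
    have h3 := PiLp.norm_apply_le a i
    have h4 := PiLp.norm_apply_le a j
    rw [Real.norm_eq_abs] at h3 h4
    gcongr
  have h5 : |(∑ i, e i i) * ‖a‖ ^ 2| ≤ (∑ i, ∑ j, |e i j|) * ‖a‖ ^ 2 := by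
    rw [abs_mul, abs_of_nonneg (sq_nonneg ‖a‖)]
    gcongr
  have h6 : 0 ≤ (∑ i, ∑ j, |e i j|) * ‖a‖ ^ 2 := (abs_nonneg _).trans h2
  rw [abs_le] at h2 h5 ⊢
  constructor <;> linarith [h2.1, h2.2, h5.1, h5.2]

/-- Integrating by parts in `z` requires the divergence of `δ |δ|²`, where `δ` is the increment. It
equals `ℓ` times the trace of the gradient times `|δ|²` plus twice the quadratic form of the
gradient in `δ`. The factor `ℓ` removes the singular prefactor, and both terms depend on the
symmetric gradient only. -/
theorem dissDR_eq_of_contDiff (hρ : IsKernel ρ R C) {w : Sp d → Sp d} (hw : ContDiff ℝ 1 w) {ℓ : ℝ}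
    (hℓ : 0 < ℓ) (x : Sp d) :
    dissDR ρ (fun y _ => w y) ℓ (x, 0) = -∫ z, ρ z * ((1 / 4) *
      ((∑ i, symGrad w i i (x + ℓ • z)) * ‖w (x + ℓ • z) - w x‖ ^ 2 +
        2 * ∑ i, ∑ j, (w (x + ℓ • z) - w x) i * (w (x + ℓ • z) - w x) j *
          symGrad w i j (x + ℓ • z))) := by
  set δ : Sp d → Sp d := fun z => w (x + ℓ • z) - w x with hδ
  have hδc : ContDiff ℝ 1 δ := by fun_prop
  set G : Fin d → Sp d → ℝ := fun i z => (1 / (4 * ℓ)) * (δ z i * ‖δ z‖ ^ 2) with hG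
  have hδi : ∀ i, ContDiff ℝ 1 fun z => δ z i := fun i =>
    (EuclideanSpace.proj i : Sp d →L[ℝ] ℝ).contDiff.comp hδc
  have hGc : ∀ i, ContDiff ℝ 1 (G i) := fun i =>
    contDiff_const.mul ((hδi i).mul (hδc.norm_sq ℝ))
  have hrep : ∀ z, integrandDR ρ (fun y _ => w y) ℓ (x, 0) z
      = ∑ i, fderiv ℝ ρ z (EuclideanSpace.single i 1) * G i z := fun z => by
    rw [integrandDR, inner_gradient_eq_fderiv, clm_apply_eq_sum, Finset.sum_mul]
    refine Finset.sum_congr rfl fun i _ => ?_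
    simp only [increment, hG, hδ, PiLp.smul_apply, smul_eq_mul]
    ring
  have hcs : ∀ {g : Sp d → ℝ}, Continuous g → Integrable fun z => ρ z * g z := fun {g} hg =>
    (hρ.smooth.continuous.mul hg).integrable_of_hasCompactSupport hρ.hasCompactSupport.mul_right
  have hcs' : ∀ {g : Sp d → ℝ} (e : Sp d), Continuous g →
      Integrable fun z => fderiv ℝ ρ z e * g z := fun {g} e hg =>
    ((hρ.continuous_fderiv.clm_apply continuous_const).mul hg).integrable_of_hasCompactSupport
      (HasCompactSupport.intro (isCompact_closedBall 0 R) fun z hz => by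
        simp [hρ.fderiv_eq_zero hz])
  have hdG : ∀ i, Continuous fun z => fderiv ℝ (G i) z (EuclideanSpace.single i 1) := fun i =>
    ((hGc i).continuous_fderiv (by simp)).clm_apply continuous_const
  -- There is no boundary term because the kernel has compact support.
  have hibp : ∀ i, ∫ z, fderiv ℝ ρ z (EuclideanSpace.single i 1) * G i z
      = -∫ z, ρ z * fderiv ℝ (G i) z (EuclideanSpace.single i 1) := fun i => by
    rw [integral_mul_fderiv_eq_neg_fderiv_mul_of_integrable (hcs' _ (hGc i).continuous)
      (hcs (hdG i)) (hcs (hGc i).continuous)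
      (fun z _ => hρ.smooth.differentiable (by simp) z)
      (fun z _ => (hGc i).differentiable (by simp) z), neg_neg]
  have hder : ∀ i z, fderiv ℝ (G i) z (EuclideanSpace.single i 1)
      = (1 / 4) * ((fderiv ℝ w (x + ℓ • z) (EuclideanSpace.single i 1)) i * ‖δ z‖ ^ 2 +
          2 * (δ z i * ∑ j, δ z j * (fderiv ℝ w (x + ℓ • z) (EuclideanSpace.single i 1)) j)) := by
    intro i z
    set e : Sp d := EuclideanSpace.single i 1
    set D := fderiv ℝ w (x + ℓ • z)
    have h1 : HasFDerivAt δ (D.comp (ℓ • ContinuousLinearMap.id ℝ (Sp d))) z := by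
      have h2 : HasFDerivAt (fun z : Sp d => x + ℓ • z) (ℓ • ContinuousLinearMap.id ℝ (Sp d)) z :=
        ((hasFDerivAt_id (𝕜 := ℝ) z).fun_const_smul ℓ).const_add x
      exact (((hw.differentiable (by simp)) (x + ℓ • z)).hasFDerivAt.comp z h2).sub_const _
    have h3 : HasFDerivAt (fun z => δ z i)
        ((EuclideanSpace.proj i : Sp d →L[ℝ] ℝ).comp
          (D.comp (ℓ • ContinuousLinearMap.id ℝ (Sp d)))) z :=
      (EuclideanSpace.proj i : Sp d →L[ℝ] ℝ).hasFDerivAt.comp z h1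
    have h4 := (h3.mul h1.norm_sq).const_mul (1 / (4 * ℓ))
    have h5 : fderiv ℝ (G i) z = _ := h4.fderiv
    rw [h5, ← inner_eq_sum]
    simp
    field_simp
    ring
  rw [dissDR]
  simp only [hrep]
  rw [integral_finsetSum _ fun i _ => hcs' _ (hGc i).continuous]
  simp only [hibp, Finset.sum_neg_distrib]
  rw [← integral_finsetSum _ fun i _ => hcs (hdG i)]
  congr 2; ext z
  simp only [hder, ← Finset.mul_sum]
  congr 2
  rw [Finset.sum_add_distrib, Finset.sum_mul, ← Finset.mul_sum]
  congr 1
  · exact Finset.sum_congr rfl fun i _ => by rw [symGrad]; ring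
  · congr 1
    -- The weight `δ z i * δ z j` is symmetric in the indices, so the full gradient may be replaced
    -- by its symmetric part.
    set E : Fin d → Fin d → ℝ := fun i j =>
      (fderiv ℝ w (x + ℓ • z) (EuclideanSpace.single j 1)) i with hE
    have h1 : ∑ i, δ z i * ∑ j, δ z j * E j i = ∑ i, ∑ j, δ z i * δ z j * E j i :=
      Finset.sum_congr rfl fun i _ => by
        rw [Finset.mul_sum]; exact Finset.sum_congr rfl fun j _ => by ring
    have h2 : ∑ i, ∑ j, δ z i * δ z j * E j i = ∑ i, ∑ j, δ z i * δ z j * E i j := by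
      rw [Finset.sum_comm]
      exact Finset.sum_congr rfl fun i _ => Finset.sum_congr rfl fun j _ => by ring
    have h3 : ∑ i, ∑ j, δ z i * δ z j * symGrad w i j (x + ℓ • z)
        = (∑ i, ∑ j, δ z i * δ z j * E i j + ∑ i, ∑ j, δ z i * δ z j * E j i) / 2 := by
      rw [← Finset.sum_add_distrib, Finset.sum_div]
      refine Finset.sum_congr rfl fun i _ => ?_
      rw [← Finset.sum_add_distrib, Finset.sum_div]
      refine Finset.sum_congr rfl fun j _ => ?_
      simp only [symGrad, hE]; ring
    change ∑ i, δ z i * ∑ j, δ z j * E j i = ∑ i, ∑ j, δ z i * δ z j * symGrad w i j (x + ℓ • z)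
    rw [h3, h1, h2]; ring

theorem enorm_dissDR_le_symGrad (hρ : IsKernel ρ R C) {w : Sp d → Sp d} (hw : ContDiff ℝ 1 w)
    {ℓ : ℝ} (hℓ : 0 < ℓ) (x : Sp d) :
    ‖dissDR ρ (fun y _ => w y) ℓ (x, 0)‖ₑ ≤ ENNReal.ofReal C * ∫⁻ z in closedBall (0 : Sp d) R,
      (∑ i, ∑ j, ‖symGrad w i j (x + ℓ • z)‖ₑ) * ‖w (x + ℓ • z) - w x‖ₑ ^ 2 := by
  rw [dissDR_eq_of_contDiff hρ hw hℓ x, enorm_neg, ← lintegral_const_mul' _ _ (by simp),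
    ← lintegral_indicator measurableSet_closedBall]
  refine (enorm_integral_le_lintegral_enorm _).trans (lintegral_mono fun z => ?_)
  by_cases hz : z ∈ closedBall (0 : Sp d) R
  · rw [indicator_of_mem hz, enorm_mul]
    refine mul_le_mul' ?_ ?_
    · rw [← ofReal_norm]; exact ENNReal.ofReal_le_ofReal (hρ.bound z)
    · have := abs_sum_flux_le (fun i j => symGrad w i j (x + ℓ • z)) (w (x + ℓ • z) - w x)
      rw [← Real.norm_eq_abs] at this
      refine (ofReal_norm _).symm.le.trans ((ENNReal.ofReal_le_ofReal this).trans_eq ?_)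
      rw [ENNReal.ofReal_mul (Finset.sum_nonneg fun i _ => Finset.sum_nonneg fun j _ => abs_nonneg _),
        ENNReal.ofReal_sum_of_nonneg fun i _ => Finset.sum_nonneg fun j _ => abs_nonneg _,
        ENNReal.ofReal_pow (norm_nonneg _), ofReal_norm]
      congr 1
      refine Finset.sum_congr rfl fun i _ => ?_
      rw [ENNReal.ofReal_sum_of_nonneg fun j _ => abs_nonneg _]
      exact Finset.sum_congr rfl fun j _ => by rw [← Real.norm_eq_abs, ofReal_norm]
  · simp [hρ.eq_zero hz]

/-! ### Convolution with a probability density -/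

/-- This is `sq_lintegral_le` for the measure with density `κ`, a weighted Cauchy--Schwarz
inequality with an extra factor `2`. -/
theorem sq_lintegral_mul_le {κ h : Sp d → ℝ≥0∞} (hκ : Measurable κ) (hh : AEMeasurable h volume) :
    (∫⁻ t, κ t * h t) ^ 2 ≤ 2 * (∫⁻ t, κ t) * ∫⁻ t, κ t * h t ^ 2 := by
  have hh' : AEMeasurable h (volume.withDensity κ) :=
    hh.mono_ac (withDensity_absolutelyContinuous _ _)
  have := sq_lintegral_le (volume.withDensity κ) hh'
  rwa [lintegral_withDensity_eq_lintegral_mul₀ hκ.aemeasurable hh,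
    lintegral_withDensity_eq_lintegral_mul₀ hκ.aemeasurable (hh.pow_const 2),
    withDensity_apply _ MeasurableSet.univ, Measure.restrict_univ] at this

theorem enorm_convolution_le (k : Sp d → ℝ) (f : Sp d → Sp d) (x : Sp d) :
    ‖(k ⋆[ContinuousLinearMap.lsmul ℝ ℝ] f) x‖ₑ ≤ ∫⁻ t, ‖k t‖ₑ * ‖f (x - t)‖ₑ := by
  rw [convolution_def]
  refine (enorm_integral_le_lintegral_enorm _).trans_eq ?_
  simp [enorm_smul]

theorem convolution_sub_eq {k : Sp d → ℝ} (hk : ContDiff ℝ ∞ k) (hkc : HasCompactSupport k)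
    {f : Sp d → Sp d} (hf : Integrable f) (x h : Sp d) :
    (k ⋆[ContinuousLinearMap.lsmul ℝ ℝ] f) (x + h) - (k ⋆[ContinuousLinearMap.lsmul ℝ ℝ] f) x
      = (k ⋆[ContinuousLinearMap.lsmul ℝ ℝ] fun y => f (y + h) - f y) x := by
  have hex := fun x => hkc.convolutionExists_left (ContinuousLinearMap.lsmul ℝ ℝ (E := Sp d))
    hk.continuous hf.locallyIntegrable x
  rw [convolution_def, convolution_def, convolution_def, ← integral_sub (hex _) (hex _)]
  congr 1; ext1 t
  simp only [ContinuousLinearMap.lsmul_apply, ← smul_sub]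
  congr 3; abel

theorem lintegral_convolution_sq_le {k : Sp d → ℝ} (hk : Continuous k)
    {g : Sp d → Sp d} (hg : AEStronglyMeasurable g volume) :
    ∫⁻ x, ‖(k ⋆[ContinuousLinearMap.lsmul ℝ ℝ] g) x‖ₑ ^ 2
      ≤ 2 * (∫⁻ t, ‖k t‖ₑ) ^ 2 * ∫⁻ x, ‖g x‖ₑ ^ 2 := by
  set I := ∫⁻ t, ‖k t‖ₑ
  have hsub : ∀ x, AEMeasurable (fun t => ‖g (x - t)‖ₑ) volume := fun x =>
    (hg.comp_quasiMeasurePreserving (quasiMeasurePreserving_sub_left volume x)).enorm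
  have hm2 : AEMeasurable (fun p : Sp d × Sp d => ‖k p.2‖ₑ * ‖g (p.1 - p.2)‖ₑ ^ 2)
      ((volume : Measure (Sp d)).prod volume) := by
    refine AEMeasurable.mul (hk.comp continuous_snd).measurable.enorm.aemeasurable ?_
    have h1 := hg.comp_quasiMeasurePreserving
      (quasiMeasurePreserving_sub (volume : Measure (Sp d)) volume)
    exact h1.enorm.pow_const 2
  calc ∫⁻ x, ‖(k ⋆[ContinuousLinearMap.lsmul ℝ ℝ] g) x‖ₑ ^ 2
      ≤ ∫⁻ x, 2 * I * ∫⁻ t, ‖k t‖ₑ * ‖g (x - t)‖ₑ ^ 2 := by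
        gcongr with x
        refine (pow_le_pow_left' (enorm_convolution_le k g x) 2).trans ?_
        exact sq_lintegral_mul_le hk.measurable.enorm (hsub x)
    _ = 2 * I * ∫⁻ x, ∫⁻ t, ‖k t‖ₑ * ‖g (x - t)‖ₑ ^ 2 :=
        lintegral_const_mul'' _ hm2.lintegral_prod_right'
    _ = 2 * I * ∫⁻ t, ∫⁻ x, ‖k t‖ₑ * ‖g (x - t)‖ₑ ^ 2 := by
        rw [lintegral_lintegral_swap hm2]
    _ = 2 * I * ∫⁻ t, ‖k t‖ₑ * ∫⁻ x, ‖g x‖ₑ ^ 2 := by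
        congr 2; ext t
        rw [lintegral_const_mul' _ _ (by simp), lintegral_sub_right_eq_self (fun x => ‖g x‖ₑ ^ 2) t]
    _ = 2 * I * (I * ∫⁻ x, ‖g x‖ₑ ^ 2) := by
        rw [lintegral_mul_const _ hk.measurable.enorm]
    _ = _ := by ring

/-- Increments commute with convolution, so Young's inequality in `L²` applies to each of them; the
factor `2` is inherited from `lintegral_convolution_sq_le`. -/
theorem incrementSq_convolution_le {k : Sp d → ℝ} (hk : ContDiff ℝ ∞ k) (hkc : HasCompactSupport k)
    (hk1 : ∫⁻ t, ‖k t‖ₑ = 1) {f : Sp d → Sp d} (hf : Integrable f) (R ℓ : ℝ) :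
    incrementSq (k ⋆[ContinuousLinearMap.lsmul ℝ ℝ] f) R ℓ ≤ 2 * incrementSq f R ℓ := by
  unfold incrementSq
  rw [← lintegral_const_mul' _ _ (by simp)]
  gcongr with z
  simp only [convolution_sub_eq hk hkc hf]
  have hm : AEStronglyMeasurable (fun y => f (y + ℓ • z) - f y) volume :=
    ((hf.comp_add_right (ℓ • z)).sub hf).aestronglyMeasurable
  simpa [hk1] using lintegral_convolution_sq_le hk.continuous hm

theorem lintegral_normed_bump (φ : ContDiffBump (0 : Sp d)) :
    ∫⁻ t, ‖φ.normed volume t‖ₑ = 1 := by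
  have h1 : Integrable (φ.normed volume) := φ.integrable_normed
  rw [← ofReal_integral_norm_eq_lintegral_enorm h1]
  simp only [Real.norm_of_nonneg (φ.nonneg_normed _), φ.integral_normed, ENNReal.ofReal_one]


theorem enorm_convolution_le_of_ae_le {k : Sp d → ℝ} (hk1 : ∫⁻ t, ‖k t‖ₑ = 1) {f : Sp d → Sp d}
    {x : Sp d} {c : ℝ≥0∞} (hf : ∀ᵐ t, t ∈ Function.support k → ‖f (x - t)‖ₑ ≤ c) :
    ‖(k ⋆[ContinuousLinearMap.lsmul ℝ ℝ] f) x‖ₑ ≤ c := by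
  refine (enorm_convolution_le k f x).trans ?_
  calc ∫⁻ t, ‖k t‖ₑ * ‖f (x - t)‖ₑ ≤ ∫⁻ t, ‖k t‖ₑ * c := by
        refine lintegral_mono_ae ?_
        filter_upwards [hf] with t ht
        by_cases hkt : t ∈ Function.support k
        · gcongr; exact ht hkt
        · simp [Function.notMem_support.1 hkt]
    _ ≤ (∫⁻ t, ‖k t‖ₑ) * c := by
        by_cases hc : c = ⊤
        · rw [hc, hk1, one_mul]; exact le_top
        · rw [lintegral_mul_const' _ _ hc]
    _ = c := by rw [hk1, one_mul]

/-- A sequence of bump functions with radii tending to zero. -/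
def bumpSeq (δ : ℝ) (hδ : 0 < δ) (n : ℕ) : ContDiffBump (0 : Sp d) where
  rIn := δ / (4 * (n + 1))
  rOut := δ / (2 * (n + 1))
  rIn_pos := by positivity
  rIn_lt_rOut := by
    apply div_lt_div_of_pos_left hδ (by positivity)
    have : (0 : ℝ) < n + 1 := by positivity
    linarith

theorem bumpSeq_rOut_le (δ : ℝ) (hδ : 0 < δ) (n : ℕ) :
    (bumpSeq (d := d) δ hδ n).rOut ≤ δ / 2 := by
  change δ / (2 * ((n : ℝ) + 1)) ≤ δ / 2
  apply div_le_div_of_nonneg_left hδ.le (by norm_num)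
  have : (0 : ℝ) ≤ n := by positivity
  linarith

theorem ae_tendsto_bumpSeq_convolution (δ : ℝ) (hδ : 0 < δ) {f : Sp d → Sp d} (hf : Integrable f) :
    ∀ᵐ x, Tendsto (fun n => ((bumpSeq δ hδ n).normed volume ⋆[ContinuousLinearMap.lsmul ℝ ℝ] f) x)
      atTop (𝓝 (f x)) := by
  -- The ratio of outer to inner radius is always `2`; a bounded ratio gives convergence at almost
  -- every point by Lebesgue differentiation.
  refine ContDiffBump.ae_convolution_tendsto_right_of_locallyIntegrable (K := 2) ?_ ?_
    hf.locallyIntegrable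
  · change Tendsto (fun n : ℕ => δ / (2 * ((n : ℝ) + 1))) atTop (𝓝 0)
    have h1 := (tendsto_one_div_add_atTop_nhds_zero_nat (𝕜 := ℝ)).const_mul (δ / 2)
    rw [mul_zero] at h1
    refine h1.congr fun n => ?_
    field_simp
  · refine Eventually.of_forall fun n => le_of_eq ?_
    change δ / (2 * ((n : ℝ) + 1)) = 2 * (δ / (4 * ((n : ℝ) + 1)))
    field_simp; norm_num

theorem tsupport_normed_bump_subset (φ : ContDiffBump (0 : Sp d)) :
    tsupport (φ.normed volume) ⊆ closedBall 0 φ.rOut := by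
  rw [φ.tsupport_normed_eq]

/-! ### From smooth fields to bounded fields for the Duchon--Robert approximation. -/

theorem aestronglyMeasurable_dissDR (hρ : IsKernel ρ R C) {w : Sp d → Sp d} (hw : Continuous w)
    (ℓ : ℝ) : AEStronglyMeasurable (fun x => dissDR ρ (fun y _ => w y) ℓ (x, 0)) volume := by
  have : Continuous fun q : Sp d × Sp d => integrandDR ρ (fun y _ => w y) ℓ (q.1, 0) q.2 := by
    simp only [integrandDR, inner_gradient_eq_fderiv, increment]
    have := hρ.continuous_fderiv
    fun_prop
  exact (this.stronglyMeasurable.integral_prod_right' (ν := volume)).aestronglyMeasurable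

/-- A uniform bound on the approximations dominates the cubic integrand by a constant on the ball
carrying the kernel. This is where boundedness of the field is used. -/
theorem tendsto_dissDR_of_ae_tendsto (hρ : IsKernel ρ R C) {f : Sp d → Sp d} {w : ℕ → Sp d → Sp d}
    {N : ℝ} (hN : ∀ n x, ‖w n x‖ₑ ≤ ENNReal.ofReal N) (hw : ∀ n, Continuous (w n))
    (hlim : ∀ᵐ x, Tendsto (fun n => w n x) atTop (𝓝 (f x))) {ℓ : ℝ} (hℓ : 0 < ℓ) :
    ∀ᵐ x, Tendsto (fun n => dissDR ρ (fun y _ => w n y) ℓ (x, 0)) atTop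
      (𝓝 (dissDR ρ (fun y _ => f y) ℓ (x, 0))) := by
  filter_upwards [hlim] with x hx
  set B : ℝ≥0∞ := ENNReal.ofReal C * ENNReal.ofReal ℓ⁻¹ *
    (ENNReal.ofReal N + ENNReal.ofReal N) ^ 3 with hB
  have hBt : B ≠ ⊤ := by finiteness
  refine tendsto_integral_of_dominated_convergence
    ((closedBall (0 : Sp d) R).indicator fun _ => B.toReal)
    (fun n => aestronglyMeasurable_integrandDR hρ (hw n).aestronglyMeasurable hℓ.ne' x) ?_ ?_ ?_
  · exact (integrable_indicator_iff measurableSet_closedBall).2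
      (integrableOn_const measure_closedBall_lt_top.ne)
  · intro n
    refine Eventually.of_forall fun z => ?_
    have h1 := enorm_integrandDR_le hρ (w n) hℓ x z
    rw [← toReal_enorm]
    by_cases hz : z ∈ closedBall (0 : Sp d) R
    · rw [indicator_of_mem hz] at h1 ⊢
      refine ENNReal.toReal_mono hBt (h1.trans ?_)
      rw [hB]
      gcongr
      exact enorm_sub_le.trans (add_le_add (hN _ _) (hN _ _))
    · rw [indicator_of_notMem hz] at h1 ⊢
      simp [le_zero_iff.1 h1]
  · filter_upwards [(quasiMeasurePreserving_add_smul x hℓ.ne').ae hlim] with z hz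
    simp only [integrandDR, increment]
    have hd := hz.sub hx
    exact ((tendsto_const_nhds (x := ∇ ρ z)).inner (hd.const_smul (1 / (4 * ℓ)))).mul
      (hd.norm.pow 2)

/-- The two parts of the symmetric gradient are paired differently: the bounded part `M` with the
`L²` size of the increments, the integrable part `κ` with their supremum `η`. Tonelli and
translation invariance evaluate the second integral. -/
theorem lintegral_dissDR_smooth_le (hρ : IsKernel ρ R C) {w : Sp d → Sp d} (hw : ContDiff ℝ 1 w)
    {ℓ : ℝ} (hℓ : 0 < ℓ) {K : Set (Sp d)} (hKm : MeasurableSet K) {κ : Sp d → ℝ≥0∞}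
    (hκ : Measurable κ) {M η : ℝ≥0∞} (hM : M ≠ ⊤) (hη : η ≠ ⊤)
    (hE : ∀ x ∈ K, ∀ z ∈ closedBall (0 : Sp d) R, ∀ i j, ‖symGrad w i j (x + ℓ • z)‖ₑ
      ≤ M + κ (x + ℓ • z))
    (hinc : ∀ x ∈ K, ∀ z ∈ closedBall (0 : Sp d) R, ‖w (x + ℓ • z) - w x‖ₑ ≤ η) :
    ∫⁻ x in K, ‖dissDR ρ (fun y _ => w y) ℓ (x, 0)‖ₑ ≤ ENNReal.ofReal C * (d * d) *
      (M * incrementSq w R ℓ + η ^ 2 * (volume (closedBall (0 : Sp d) R) * ∫⁻ x, κ x)) := by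
  set B := closedBall (0 : Sp d) R
  have hmI : Measurable fun q : Sp d × Sp d => ‖w (q.1 + ℓ • q.2) - w q.1‖ₑ ^ 2 := by
    have := hw.continuous
    exact (by fun_prop : Continuous fun q : Sp d × Sp d => w (q.1 + ℓ • q.2) - w q.1).measurable.enorm.pow_const 2
  have hmκ : Measurable fun q : Sp d × Sp d => κ (q.1 + ℓ • q.2) := hκ.comp (by fun_prop)
  calc ∫⁻ x in K, ‖dissDR ρ (fun y _ => w y) ℓ (x, 0)‖ₑ
      ≤ ∫⁻ x in K, ENNReal.ofReal C * (d * d) * ∫⁻ z in B,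
          (M * ‖w (x + ℓ • z) - w x‖ₑ ^ 2 + η ^ 2 * κ (x + ℓ • z)) := by
        refine setLIntegral_mono' hKm fun x hx => ?_
        refine (enorm_dissDR_le_symGrad hρ hw hℓ x).trans ?_
        rw [mul_assoc, ← lintegral_const_mul' (d * d : ℝ≥0∞) _ (by finiteness)]
        refine mul_le_mul_right ?_ _
        refine setLIntegral_mono' measurableSet_closedBall fun z hz => ?_
        calc (∑ i, ∑ j, ‖symGrad w i j (x + ℓ • z)‖ₑ) * ‖w (x + ℓ • z) - w x‖ₑ ^ 2
            ≤ (∑ _i : Fin d, ∑ _j : Fin d, (M + κ (x + ℓ • z))) * ‖w (x + ℓ • z) - w x‖ₑ ^ 2 := by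
              gcongr with i _ j _
              exact hE x hx z hz i j
          _ = d * d * (M * ‖w (x + ℓ • z) - w x‖ₑ ^ 2 +
                ‖w (x + ℓ • z) - w x‖ₑ ^ 2 * κ (x + ℓ • z)) := by simp; ring
          _ ≤ _ := by gcongr; exact hinc x hx z hz
    _ = ENNReal.ofReal C * (d * d) * ∫⁻ x in K, ((∫⁻ z in B, M * ‖w (x + ℓ • z) - w x‖ₑ ^ 2) +
          ∫⁻ z in B, η ^ 2 * κ (x + ℓ • z)) := by
        rw [lintegral_const_mul' _ _ (by finiteness)]
        congr 2; ext x
        exact lintegral_add_right _ ((hmκ.comp measurable_prodMk_left).const_mul _)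
    _ = ENNReal.ofReal C * (d * d) * (M * (∫⁻ x in K, ∫⁻ z in B, ‖w (x + ℓ • z) - w x‖ₑ ^ 2) +
          η ^ 2 * ∫⁻ x in K, ∫⁻ z in B, κ (x + ℓ • z)) := by
        have hη2 : η ^ 2 ≠ ⊤ := by finiteness
        simp only [lintegral_const_mul' _ _ hM, lintegral_const_mul' _ _ hη2]
        rw [lintegral_add_right _ (hmκ.lintegral_prod_right'.const_mul _),
          lintegral_const_mul' _ _ hM, lintegral_const_mul' _ _ hη2]
    _ ≤ _ := by
        gcongr
        · exact lintegral_lintegral_increment_le hw.continuous.aestronglyMeasurable ℓ R K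
        · calc ∫⁻ x in K, ∫⁻ z in B, κ (x + ℓ • z) ≤ ∫⁻ x, ∫⁻ z in B, κ (x + ℓ • z) :=
                lintegral_mono' Measure.restrict_le_self le_rfl
            _ = ∫⁻ z in B, ∫⁻ x, κ (x + ℓ • z) := lintegral_lintegral_swap hmκ.aemeasurable
            _ = ∫⁻ _z in B, ∫⁻ x, κ x := by
                congr 1; ext z
                exact lintegral_add_right_eq_self κ (ℓ • z)
            _ = _ := by rw [setLIntegral_const, mul_comm]

/-- The Duchon--Robert approximation of a bounded field is controlled by its symmetric gradient. -/
theorem lintegral_dissDR_le (hρ : IsKernel ρ R C) :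
    ∃ C' : ℝ≥0∞, C' ≠ ⊤ ∧ ∀ (O K : Set (Sp d)) (δ : ℝ), 0 < δ → cthickening δ K ⊆ O →
      MeasurableSet K → ∀ (f : Sp d → Sp d) (N : ℝ), Integrable f →
      (∀ᵐ x, ‖f x‖ₑ ≤ ENNReal.ofReal N) → ∀ (M : ℝ≥0∞) (ν : Measure (Sp d)) [SFinite ν], M ≠ ⊤ →
      SymGradBound O f M ν → ∀ ℓ : ℝ, 0 < ℓ → R * ℓ ≤ δ / 2 → ∀ η : ℝ≥0∞, η ≠ ⊤ →
      (∀ h : Sp d, ‖h‖ ≤ R * ℓ → ∀ᵐ x, x ∈ cthickening (δ / 2) K → ‖f (x + h) - f x‖ₑ ≤ η) →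
      ∫⁻ x in K, ‖dissDR ρ (fun y _ => f y) ℓ (x, 0)‖ₑ
        ≤ C' * (M * incrementSq f R ℓ + η ^ 2 * ν univ) := by
  set V := volume (closedBall (0 : Sp d) R)
  have hV : V ≠ ⊤ := measure_closedBall_lt_top.ne
  -- The `2` is the loss in `incrementSq_convolution_le` and `V` comes from integrating over `z`;
  -- their sum serves both terms at once.
  refine ⟨ENNReal.ofReal C * (d * d) * (2 + V), by finiteness,
    fun O K δ hδ hK hKm f N hf hN M ν _ hM hb ℓ hℓ hRℓ η hη hinc => ?_⟩
  set φ : ℕ → Sp d → ℝ := fun n => (bumpSeq δ hδ n).normed volume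
  set w : ℕ → Sp d → Sp d := fun n => φ n ⋆[ContinuousLinearMap.lsmul ℝ ℝ] f
  have hφ : ∀ n, ContDiff ℝ ∞ (φ n) := fun n => (bumpSeq δ hδ n).contDiff_normed
  have hφc : ∀ n, HasCompactSupport (φ n) := fun n => (bumpSeq δ hδ n).hasCompactSupport_normed
  have hφ1 : ∀ n, ∫⁻ t, ‖φ n t‖ₑ = 1 := fun n => lintegral_normed_bump _
  have hφs : ∀ n, tsupport (φ n) ⊆ closedBall 0 (δ / 2) := fun n =>
    (tsupport_normed_bump_subset _).trans (closedBall_subset_closedBall (bumpSeq_rOut_le δ hδ n))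
  have hw : ∀ n, ContDiff ℝ 1 (w n) := fun n =>
    ((hφc n).contDiff_convolution_left (ContinuousLinearMap.lsmul ℝ ℝ (E := Sp d)) (hφ n)
      hf.locallyIntegrable).of_le (by simp)
  have hwN : ∀ n x, ‖w n x‖ₑ ≤ ENNReal.ofReal N := fun n x => by
    refine enorm_convolution_le_of_ae_le (hφ1 n) ?_
    filter_upwards [(quasiMeasurePreserving_sub_left volume x).ae hN] with t ht _ using ht
  have hlim := tendsto_dissDR_of_ae_tendsto hρ hwN (fun n => (hw n).continuous)
    (ae_tendsto_bumpSeq_convolution δ hδ hf) hℓ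
  have hbound : ∀ n, ∫⁻ x in K, ‖dissDR ρ (fun y _ => w n y) ℓ (x, 0)‖ₑ
      ≤ ENNReal.ofReal C * (d * d) * (2 + V) * (M * incrementSq f R ℓ + η ^ 2 * ν univ) := by
    intro n
    have hmκ : Measurable fun q : Sp d × Sp d => ‖φ n (q.1 - q.2)‖ₑ :=
      ((hφ n).continuous.comp (continuous_fst.sub continuous_snd)).measurable.enorm
    have h1 := lintegral_dissDR_smooth_le hρ (hw n) hℓ hKm
      (κ := fun y => ∫⁻ y', ‖φ n (y - y')‖ₑ ∂ν) hmκ.lintegral_prod_right' hM hη ?_ ?_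
    · have h2 := lintegral_lintegral_kernel_le (hφ n).continuous ν univ
      rw [hφ1, one_mul, Measure.restrict_univ] at h2
      refine h1.trans ?_
      rw [mul_assoc _ (2 + V)]
      refine mul_le_mul_right ?_ _
      calc M * incrementSq (w n) R ℓ + η ^ 2 * (V * ∫⁻ x, ∫⁻ y', ‖φ n (x - y')‖ₑ ∂ν)
          ≤ M * (2 * incrementSq f R ℓ) + η ^ 2 * (V * ν univ) := by
            gcongr
            exact incrementSq_convolution_le (hφ n) (hφc n) (hφ1 n) hf R ℓ
        _ = 2 * (M * incrementSq f R ℓ) + V * (η ^ 2 * ν univ) := by ring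
        _ ≤ (2 + V) * (M * incrementSq f R ℓ) + (2 + V) * (η ^ 2 * ν univ) := by
            gcongr
            · exact le_self_add
            · exact le_add_self
        _ = _ := by ring
    · intro x hx z hz i j
      have h2 := enorm_symGrad_convolution_le hb hf (hφ n) (hφs n) (x := x + ℓ • z) ?_ i j
      · rwa [hφ1, mul_one] at h2
      -- The mollifier has radius at most `δ / 2` and the shift is at most `R * ℓ ≤ δ / 2`, so only
      -- points within `δ` of `K` are involved.
      · refine Subset.trans ?_ ((closedBall_subset_cthickening hx δ).trans hK)
        refine closedBall_subset_closedBall' ?_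
        have := mem_closedBall.1 (add_smul_mem_closedBall hℓ hRℓ x hz)
        linarith
    · intro x hx z hz
      rw [convolution_sub_eq (hφ n) (hφc n) hf]
      refine enorm_convolution_le_of_ae_le (hφ1 n) ?_
      have hz' : ‖ℓ • z‖ ≤ R * ℓ := by
        have := mem_closedBall_zero_iff.1 hz
        rw [norm_smul, Real.norm_of_nonneg hℓ.le, mul_comm]
        gcongr
      -- An increment of the mollified field is an average of increments of `f` based at points
      -- within `δ / 2` of `K`, hence inherits the bound `η`.
      filter_upwards [(quasiMeasurePreserving_sub_left volume x).ae (hinc _ hz')] with t ht hts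
      refine ht (closedBall_subset_cthickening hx _ ?_)
      have := mem_closedBall_zero_iff.1 (hφs n (subset_tsupport _ hts))
      rwa [mem_closedBall_iff_norm, sub_sub_cancel_left, norm_neg]
  calc ∫⁻ x in K, ‖dissDR ρ (fun y _ => f y) ℓ (x, 0)‖ₑ
      = ∫⁻ x in K, liminf (fun n => ‖dissDR ρ (fun y _ => w n y) ℓ (x, 0)‖ₑ) atTop := by
        refine lintegral_congr_ae (ae_restrict_of_ae ?_)
        filter_upwards [hlim] with x hx
        exact hx.enorm.liminf_eq.symm
    _ ≤ liminf (fun n => ∫⁻ x in K, ‖dissDR ρ (fun y _ => w n y) ℓ (x, 0)‖ₑ) atTop :=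
        lintegral_liminf_le' fun n =>
          (aestronglyMeasurable_dissDR hρ (hw n).continuous ℓ).enorm.restrict
    _ ≤ _ := liminf_le_of_le (by isBoundedDefault) fun b hb => by
        obtain ⟨n, hn⟩ := hb.exists
        exact hn.trans (hbound n)


/-! ### Fields with bounded symmetric gradient are locally bounded -/

theorem inner_fderiv_eq_sum_symGrad (w : Sp d → Sp d) (y h : Sp d) :
    inner ℝ (fderiv ℝ w y h) h = ∑ i, ∑ j, h i * h j * symGrad w i j y := by
  set E : Fin d → Fin d → ℝ := fun i j =>
      (fderiv ℝ w y (EuclideanSpace.single j 1)) i with hE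
  have h0 : ∀ i, (fderiv ℝ w y h) i = ∑ j, E i j * h j := fun i =>
    clm_apply_eq_sum ((EuclideanSpace.proj i : Sp d →L[ℝ] ℝ).comp (fderiv ℝ w y)) h
  have h1 : inner ℝ (fderiv ℝ w y h) h = ∑ i, ∑ j, h i * h j * E i j := by
    rw [inner_eq_sum]
    refine Finset.sum_congr rfl fun i _ => ?_
    rw [h0, Finset.sum_mul]
    exact Finset.sum_congr rfl fun j _ => by ring
  have h2 : ∑ i, ∑ j, h i * h j * E j i = ∑ i, ∑ j, h i * h j * E i j := by
    rw [Finset.sum_comm]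
    exact Finset.sum_congr rfl fun i _ => Finset.sum_congr rfl fun j _ => by ring
  have h3 : ∑ i, ∑ j, h i * h j * symGrad w i j y
      = (∑ i, ∑ j, h i * h j * E i j + ∑ i, ∑ j, h i * h j * E j i) / 2 := by
    rw [← Finset.sum_add_distrib, Finset.sum_div]
    refine Finset.sum_congr rfl fun i _ => ?_
    rw [← Finset.sum_add_distrib, Finset.sum_div]
    refine Finset.sum_congr rfl fun j _ => ?_
    simp only [symGrad, hE]; ring
  rw [h1, h3, h2]; ring

/-- Along the segment, `s ↦ ⟨w (x + s • h), h⟩` has derivative `⟨∇w h, h⟩`, which involves only the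
symmetric gradient. Longitudinal increments are therefore controlled without a bound on the full
gradient. -/
theorem abs_inner_increment_le {w : Sp d → Sp d} (hw : ContDiff ℝ 1 w) {x h : Sp d} {r M : ℝ}
    (hh : ‖h‖ < r) (hM : ∀ y ∈ ball x r, ∀ i j, |symGrad w i j y| ≤ M) :
    |inner ℝ (w (x + h) - w x) h| ≤ d * d * M * ‖h‖ ^ 2 := by
  have hder : ∀ s : ℝ, HasDerivAt (fun s : ℝ => inner ℝ (w (x + s • h)) h)
      (inner ℝ (fderiv ℝ w (x + s • h) h) h) s := fun s => by
    have h1 : HasDerivAt (fun s : ℝ => x + s • h) h s := by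
      simpa using ((hasDerivAt_id s).smul_const h).const_add x
    have h2 := ((hw.differentiable (by simp) (x + s • h)).hasFDerivAt).comp_hasDerivAt s h1
    simpa using h2.inner ℝ (hasDerivAt_const s h)
  have hb : ∀ s ∈ Ico (0 : ℝ) 1, ‖(inner ℝ (fderiv ℝ w (x + s • h) h) h : ℝ)‖
      ≤ d * d * M * ‖h‖ ^ 2 := fun s hs => by
    have hy : x + s • h ∈ ball x r := by
      rw [mem_ball_iff_norm, add_sub_cancel_left, norm_smul, Real.norm_of_nonneg hs.1]
      nlinarith [hs.1, hs.2.le, norm_nonneg h]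
    rw [inner_fderiv_eq_sum_symGrad, Real.norm_eq_abs]
    calc _ ≤ ∑ i, ∑ j, |h i * h j * symGrad w i j (x + s • h)| :=
          (Finset.abs_sum_le_sum_abs _ _).trans
            (Finset.sum_le_sum fun i _ => Finset.abs_sum_le_sum_abs _ _)
      _ ≤ ∑ _i : Fin d, ∑ _j : Fin d, ‖h‖ * ‖h‖ * M := by
          refine Finset.sum_le_sum fun i _ => Finset.sum_le_sum fun j _ => ?_
          rw [abs_mul, abs_mul]
          have h3 := PiLp.norm_apply_le h i
          have h4 := PiLp.norm_apply_le h j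
          rw [Real.norm_eq_abs] at h3 h4
          exact mul_le_mul (mul_le_mul h3 h4 (abs_nonneg _) (norm_nonneg _)) (hM _ hy i j)
            (abs_nonneg _) (by positivity)
      _ = _ := by simp; ring
  have := norm_image_sub_le_of_norm_deriv_le_segment_01' (fun s _ => (hder s).hasDerivWithinAt) hb
  simpa [← inner_sub_left] using this

/-- For `h` close to a vector parallel to `w x`, the longitudinal increment estimate bounds `‖w x‖`
by `‖w (x + h)‖` and an error of order `M * r`. Averaging over a small ball of such `h` leaves only
the `L¹` norm of `w`. -/
theorem enorm_le_of_symGrad_bounded {w : Sp d → Sp d} (hw : ContDiff ℝ 1 w) {x : Sp d} {r M : ℝ}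
    (hr : 0 < r) (hM0 : 0 ≤ M) (hM : ∀ y ∈ ball x r, ∀ i j, |symGrad w i j y| ≤ M) :
    ‖w x‖ₑ ≤ 4 * (∫⁻ y, ‖w y‖ₑ) / volume (ball (0 : Sp d) (r / 4)) +
      ENNReal.ofReal (4 * (d * d * M) * r) := by
  rcases eq_or_ne (w x) 0 with h0 | h0
  · simp [h0]
  have hn : 0 < ‖w x‖ := norm_pos_iff.2 h0
  set e : Sp d := (r / 2 / ‖w x‖) • w x with he
  have hen : ‖e‖ = r / 2 := by
    rw [he, norm_smul, Real.norm_of_nonneg (by positivity)]; field_simp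
  -- The inner product of `w x` with `h` is at least `‖w x‖ * (r / 2 - r / 4)`, whence the factor
  -- `4`.
  have hpt : ∀ h ∈ ball e (r / 4), ‖w x‖ ≤ 4 * ‖w (x + h)‖ + 4 * (d * d * M) * r := by
    intro h hh
    have hh' : ‖h - e‖ < r / 4 := mem_ball_iff_norm.1 hh
    have hhr : ‖h‖ < r := by
      have := norm_add_le (h - e) e
      rw [sub_add_cancel] at this
      linarith
    have h1 := abs_inner_increment_le hw hhr hM
    have h2 : ‖w x‖ * (r / 4) ≤ inner ℝ (w x) h := by
      have h3 : inner ℝ (w x) e = ‖w x‖ * (r / 2) := by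
        rw [he, inner_smul_right, real_inner_self_eq_norm_sq]; field_simp
      have h4 : -(‖w x‖ * (r / 4)) ≤ inner ℝ (w x) (h - e) := by
        have := (abs_le.1 (abs_real_inner_le_norm (w x) (h - e))).1
        nlinarith
      have h5 : inner ℝ (w x) h = inner ℝ (w x) (h - e) + inner ℝ (w x) e := by
        rw [← inner_add_right, sub_add_cancel]
      linarith
    have h6 : inner ℝ (w (x + h)) h ≤ ‖w (x + h)‖ * r :=
      (real_inner_le_norm _ _).trans (by gcongr)
    have h7 := (abs_le.1 h1).1
    rw [inner_sub_left] at h7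
    have h8 : d * d * M * ‖h‖ ^ 2 ≤ d * d * M * (r * r) := by
      have : 0 ≤ d * d * M := by positivity
      nlinarith [norm_nonneg h, mul_le_mul hhr.le hhr.le (norm_nonneg h) hr.le]
    have h9 : r * ‖w x‖ ≤ r * (4 * ‖w (x + h)‖ + 4 * (d * d * M) * r) := by nlinarith
    exact le_of_mul_le_mul_left h9 hr
  set V := volume (ball (0 : Sp d) (r / 4)) with hV
  have hVe : volume (ball e (r / 4)) = V := Measure.addHaar_ball_center _ _ _
  have hV0 : V ≠ 0 := (measure_ball_pos _ _ (by positivity)).ne'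
  have hVt : V ≠ ⊤ := measure_ball_lt_top.ne
  have hint : ‖w x‖ₑ * V ≤ 4 * (∫⁻ y, ‖w y‖ₑ) + ENNReal.ofReal (4 * (d * d * M) * r) * V := by
    calc ‖w x‖ₑ * V = ∫⁻ _h in ball e (r / 4), ‖w x‖ₑ := by rw [setLIntegral_const, hVe]
      _ ≤ ∫⁻ h in ball e (r / 4), (4 * ‖w (x + h)‖ₑ + ENNReal.ofReal (4 * (d * d * M) * r)) := by
          refine setLIntegral_mono' measurableSet_ball fun h hh => ?_
          have := ENNReal.ofReal_le_ofReal (hpt h hh)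
          rwa [ENNReal.ofReal_add (by positivity) (by positivity), ENNReal.ofReal_mul (by norm_num),
            ofReal_norm, ofReal_norm, ENNReal.ofReal_ofNat] at this
      _ = 4 * (∫⁻ h in ball e (r / 4), ‖w (x + h)‖ₑ) +
            ENNReal.ofReal (4 * (d * d * M) * r) * V := by
          rw [lintegral_add_right _ measurable_const, setLIntegral_const, hVe,
            lintegral_const_mul' _ _ (by simp)]
      _ ≤ 4 * (∫⁻ h, ‖w (x + h)‖ₑ) + ENNReal.ofReal (4 * (d * d * M) * r) * V := by
          gcongr
          exact Measure.restrict_le_self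
      _ = _ := by rw [lintegral_add_left_eq_self (fun y => ‖w y‖ₑ) x]
  calc ‖w x‖ₑ = ‖w x‖ₑ * V / V := (ENNReal.mul_div_cancel_right hV0 hVt).symm
    _ ≤ (4 * (∫⁻ y, ‖w y‖ₑ) + ENNReal.ofReal (4 * (d * d * M) * r) * V) / V := by gcongr
    _ = _ := by rw [ENNReal.add_div, ENNReal.mul_div_cancel_right hV0 hVt]

theorem lintegral_convolution_le {k : Sp d → ℝ} (hk : Continuous k) {g : Sp d → Sp d}
    (hg : AEStronglyMeasurable g volume) :
    ∫⁻ x, ‖(k ⋆[ContinuousLinearMap.lsmul ℝ ℝ] g) x‖ₑ ≤ (∫⁻ t, ‖k t‖ₑ) * ∫⁻ x, ‖g x‖ₑ := by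
  have hm2 : AEMeasurable (fun p : Sp d × Sp d => ‖k p.2‖ₑ * ‖g (p.1 - p.2)‖ₑ)
      ((volume : Measure (Sp d)).prod volume) := by
    refine AEMeasurable.mul (hk.comp continuous_snd).measurable.enorm.aemeasurable ?_
    exact (hg.comp_quasiMeasurePreserving
      (quasiMeasurePreserving_sub (volume : Measure (Sp d)) volume)).enorm
  calc _ ≤ ∫⁻ x, ∫⁻ t, ‖k t‖ₑ * ‖g (x - t)‖ₑ := lintegral_mono fun x => enorm_convolution_le k g x
    _ = ∫⁻ t, ∫⁻ x, ‖k t‖ₑ * ‖g (x - t)‖ₑ := lintegral_lintegral_swap hm2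
    _ = ∫⁻ t, ‖k t‖ₑ * ∫⁻ x, ‖g x‖ₑ := by
        congr 1; ext t
        rw [lintegral_const_mul' _ _ (by simp), lintegral_sub_right_eq_self (fun x => ‖g x‖ₑ) t]
    _ = _ := lintegral_mul_const _ hk.measurable.enorm

theorem exists_bound_of_symGradBound {O K : Set (Sp d)} {δ : ℝ} (hδ : 0 < δ)
    (hK : cthickening δ K ⊆ O) {f : Sp d → Sp d} (hf : Integrable f) {M : ℝ≥0∞} (hM : M ≠ ⊤)
    (hb : SymGradBound O f M 0) :
    ∃ N : ℝ, ∀ᵐ x, x ∈ cthickening (δ / 2) K → ‖f x‖ₑ ≤ ENNReal.ofReal N := by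
  -- The distances add up to `δ`: the point lies within `δ / 2` of `K`, the pointwise estimate uses
  -- a ball of radius `δ / 4`, and the mollifier has radius at most `δ / 4`.
  set φ : ℕ → Sp d → ℝ := fun n => (bumpSeq (δ / 2) (half_pos hδ) n).normed volume
  set w : ℕ → Sp d → Sp d := fun n => φ n ⋆[ContinuousLinearMap.lsmul ℝ ℝ] f
  have hφ : ∀ n, ContDiff ℝ ∞ (φ n) := fun n => (bumpSeq (δ / 2) _ n).contDiff_normed
  have hφc : ∀ n, HasCompactSupport (φ n) := fun n =>
    (bumpSeq (δ / 2) _ n).hasCompactSupport_normed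
  have hφ1 : ∀ n, ∫⁻ t, ‖φ n t‖ₑ = 1 := fun n => lintegral_normed_bump _
  have hφs : ∀ n, tsupport (φ n) ⊆ closedBall 0 (δ / 4) := fun n =>
    (tsupport_normed_bump_subset _).trans (closedBall_subset_closedBall
      ((bumpSeq_rOut_le (δ / 2) _ n).trans (by linarith)))
  have hw : ∀ n, ContDiff ℝ 1 (w n) := fun n =>
    ((hφc n).contDiff_convolution_left (ContinuousLinearMap.lsmul ℝ ℝ (E := Sp d)) (hφ n)
      hf.locallyIntegrable).of_le (by simp)
  set B : ℝ≥0∞ := 4 * (∫⁻ y, ‖f y‖ₑ) / volume (ball (0 : Sp d) (δ / 4 / 4)) +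
      ENNReal.ofReal (4 * (d * d * M.toReal) * (δ / 4)) with hB
  have hBt : B ≠ ⊤ := by
    have h1 : ∫⁻ y, ‖f y‖ₑ ≠ ⊤ := hf.2.ne
    have h2 : volume (ball (0 : Sp d) (δ / 4 / 4)) ≠ 0 :=
      (measure_ball_pos _ _ (by positivity)).ne'
    have h3 := ENNReal.div_ne_top (ENNReal.mul_ne_top (by simp : (4 : ℝ≥0∞) ≠ ⊤) h1) h2
    finiteness
  have hbound : ∀ n, ∀ x ∈ cthickening (δ / 2) K, ‖w n x‖ₑ ≤ B := by
    intro n x hx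
    have h1 := enorm_le_of_symGrad_bounded (hw n) (x := x) (r := δ / 4) (M := M.toReal)
      (by positivity) ENNReal.toReal_nonneg ?_
    · refine h1.trans ?_
      rw [hB]
      have h2 := lintegral_convolution_le (hφ n).continuous hf.aestronglyMeasurable
      rw [hφ1, one_mul] at h2
      gcongr
    · intro y hy i j
      have h2 := enorm_symGrad_convolution_le hb hf (hφ n) (hφs n) (x := y) ?_ i j
      · rw [hφ1, mul_one, lintegral_zero_measure, add_zero] at h2
        rw [← Real.norm_eq_abs, ← toReal_enorm]
        exact ENNReal.toReal_mono hM h2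
      · intro y' hy'
        refine hK (cthickening_mono (by linarith) K
          (cthickening_cthickening_subset (by positivity : 0 ≤ δ / 2) (by positivity : 0 ≤ δ / 2) K
            (closedBall_subset_cthickening hx (δ / 2) ?_)))
        have h3 := mem_closedBall.1 hy'
        have h4 := mem_ball.1 hy
        have h5 := dist_triangle y' y x
        rw [mem_closedBall]; linarith
  refine ⟨B.toReal, ?_⟩
  filter_upwards [ae_tendsto_bumpSeq_convolution (δ / 2) (half_pos hδ) hf] with x hx hxK
  rw [ENNReal.ofReal_toReal hBt]
  exact le_of_tendsto hx.enorm (Eventually.of_forall fun n => hbound n x hxK)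

/-! ### Bounds on the symmetric gradient -/

theorem lintegral_mul_eq_setLIntegral {O : Set (Sp d)} {φ : Sp d → ℝ} (hφ : IsTest O φ)
    (μ : Measure (Sp d)) (g : Sp d → ℝ≥0∞) :
    ∫⁻ x, ‖φ x‖ₑ * g x ∂μ = ∫⁻ x in O, ‖φ x‖ₑ * g x ∂μ := by
  refine (setLIntegral_eq_of_support_subset fun x hx => hφ.2.2 (subset_tsupport _ ?_)).symm
  intro h
  exact hx (by simp [h])

theorem symGradBound_of_isSymGradMeasure {O : Set (Sp d)} {v : Sp d → Sp d}
    {μ : VectorMeasure (Sp d) (Mat d)} (h : IsSymGradMeasure O v μ) :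
    SymGradBound O v 0 (μ.variation.restrict O) := fun φ hφ i j => by
  rw [← h.2 φ hφ i j, zero_mul, zero_add]
  have h1 := lintegral_mul_eq_setLIntegral hφ μ.variation 1
  simp only [Pi.one_apply, mul_one] at h1
  rw [← h1]
  calc _ ≤ ‖VectorMeasure.integral μ φ (ContinuousLinearMap.lsmul ℝ ℝ)‖ₑ := by
        rw [← ofReal_norm, ← ofReal_norm]
        exact ENNReal.ofReal_le_ofReal (PiLp.norm_apply_le _ (i, j))
    _ ≤ _ := VectorMeasure.enorm_integral_le_lintegral_enorm_transpose
    _ = _ := by rw [VectorMeasure.variation_transpose_lsmul]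

/-- The split `M + g` is left open: `M = 0` gives the total mass, `g = 0` a bounded gradient, and `M
= n` with `g` the part of `‖G‖` above height `n` gives the truncation. -/
theorem symGradBound_of_isSymGradFun {O : Set (Sp d)} {v : Sp d → Sp d} {G : Sp d → Mat d}
    (h : IsSymGradFun O v G) {M : ℝ≥0∞} {g : Sp d → ℝ≥0∞} (hg : AEMeasurable g (volume.restrict O))
    (hMg : ∀ᵐ x ∂(volume.restrict O), ‖G x‖ₑ ≤ M + g x) :
    SymGradBound O v M ((volume.restrict O).withDensity g) := fun φ hφ i j => by
  rw [← h.2.2 φ hφ i j]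
  have hφm : Measurable fun x => ‖φ x‖ₑ := hφ.1.continuous.measurable.enorm
  calc ‖∫ x, φ x * G x (i, j)‖ₑ ≤ ∫⁻ x, ‖φ x‖ₑ * ‖G x (i, j)‖ₑ := by
        refine (enorm_integral_le_lintegral_enorm _).trans_eq ?_
        simp only [enorm_mul]
    _ = ∫⁻ x in O, ‖φ x‖ₑ * ‖G x (i, j)‖ₑ := lintegral_mul_eq_setLIntegral hφ _ _
    _ ≤ ∫⁻ x in O, (‖φ x‖ₑ * M + ‖φ x‖ₑ * g x) := by
        refine lintegral_mono_ae ?_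
        filter_upwards [hMg] with x hx
        rw [← mul_add]
        gcongr
        refine le_trans ?_ hx
        rw [← ofReal_norm, ← ofReal_norm]
        exact ENNReal.ofReal_le_ofReal (PiLp.norm_apply_le _ (i, j))
    _ = (∫⁻ x in O, ‖φ x‖ₑ * M) + ∫⁻ x in O, ‖φ x‖ₑ * g x :=
        lintegral_add_left (hφm.mul_const _) _
    _ ≤ M * (∫⁻ x, ‖φ x‖ₑ) + ∫⁻ x, ‖φ x‖ₑ ∂((volume.restrict O).withDensity g) := by
        refine add_le_add ?_ ?_
        · rw [lintegral_mul_const _ hφm, mul_comm]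
          gcongr
          exact Measure.restrict_le_self
        · rw [lintegral_withDensity_eq_lintegral_mul₀ hg hφm.aemeasurable]
          simp [mul_comm]


/-! ### Bounds and limits at a fixed time -/

theorem eventually_scale_le (R : ℝ) {δ : ℝ} (hδ : 0 < δ) :
    ∀ᶠ ℓ in 𝓝[>] (0 : ℝ), 0 < ℓ ∧ R * ℓ ≤ δ := by
  have h1 : Tendsto (fun ℓ : ℝ => R * ℓ) (𝓝[>] 0) (𝓝 0) := by
    have : Continuous fun ℓ : ℝ => R * ℓ := by fun_prop
    simpa using (this.tendsto 0).mono_left nhdsWithin_le_nhds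
  filter_upwards [self_mem_nhdsWithin, h1.eventually_le_const hδ] with ℓ h2 h3 using ⟨h2, h3⟩

theorem lintegral_enorm_sq_eq (f : Sp d → Sp d) (μ : Measure (Sp d)) :
    ∫⁻ x, ‖f x‖ₑ ^ 2 ∂μ = eLpNorm f 2 μ ^ 2 := by
  rw [eLpNorm_eq_lintegral_rpow_enorm_toReal (by simp) (by simp), ← ENNReal.rpow_natCast,
    ← ENNReal.rpow_mul]
  simp

theorem memLp_indicator_of_eLpNorm_ne_top {O : Set (Sp d)} (hO : MeasurableSet O) {v : Sp d → Sp d}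
    (hv : AEStronglyMeasurable v (volume.restrict O)) {p : ℝ≥0∞}
    (hp : eLpNorm v p (volume.restrict O) ≠ ⊤) : MemLp (O.indicator v) p :=
  (memLp_indicator_iff_restrict hO).2 ⟨hv, hp.lt_top⟩

theorem memLp_indicator_of_le {O : Set (Sp d)} (hO : MeasurableSet O) (hOt : volume O ≠ ⊤)
    {v : Sp d → Sp d} {p q : ℝ≥0∞} (h : MemLp (O.indicator v) q) (hpq : p ≤ q) :
    MemLp (O.indicator v) p := by
  rw [memLp_indicator_iff_restrict hO] at h ⊢
  have : IsFiniteMeasure (volume.restrict O) := ⟨by simpa using hOt.lt_top⟩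
  exact h.mono_exponent hpq

theorem ae_indicator_le {O : Set (Sp d)} (hO : MeasurableSet O) {v : Sp d → Sp d} {a : ℝ≥0∞}
    (h : lebNorm ⊤ O v ≤ a) : ∀ᵐ x, ‖O.indicator v x‖ₑ ≤ a := by
  have h1 : eLpNorm (O.indicator v) ⊤ volume ≤ a := by
    rwa [eLpNorm_indicator_eq_eLpNorm_restrict hO]
  rw [eLpNorm_exponent_top] at h1
  filter_upwards [ae_le_eLpNormEssSup (f := O.indicator v) (μ := volume)] with x hx
  exact hx.trans h1

theorem ae_increment_le {f : Sp d → Sp d} {a : ℝ≥0∞} (h : ∀ᵐ x, ‖f x‖ₑ ≤ a) (y : Sp d) :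
    ∀ᵐ x, ‖f (x + y) - f x‖ₑ ≤ 2 * a := by
  filter_upwards [h, (measurePreserving_add_right volume y).quasiMeasurePreserving.ae h] with x h1 h2
  exact enorm_sub_le.trans ((add_le_add h2 h1).trans_eq (two_mul a).symm)

/-- The geometric setting at a fixed time: `K` is well inside the bounded open set `O`. -/
structure IsInside (K O : Set (Sp d)) (δ : ℝ) : Prop where
  pos : 0 < δ
  subset : cthickening δ K ⊆ O
  compact : IsCompact K
  isOpen : IsOpen O
  volume_ne_top : volume O ≠ ⊤

theorem IsInside.mono {K O : Set (Sp d)} {δ δ' : ℝ} (h : IsInside K O δ) (hδ' : 0 < δ')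
    (hle : δ' ≤ δ) : IsInside K O δ' :=
  ⟨hδ', (cthickening_mono hle K).trans h.subset, h.compact, h.isOpen, h.volume_ne_top⟩

theorem IsInside.thickening_subset {K O : Set (Sp d)} {δ : ℝ} (h : IsInside K O δ) :
    thickening (δ / 2) K ⊆ O :=
  (thickening_subset_cthickening _ _).trans
    ((cthickening_mono (by linarith [h.pos]) K).trans h.subset)

/-- Local boundedness and John--Nirenberg give information only in the interior of `O`; this smaller
set still surrounds `K` with a margin. -/
theorem IsInside.thickening {K O : Set (Sp d)} {δ : ℝ} (h : IsInside K O δ) :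
    IsInside K (thickening (δ / 2) K) (δ / 4) := by
  have hδ := h.pos
  exact ⟨by positivity, cthickening_subset_thickening' (by positivity) (by linarith) K, h.compact,
    isOpen_thickening, ne_top_of_le_ne_top h.volume_ne_top (measure_mono h.thickening_subset)⟩

/-! ### The Duchon--Robert approximation at a fixed time. -/

theorem lintegral_dissDR_le_of_bounded (hρ : IsKernel ρ R C) :
    ∃ C' : ℝ≥0∞, C' ≠ ⊤ ∧ ∀ (K O : Set (Sp d)) (δ : ℝ), IsInside K O δ → ∀ (v : Sp d → Sp d),
      AEStronglyMeasurable v (volume.restrict O) → ∀ a : ℝ≥0∞, a ≠ ⊤ → lebNorm ⊤ O v ≤ a →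
      ∀ (M : ℝ≥0∞) (ν : Measure (Sp d)) [SFinite ν], M ≠ ⊤ → SymGradBound O v M ν →
      ∀ ℓ : ℝ, 0 < ℓ → R * ℓ ≤ δ / 2 → ∀ η : ℝ≥0∞, η ≠ ⊤ →
      (∀ h : Sp d, ‖h‖ ≤ R * ℓ → ∀ᵐ x, x ∈ cthickening (δ / 2) K →
        ‖O.indicator v (x + h) - O.indicator v x‖ₑ ≤ η) →
      ∫⁻ x in K, ‖dissDR ρ (fun y _ => v y) ℓ (x, 0)‖ₑ
        ≤ C' * (M * incrementSq (O.indicator v) R ℓ + η ^ 2 * ν univ) := by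
  obtain ⟨C', hC', h⟩ := lintegral_dissDR_le hρ
  refine ⟨C', hC', fun K O δ hKO v hv a ha hva M ν _ hM hb ℓ hℓ hRℓ η hη hinc => ?_⟩
  have hOm := hKO.isOpen.measurableSet
  have hint : Integrable (O.indicator v) := memLp_one_iff_integrable.1
    (memLp_indicator_of_le hOm hKO.volume_ne_top
      (memLp_indicator_of_eLpNorm_ne_top hOm hv (ne_top_of_le_ne_top ha hva)) le_top)
  have hbd : ∀ᵐ x, ‖O.indicator v x‖ₑ ≤ ENNReal.ofReal a.toReal := by
    rw [ENNReal.ofReal_toReal ha]; exact ae_indicator_le hOm hva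
  refine le_trans (le_of_eq ?_) (h O K δ hKO.pos hKO.subset hKO.compact.measurableSet _ _ hint hbd
    M ν hM (hb.indicator subset_rfl) ℓ hℓ hRℓ η hη hinc)
  refine setLIntegral_congr_fun hKO.compact.measurableSet fun x hx => ?_
  rw [dissDR_congr hρ hℓ (hRℓ.trans (by linarith [hKO.pos])) (eqOn_indicator hKO.subset v hx)]

theorem integrable_integrandDR_of_memLp (hρ : IsKernel ρ R C) {K O : Set (Sp d)} {δ : ℝ}
    (hKO : IsInside K O δ) {v : Sp d → Sp d} (hv : MemLp (O.indicator v) 3) {ℓ : ℝ} (hℓ : 0 < ℓ)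
    (hRℓ : R * ℓ ≤ δ) {x : Sp d} (hx : x ∈ K) :
    Integrable (integrandDR ρ (fun y _ => v y) ℓ (x, 0)) := by
  rw [integrandDR_congr hρ hℓ hRℓ (eqOn_indicator hKO.subset v hx)]
  exact integrable_integrandDR hρ hv hℓ x

/-- A continuous representative is uniformly continuous on the compact set `cthickening δ K`, which
contains both `x` and `x + h` for small `ℓ`. -/
theorem ae_indicator_increment_le_of_continuous {K O : Set (Sp d)} {δ : ℝ} (hKO : IsInside K O δ)
    {v w : Sp d → Sp d} (hw : ContinuousOn w O) (hvw : v =ᵐ[volume.restrict O] w) {e : ℝ}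
    (he : 0 < e) (R : ℝ) : ∀ᶠ ℓ in 𝓝[>] (0 : ℝ), ∀ h : Sp d, ‖h‖ ≤ R * ℓ →
      ∀ᵐ x, x ∈ cthickening (δ / 2) K →
        ‖O.indicator v (x + h) - O.indicator v x‖ₑ ≤ ENNReal.ofReal e := by
  have hcomp : IsCompact (cthickening δ K) := hKO.compact.cthickening
  have hunif := hcomp.uniformContinuousOn_of_continuous (hw.mono hKO.subset)
  obtain ⟨r, hr, hwr⟩ := Metric.uniformContinuousOn_iff.1 hunif e he
  have hδ := hKO.pos
  have hae : ∀ᵐ x, x ∈ O → v x = w x := (ae_restrict_iff' hKO.isOpen.measurableSet).1 hvw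
  filter_upwards [eventually_scale_le R (half_pos hδ), eventually_scale_le R (half_pos hr)]
    with ℓ h1 h2 h hh
  filter_upwards [hae, (measurePreserving_add_right volume h).quasiMeasurePreserving.ae hae]
    with x hx1 hx2 hxK
  have m1 : x ∈ cthickening δ K := cthickening_mono (by linarith) K hxK
  have m2 : x + h ∈ cthickening δ K := by
    refine cthickening_mono (by linarith) K
      (cthickening_cthickening_subset (by positivity : 0 ≤ δ / 2) (by positivity : 0 ≤ δ / 2) K
        (closedBall_subset_cthickening hxK (δ / 2) ?_))
    rw [mem_closedBall_iff_norm, add_sub_cancel_left]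
    exact hh.trans h1.2
  rw [indicator_of_mem (hKO.subset m1), indicator_of_mem (hKO.subset m2),
    hx1 (hKO.subset m1), hx2 (hKO.subset m2), ← ofReal_norm]
  refine ENNReal.ofReal_le_ofReal ?_
  rw [← dist_eq_norm]
  refine (hwr _ m2 _ m1 ?_).le
  rw [dist_eq_norm, add_sub_cancel_left]
  linarith [h2.2]

theorem exists_small_mul {B : ℝ≥0∞} (hB : B ≠ ⊤) {ε : ℝ≥0∞} (hε : 0 < ε) :
    ∃ e : ℝ, 0 < e ∧ ENNReal.ofReal e ^ 2 * B ≤ ε := by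
  have h1 : Tendsto (fun e : ℝ => ENNReal.ofReal e ^ 2 * B) (𝓝[>] 0) (𝓝 0) := by
    have h2 : Tendsto (fun e : ℝ => ENNReal.ofReal e) (𝓝[>] 0) (𝓝 0) := by
      have := (ENNReal.continuous_ofReal.tendsto 0).mono_left
        (nhdsWithin_le_nhds (a := (0 : ℝ)) (s := Ioi 0))
      rwa [ENNReal.ofReal_zero] at this
    have h3 := ENNReal.Tendsto.mul_const (b := B) (ENNReal.Tendsto.pow (n := 2) h2) (Or.inr hB)
    simpa using h3
  obtain ⟨e, he⟩ := ((ENNReal.tendsto_nhds_zero.1 h1 ε hε).and self_mem_nhdsWithin).exists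
  exact ⟨e, he.2, he.1⟩

theorem tendsto_const_mul_add {F : ℝ → ℝ≥0∞} (hF : Tendsto F (𝓝[>] 0) (𝓝 0)) {A : ℝ≥0∞}
    (hA : A ≠ ⊤) : Tendsto (fun ℓ => A * F ℓ) (𝓝[>] 0) (𝓝 0) := by
  simpa using ENNReal.Tendsto.const_mul hF (Or.inr hA)

/-- Continuous fields whose symmetric gradient is a finite measure. -/
theorem dissDR_continuous (hρ : IsKernel ρ R C) :
    ∃ C' : ℝ≥0∞, C' ≠ ⊤ ∧ ∀ (K O : Set (Sp d)) (δ : ℝ), IsInside K O δ → ∀ (v : Sp d → Sp d),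
      AEStronglyMeasurable v (volume.restrict O) → ∀ a : ℝ≥0∞, a ≠ ⊤ → lebNorm ⊤ O v ≤ a →
      ∀ (ν : Measure (Sp d)) [IsFiniteMeasure ν], SymGradBound O v 0 ν →
      (∀ ℓ : ℝ, 0 < ℓ → R * ℓ ≤ δ / 2 →
        ∫⁻ x in K, ‖dissDR ρ (fun y _ => v y) ℓ (x, 0)‖ₑ ≤ C' * (ν univ * (a * a))) ∧
      (HasContinuousRep O v → Tendsto (fun ℓ => ∫⁻ x in K, ‖dissDR ρ (fun y _ => v y) ℓ (x, 0)‖ₑ)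
        (𝓝[>] 0) (𝓝 0)) := by
  obtain ⟨C', hC', h⟩ := lintegral_dissDR_le_of_bounded hρ
  refine ⟨4 * C', by finiteness, fun K O δ hKO v hv a ha hva ν _ hb => ⟨fun ℓ hℓ hRℓ => ?_, ?_⟩⟩
  -- The crude bound `2 * a` on increments is squared, which explains the factor `4` in the
  -- constant.
  · have h1 := h K O δ hKO v hv a ha hva 0 ν (by simp) hb ℓ hℓ hRℓ (2 * a) (by finiteness)
      (fun y _ => (ae_increment_le (ae_indicator_le hKO.isOpen.measurableSet hva) y).mono
        fun _ hx _ => hx)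
    refine h1.trans_eq ?_
    ring
  · rintro ⟨w, hw, hvw⟩
    rw [ENNReal.tendsto_nhds_zero]
    intro ε hε
    obtain ⟨e, he, hee⟩ := exists_small_mul (B := C' * ν univ) (by finiteness) hε
    filter_upwards [eventually_scale_le R (half_pos hKO.pos),
      ae_indicator_increment_le_of_continuous hKO hw hvw he R] with ℓ hℓ hinc
    refine (h K O δ hKO v hv a ha hva 0 ν (by simp) hb ℓ hℓ.1 hℓ.2 (ENNReal.ofReal e) (by simp)
      hinc).trans ?_
    rw [zero_mul, zero_add]
    refine le_trans (le_of_eq ?_) hee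
    ring

theorem tendsto_lintegral_tail {O : Set (Sp d)} {G : Sp d → Mat d}
    (hG : AEStronglyMeasurable G (volume.restrict O)) (hG1 : ∫⁻ x in O, ‖G x‖ₑ ≠ ⊤) :
    Tendsto (fun n : ℕ => ∫⁻ x in O, {y | (n : ℝ≥0∞) < ‖G y‖ₑ}.indicator (fun y => ‖G y‖ₑ) x)
      atTop (𝓝 0) := by
  have h := tendsto_lintegral_of_dominated_convergence' (μ := volume.restrict O)
    (F := fun n : ℕ => {y | (n : ℝ≥0∞) < ‖G y‖ₑ}.indicator (fun y => ‖G y‖ₑ)) (f := fun _ => 0)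
    (fun x => ‖G x‖ₑ) (fun n => ?_) (fun n => ae_of_all _ fun x => indicator_le_self' (by simp) x)
    hG1 (ae_of_all _ fun x => ?_)
  · simpa using h
  · exact hG.enorm.indicator₀ (nullMeasurableSet_lt aemeasurable_const hG.enorm)
  · obtain ⟨N, hN⟩ := ENNReal.exists_nat_gt (enorm_ne_top (x := G x))
    refine tendsto_const_nhds.congr' ?_
    filter_upwards [eventually_ge_atTop N] with n hn
    rw [indicator_of_notMem]
    simp only [mem_ofPred_eq, not_lt]
    exact hN.le.trans (by exact_mod_cast hn)

/-- Bounded fields whose symmetric gradient is integrable. -/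
theorem dissDR_bounded (hρ : IsKernel ρ R C) :
    ∃ C' : ℝ≥0∞, C' ≠ ⊤ ∧ ∀ (K O : Set (Sp d)) (δ : ℝ), IsInside K O δ → ∀ (v : Sp d → Sp d),
      AEStronglyMeasurable v (volume.restrict O) → ∀ a : ℝ≥0∞, a ≠ ⊤ → lebNorm ⊤ O v ≤ a →
      ∀ (G : Sp d → Mat d), IsSymGradFun O v G → eLpNorm G 1 (volume.restrict O) ≠ ⊤ →
      (∀ ℓ : ℝ, 0 < ℓ → R * ℓ ≤ δ / 2 →
        ∫⁻ x in K, ‖dissDR ρ (fun y _ => v y) ℓ (x, 0)‖ₑ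
          ≤ C' * (eLpNorm G 1 (volume.restrict O) * (a * a))) ∧
      Tendsto (fun ℓ => ∫⁻ x in K, ‖dissDR ρ (fun y _ => v y) ℓ (x, 0)‖ₑ) (𝓝[>] 0) (𝓝 0) := by
  obtain ⟨C', hC', h⟩ := lintegral_dissDR_le_of_bounded hρ
  obtain ⟨C₂, hC₂, h₂⟩ := dissDR_continuous hρ
  refine ⟨C₂, hC₂, fun K O δ hKO v hv a ha hva G hG hG1 => ?_⟩
  have hOm := hKO.isOpen.measurableSet
  have hGm : AEStronglyMeasurable G (volume.restrict O) := hG.2.1.aestronglyMeasurable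
  rw [eLpNorm_one_eq_lintegral_enorm] at hG1 ⊢
  constructor
  · have hb := symGradBound_of_isSymGradFun hG (M := 0) (g := fun x => ‖G x‖ₑ) hGm.enorm
      (ae_of_all _ fun x => by simp)
    have : IsFiniteMeasure ((volume.restrict O).withDensity fun x => ‖G x‖ₑ) :=
      isFiniteMeasure_withDensity hG1
    have h3 := (h₂ K O δ hKO v hv a ha hva _ hb).1
    rwa [withDensity_apply _ MeasurableSet.univ, Measure.restrict_univ] at h3
  · have hf2 : MemLp (O.indicator v) 2 := memLp_indicator_of_le hOm hKO.volume_ne_top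
      (memLp_indicator_of_eLpNorm_ne_top hOm hv (ne_top_of_le_ne_top ha hva)) le_top
    rw [ENNReal.tendsto_nhds_zero]
    intro ε hε
    have hA : C' * (2 * a) ^ 2 ≠ ⊤ := by finiteness
    -- The order of choices matters: the height `n` is fixed first, making the tail small against
    -- increments bounded by `2 * a`; then `ℓ` is taken so small that `n` times the squared `L²`
    -- increments is small.
    have htail : Tendsto (fun n : ℕ => C' * (2 * a) ^ 2 *
        ∫⁻ x in O, {y | (n : ℝ≥0∞) < ‖G y‖ₑ}.indicator (fun y => ‖G y‖ₑ) x) atTop (𝓝 0) := by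
      simpa using ENNReal.Tendsto.const_mul (tendsto_lintegral_tail hGm hG1) (Or.inr hA)
    have hε2 : 0 < ε / 2 := ENNReal.half_pos hε.ne'
    obtain ⟨n, hn⟩ := (ENNReal.tendsto_nhds_zero.1 htail _ hε2).exists
    have hsmall := ENNReal.tendsto_nhds_zero.1 (tendsto_const_mul_add (tendsto_incrementSq hf2 R)
      (A := C' * n) (by finiteness)) _ hε2
    have hgm : AEMeasurable ({y | (n : ℝ≥0∞) < ‖G y‖ₑ}.indicator (fun y => ‖G y‖ₑ))
        (volume.restrict O) :=
      hGm.enorm.indicator₀ (nullMeasurableSet_lt aemeasurable_const hGm.enorm)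
    have hb := symGradBound_of_isSymGradFun hG (M := n) hgm (ae_of_all _ fun x => by
      by_cases hx : (n : ℝ≥0∞) < ‖G x‖ₑ
      · rw [indicator_of_mem (by exact hx)]; exact le_add_self
      · exact (not_lt.1 hx).trans le_self_add)
    have hfin : IsFiniteMeasure ((volume.restrict O).withDensity
        ({y | (n : ℝ≥0∞) < ‖G y‖ₑ}.indicator (fun y => ‖G y‖ₑ))) :=
      isFiniteMeasure_withDensity (ne_top_of_le_ne_top hG1
        (lintegral_mono fun x => indicator_le_self' (by simp) x))
    filter_upwards [eventually_scale_le R (half_pos hKO.pos), hsmall] with ℓ hℓ hs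
    have h1 := h K O δ hKO v hv a ha hva n _ (by simp) hb ℓ hℓ.1 hℓ.2 (2 * a) (by finiteness)
      (fun y _ => (ae_increment_le (ae_indicator_le hOm hva) y).mono fun _ hx _ => hx)
    rw [withDensity_apply _ MeasurableSet.univ, Measure.restrict_univ] at h1
    refine h1.trans ?_
    rw [mul_add, ← mul_assoc, ← mul_assoc]
    exact (add_le_add hs hn).trans_eq (ENNReal.add_halves ε)

theorem symGradBound_of_eLpNorm_top_le {O : Set (Sp d)} {v : Sp d → Sp d} {G : Sp d → Mat d}
    (h : IsSymGradFun O v G) {b : ℝ≥0∞} (hb : eLpNorm G ⊤ (volume.restrict O) ≤ b) :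
    SymGradBound O v b 0 := by
  have h1 := symGradBound_of_isSymGradFun h (M := b) (g := 0) aemeasurable_const ?_
  · simpa using h1
  · rw [eLpNorm_exponent_top] at hb
    filter_upwards [ae_le_eLpNormEssSup (f := G) (μ := volume.restrict O)] with x hx
    exact (hx.trans hb).trans le_self_add

theorem exists_lebNorm_top_le_of_symGradBound {K O : Set (Sp d)} {δ : ℝ} (hKO : IsInside K O δ)
    {v : Sp d → Sp d} (hv : MemLp (O.indicator v) 2) {b : ℝ≥0∞} (hbt : b ≠ ⊤)
    (hb : SymGradBound O v b 0) : ∃ a : ℝ≥0∞, a ≠ ⊤ ∧ lebNorm ⊤ (thickening (δ / 2) K) v ≤ a := by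
  have hint : Integrable (O.indicator v) := memLp_one_iff_integrable.1
    (memLp_indicator_of_le hKO.isOpen.measurableSet hKO.volume_ne_top hv (by norm_num))
  obtain ⟨N, hN⟩ :=
    exists_bound_of_symGradBound hKO.pos hKO.subset hint hbt (hb.indicator subset_rfl)
  refine ⟨ENNReal.ofReal N, by simp, ?_⟩
  rw [lebNorm, eLpNorm_exponent_top]
  refine eLpNormEssSup_le_of_ae_enorm_bound ?_
  rw [ae_restrict_iff' isOpen_thickening.measurableSet]
  filter_upwards [hN] with x hx hxK
  have := hx (thickening_subset_cthickening _ _ hxK)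
  rwa [indicator_of_mem (hKO.thickening_subset hxK)] at this

/-- Square integrable fields whose symmetric gradient is bounded. -/
theorem dissDR_symGrad_bounded (hρ : IsKernel ρ R C) :
    ∃ C' : ℝ≥0∞, C' ≠ ⊤ ∧ ∀ (K O : Set (Sp d)) (δ : ℝ), IsInside K O δ → ∀ (v : Sp d → Sp d),
      AEStronglyMeasurable v (volume.restrict O) → lebNorm 2 O v ≠ ⊤ →
      ∀ b : ℝ≥0∞, b ≠ ⊤ → SymGradBound O v b 0 →
      (∀ ℓ : ℝ, 0 < ℓ → R * ℓ ≤ δ / 8 →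
        ∫⁻ x in K, ‖dissDR ρ (fun y _ => v y) ℓ (x, 0)‖ₑ
          ≤ C' * (b * (lebNorm 2 O v * lebNorm 2 O v))) ∧
      Tendsto (fun ℓ => ∫⁻ x in K, ‖dissDR ρ (fun y _ => v y) ℓ (x, 0)‖ₑ) (𝓝[>] 0) (𝓝 0) := by
  obtain ⟨C', hC', h⟩ := lintegral_dissDR_le_of_bounded hρ
  have hV : volume (closedBall (0 : Sp d) R) ≠ ⊤ := measure_closedBall_lt_top.ne
  refine ⟨C' * (4 * volume (closedBall (0 : Sp d) R)), by finiteness,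
    fun K O δ hKO v hv hv2 b hbt hb => ?_⟩
  have hδ := hKO.pos
  have hOm := hKO.isOpen.measurableSet
  have hK1 := hKO.thickening
  obtain ⟨a, ha, hva⟩ := exists_lebNorm_top_le_of_symGradBound hKO
    (memLp_indicator_of_eLpNorm_ne_top hOm hv hv2) hbt hb
  set O₁ := thickening (δ / 2) K
  have hsub : O₁ ⊆ O := hKO.thickening_subset
  have hv1 : AEStronglyMeasurable v (volume.restrict O₁) :=
    hv.mono_measure (Measure.restrict_mono hsub le_rfl)
  have hb1 : SymGradBound O₁ v b 0 := fun φ hφ => hb φ ⟨hφ.1, hφ.2.1, hφ.2.2.trans hsub⟩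
  have hle : lebNorm 2 O₁ v ≤ lebNorm 2 O v :=
    eLpNorm_mono_measure _ (Measure.restrict_mono hsub le_rfl)
  have hf2 : MemLp (O₁.indicator v) 2 := memLp_indicator_of_eLpNorm_ne_top hK1.isOpen.measurableSet
    hv1 (ne_top_of_le_ne_top hv2 hle)
  have hmain : ∀ ℓ : ℝ, 0 < ℓ → R * ℓ ≤ δ / 8 →
      ∫⁻ x in K, ‖dissDR ρ (fun y _ => v y) ℓ (x, 0)‖ₑ
        ≤ C' * b * incrementSq (O₁.indicator v) R ℓ := fun ℓ hℓ hRℓ => by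
    -- The supremum bound `a` enters only qualitatively: since the singular measure is zero, the
    -- term with `2 * a` vanishes and the estimate retains the `L²` increments alone.
    have h1 := h K O₁ _ hK1 v hv1 a ha hva b 0 hbt hb1 ℓ hℓ (by linarith) (2 * a) (by finiteness)
      (fun y _ => (ae_increment_le (ae_indicator_le hK1.isOpen.measurableSet hva) y).mono
        fun _ hx _ => hx)
    simpa [mul_assoc] using h1
  constructor
  · intro ℓ hℓ hRℓ
    refine (hmain ℓ hℓ hRℓ).trans ?_
    have h2 := incrementSq_le hf2.aestronglyMeasurable R ℓ
    rw [lintegral_enorm_sq_eq, eLpNorm_indicator_eq_eLpNorm_restrict hK1.isOpen.measurableSet] at h2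
    calc _ ≤ C' * b * (4 * volume (closedBall (0 : Sp d) R) * (lebNorm 2 O v) ^ 2) := by
          gcongr
          refine h2.trans ?_
          gcongr
          exact hle
      _ = _ := by ring
  · refine tendsto_of_tendsto_of_tendsto_of_le_of_le' tendsto_const_nhds
      (tendsto_const_mul_add (tendsto_incrementSq hf2 R) (A := C' * b) (by finiteness))
      (Eventually.of_forall fun _ => zero_le) ?_
    filter_upwards [eventually_scale_le R (by positivity : 0 < δ / 8)] with ℓ hℓ
    exact hmain ℓ hℓ.1 hℓ.2


/-! ### The John--Nirenberg inequality in `L²` -/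

theorem volume_ball_eq (x : Sp d) {r : ℝ} (hr : 0 < r) :
    volume (ball x r) = ENNReal.ofReal r ^ d * volume (ball (0 : Sp d) 1) := by
  rw [Measure.addHaar_ball_of_pos _ _ hr, finrank_euclideanSpace, Fintype.card_fin,
    ENNReal.ofReal_pow hr.le]

theorem volume_closedBall_eq (x : Sp d) {r : ℝ} (hr : 0 < r) :
    volume (closedBall x r) = ENNReal.ofReal r ^ d * volume (ball (0 : Sp d) 1) := by
  rw [Measure.addHaar_closedBall _ _ hr.le, finrank_euclideanSpace, Fintype.card_fin,
    ENNReal.ofReal_pow hr.le]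

theorem volume_ball_mul (x y : Sp d) {r c : ℝ} (hr : 0 < r) (hc : 0 < c) :
    volume (ball x (c * r)) = ENNReal.ofReal c ^ d * volume (ball y r) := by
  rw [volume_ball_eq _ (by positivity), volume_ball_eq _ hr, ENNReal.ofReal_mul hc.le, mul_pow,
    mul_assoc]

/-- The mean oscillation of `g` over the balls inside `U` of radius at most `s₀` is at most `A`. -/
def OscBound (g : Sp d → ℝ) (U : Set (Sp d)) (s₀ : ℝ) (A : ℝ≥0∞) : Prop :=
  ∀ x r, 0 < r → r ≤ s₀ → ball x r ⊆ U →
    ∫⁻ y in ball x r, ‖g y - ⨍ z in ball x r, g z‖ₑ ≤ A * volume (ball x r)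

/-! ### Averages, stopping radii and the Calderón--Zygmund covering. -/

theorem enorm_average_sub_mul_le {g : Sp d → ℝ} {x : Sp d} {r : ℝ} (hr : 0 < r)
    (hg : IntegrableOn g (ball x r)) (c : ℝ) :
    ‖(⨍ z in ball x r, g z) - c‖ₑ * volume (ball x r) ≤ ∫⁻ z in ball x r, ‖g z - c‖ₑ := by
  set V := volume (ball x r)
  have hV0 : V ≠ 0 := (measure_ball_pos _ _ hr).ne'
  have hVt : V ≠ ⊤ := measure_ball_lt_top.ne
  have hVr : volume.real (ball x r) ≠ 0 := (ENNReal.toReal_pos hV0 hVt).ne'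
  have h1 : (⨍ z in ball x r, g z) - c = (volume.real (ball x r))⁻¹ * ∫ z in ball x r, (g z - c) := by
    rw [integral_sub hg (integrableOn_const hVt), setAverage_eq, setIntegral_const]
    simp only [smul_eq_mul]
    field_simp
  rw [h1, enorm_mul]
  have h2 : ‖(volume.real (ball x r))⁻¹‖ₑ = V⁻¹ := by
    have h3 : 0 < volume.real (ball x r) := ENNReal.toReal_pos hV0 hVt
    rw [← ofReal_norm, Real.norm_of_nonneg (by positivity), ENNReal.ofReal_inv_of_pos h3,
      ofReal_measureReal hVt]
  rw [h2, mul_comm, ← mul_assoc, ENNReal.mul_inv_cancel hV0 hVt, one_mul]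
  exact enorm_integral_le_lintegral_enorm _

/-- A radius larger than half the supremum of the admissible ones suffices: twice it exceeds the
supremum, so no maximal radius is needed. -/
theorem exists_stopping_radius {h : Sp d → ℝ≥0∞} {lam : ℝ≥0∞} {y : Sp d} {r : ℝ}
    (hne : ∃ s, 0 < s ∧ s ≤ r ∧ lam * volume (closedBall y s) < ∫⁻ z in closedBall y s, h z) :
    ∃ s, 0 < s ∧ s ≤ r ∧ lam * volume (closedBall y s) < ∫⁻ z in closedBall y s, h z ∧
      ∀ s', 2 * s ≤ s' → s' ≤ r →
        ∫⁻ z in closedBall y s', h z ≤ lam * volume (closedBall y s') := by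
  set S := {s | 0 < s ∧ s ≤ r ∧ lam * volume (closedBall y s) < ∫⁻ z in closedBall y s, h z}
  have hS : S.Nonempty := hne
  have hbdd : BddAbove S := ⟨r, fun s hs => hs.2.1⟩
  obtain ⟨s₀, hs₀⟩ := hS
  have hpos : 0 < sSup S := hs₀.1.trans_le (le_csSup hbdd hs₀)
  obtain ⟨s, hs, hlt⟩ := exists_lt_of_lt_csSup ⟨s₀, hs₀⟩ (half_lt_self hpos)
  refine ⟨s, hs.1, hs.2.1, hs.2.2, fun s' h1 h2 => ?_⟩
  by_contra hcon
  have : s' ≤ sSup S := le_csSup hbdd ⟨by linarith [hs.1], h2, not_le.1 hcon⟩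
  linarith

/-- By Lebesgue differentiation, the averages over small closed balls about almost every `y` tend to
`h y`. Cutting off to the larger ball makes `h` globally integrable. -/
theorem ae_exists_closedBall_lt {h : Sp d → ℝ≥0∞} {x : Sp d} {r : ℝ} (hr : 0 < r)
    (hm : AEMeasurable h volume) (hfin : ∫⁻ z in ball x (2 * r), h z ≠ ⊤) (lam : ℝ≥0∞) :
    ∀ᵐ y, y ∈ ball x r → lam < h y →
      ∃ s, 0 < s ∧ s ≤ r ∧ lam * volume (closedBall y s) < ∫⁻ z in closedBall y s, h z := by
  set h' := (ball x (2 * r)).indicator h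
  have hm' : AEMeasurable h' volume := hm.indicator measurableSet_ball
  have hfin' : ∫⁻ z, h' z ≠ ⊤ := by rwa [lintegral_indicator measurableSet_ball]
  filter_upwards [(Besicovitch.vitaliFamily (volume : Measure (Sp d))).ae_tendsto_lintegral_div
    hm' hfin'] with y hy hyr hlam
  have h1 := hy.comp (Besicovitch.tendsto_filterAt volume y)
  have hy2 : y ∈ ball x (2 * r) := ball_subset_ball (by linarith) hyr
  have h2 : h' y = h y := indicator_of_mem hy2 h
  rw [h2] at h1
  have h3 := (h1.eventually_const_lt hlam).and
    (Ioc_mem_nhdsGT hr : ∀ᶠ s in 𝓝[>] (0 : ℝ), s ∈ Ioc 0 r)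
  obtain ⟨s, hs1, hs2⟩ := h3.exists
  refine ⟨s, hs2.1, hs2.2, ?_⟩
  have h4 := (ENNReal.lt_div_iff_mul_lt (Or.inl (measure_closedBall_pos _ _ hs2.1).ne')
    (Or.inl measure_closedBall_lt_top.ne)).1 hs1
  refine h4.trans_le (lintegral_mono fun z => ?_)
  exact indicator_le_self' (fun _ _ => zero_le) z

/-- A Calderón--Zygmund covering at height `4 · 20^d · A`. -/
theorem exists_covering {h : Sp d → ℝ≥0∞} {x : Sp d} {r : ℝ} (hr : 0 < r)
    (hm : AEMeasurable h volume) {A : ℝ≥0∞} (hA0 : A ≠ 0) (hAt : A ≠ ⊤)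
    (hA : ∫⁻ z in ball x (2 * r), h z ≤ A * volume (ball x (2 * r))) :
    ∃ (u : Set (Sp d)) (s : Sp d → ℝ), u.Countable ∧
      (∀ b ∈ u, b ∈ ball x r ∧ 0 < s b ∧ 10 * s b ≤ r ∧
        ∫⁻ z in ball b (10 * s b), h z ≤ 4 * 20 ^ d * A * volume (ball b (10 * s b))) ∧
      4 * ∑' b : u, volume (ball (b : Sp d) (5 * s b)) ≤ volume (ball x r) ∧
      ∀ᵐ y, y ∈ ball x r → y ∉ ⋃ b ∈ u, ball b (5 * s b) → h y ≤ 4 * 20 ^ d * A := by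
  classical
  set lam : ℝ≥0∞ := 4 * 20 ^ d * A with hlam
  have hfin : ∫⁻ z in ball x (2 * r), h z ≠ ⊤ :=
    ne_top_of_le_ne_top (ENNReal.mul_ne_top hAt measure_ball_lt_top.ne) hA
  set t := {y | y ∈ ball x r ∧
    ∃ s, 0 < s ∧ s ≤ r ∧ lam * volume (closedBall y s) < ∫⁻ z in closedBall y s, h z} with ht
  have hchoice : ∀ y, ∃ s, y ∈ t → (0 < s ∧ s ≤ r ∧
      lam * volume (closedBall y s) < ∫⁻ z in closedBall y s, h z ∧
      ∀ s', 2 * s ≤ s' → s' ≤ r →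
        ∫⁻ z in closedBall y s', h z ≤ lam * volume (closedBall y s')) := fun y => by
    by_cases hy : y ∈ t
    · obtain ⟨s, hs⟩ := exists_stopping_radius hy.2
      exact ⟨s, fun _ => hs⟩
    · exact ⟨0, fun h => absurd h hy⟩
  choose s hs using hchoice
  -- Vitali gives disjoint closed balls whose enlargements by `4` cover; the open balls of radius `5
  -- * s b` contain these enlargements.
  obtain ⟨u, hut, hdisj, hcov⟩ := Vitali.exists_disjoint_subfamily_covering_enlargement_closedBall
    t id s r (fun a ha => (hs a ha).2.1) 4 (by norm_num)
  simp only [id] at hdisj hcov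
  -- Otherwise the ball of radius `2 * r` would have at most `20 ^ d` times the volume of the
  -- selected ball, and the average there could not exceed the chosen height.
  have hsmall : ∀ b ∈ u, 10 * s b ≤ r := fun b hb => by
    by_contra hcon
    rw [not_le] at hcon
    obtain ⟨h0, h1, h2, -⟩ := hs b (hut hb)
    have hsub : closedBall b (s b) ⊆ ball x (2 * r) := by
      refine closedBall_subset_ball' ?_
      have := mem_ball.1 (hut hb).1
      linarith
    have h3 : lam * volume (closedBall b (s b)) < A * volume (ball x (2 * r)) :=
      h2.trans_le ((lintegral_mono_set hsub).trans hA)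
    have h4 : volume (ball x (2 * r)) ≤ 20 ^ d * volume (closedBall b (s b)) := by
      rw [volume_ball_eq _ (by positivity), volume_closedBall_eq _ h0, ← mul_assoc, ← mul_pow]
      gcongr
      rw [show (20 : ℝ≥0∞) = ENNReal.ofReal 20 by simp, ← ENNReal.ofReal_mul (by norm_num)]
      exact ENNReal.ofReal_le_ofReal (by linarith)
    have h5 : A * volume (ball x (2 * r)) ≤ lam * volume (closedBall b (s b)) := by
      calc A * volume (ball x (2 * r)) ≤ A * (20 ^ d * volume (closedBall b (s b))) := by gcongr
        _ = 1 * 20 ^ d * A * volume (closedBall b (s b)) := by ring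
        _ ≤ 4 * 20 ^ d * A * volume (closedBall b (s b)) := by gcongr; norm_num
    exact absurd h3 (not_lt.2 h5)
  have hcount : u.Countable := hdisj.countable_of_nonempty_interior fun b hb =>
    ⟨b, ball_subset_interior_closedBall (mem_ball_self (hs b (hut hb)).1)⟩
  refine ⟨u, s, hcount, fun b hb => ⟨(hut hb).1, (hs b (hut hb)).1, hsmall b hb, ?_⟩, ?_, ?_⟩
  · obtain ⟨h0, h1, h2, h3⟩ := hs b (hut hb)
    -- The radius `10 * s b` is beyond twice the stopping radius, so the average there is below the
    -- height; it is the double of `5 * s b`, as the oscillation estimate requires.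
    have h4 := h3 (10 * s b) (by linarith) (hsmall b hb)
    rw [volume_closedBall_eq _ (by positivity), ← volume_ball_eq b (by positivity)] at h4
    exact (lintegral_mono_set ball_subset_closedBall).trans h4
  · have hsum : lam * ∑' b : u, volume (closedBall (b : Sp d) (s b))
        ≤ A * (2 ^ d * volume (ball x r)) := by
      have : Countable u := hcount.to_subtype
      calc lam * ∑' b : u, volume (closedBall (b : Sp d) (s b))
          = ∑' b : u, lam * volume (closedBall (b : Sp d) (s b)) := ENNReal.tsum_mul_left.symm
        _ ≤ ∑' b : u, ∫⁻ z in closedBall (b : Sp d) (s b), h z :=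
            ENNReal.tsum_le_tsum fun b => (hs b (hut b.2)).2.2.1.le
        _ = ∫⁻ z in ⋃ b : u, closedBall (b : Sp d) (s b), h z := by
            rw [lintegral_iUnion (fun b => measurableSet_closedBall)]
            exact fun a b hab => hdisj a.2 b.2 (fun h => hab (Subtype.ext h))
        _ ≤ ∫⁻ z in ball x (2 * r), h z := by
            refine lintegral_mono_set (iUnion_subset fun b => closedBall_subset_ball' ?_)
            have := mem_ball.1 (hut b.2).1
            have := hsmall b b.2
            have := (hs b (hut b.2)).1
            linarith
        _ ≤ A * volume (ball x (2 * r)) := hA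
        _ = _ := by rw [volume_ball_mul x x hr (by norm_num)]; simp
    have h5 : ∑' b : u, volume (ball (b : Sp d) (5 * s b))
        = 5 ^ d * ∑' b : u, volume (closedBall (b : Sp d) (s b)) := by
      rw [← ENNReal.tsum_mul_left]
      refine tsum_congr fun b => ?_
      have h0 := (hs b (hut b.2)).1
      rw [volume_ball_mul (b : Sp d) (b : Sp d) h0 (by norm_num), volume_ball_eq _ h0,
        volume_closedBall_eq _ h0]
      simp
    set T := ∑' b : u, volume (closedBall (b : Sp d) (s b))
    rw [h5]
    have hc0 : A * 2 ^ d ≠ 0 := mul_ne_zero hA0 (by simp)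
    have hct : A * 2 ^ d ≠ ⊤ := by finiteness
    have h20 : (20 : ℝ≥0∞) ^ d = 2 ^ d * (2 ^ d * 5 ^ d) := by
      rw [← mul_pow, ← mul_pow]; norm_num
    have h6 : (A * 2 ^ d) * (4 * (5 ^ d * T)) ≤ (A * 2 ^ d) * volume (ball x r) := by
      calc (A * 2 ^ d) * (4 * (5 ^ d * T)) = 1 * (4 * (2 ^ d * 5 ^ d) * A * T) := by ring
        _ ≤ 2 ^ d * (4 * (2 ^ d * 5 ^ d) * A * T) := by
            gcongr
            exact one_le_pow₀ (by norm_num)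
        _ = lam * T := by rw [hlam, h20]; ring
        _ ≤ _ := hsum.trans_eq (by ring)
    exact (ENNReal.mul_le_mul_iff_right hc0 hct).1 h6
  · filter_upwards [ae_exists_closedBall_lt hr hm hfin lam] with y hy hyr hyu
    by_contra hcon
    have hyt : y ∈ t := ⟨hyr, hy hyr (not_le.1 hcon)⟩
    obtain ⟨b, hb, hsub⟩ := hcov y hyt
    refine hyu (mem_biUnion hb ?_)
    have := mem_closedBall.1 (hsub (mem_closedBall_self (hs y hyt).1.le))
    have := (hs b (hut hb)).1
    rw [mem_ball]; linarith

theorem enorm_sq_le_two_mul (a b : ℝ) : ‖a + b‖ₑ ^ 2 ≤ 2 * (‖a‖ₑ ^ 2 + ‖b‖ₑ ^ 2) := by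
  have h : ‖a + b‖ ^ 2 ≤ 2 * (‖a‖ ^ 2 + ‖b‖ ^ 2) := by
    nlinarith [norm_add_le a b, norm_nonneg (a + b), sq_nonneg (‖a‖ - ‖b‖)]
  simp only [← ofReal_norm, ← ENNReal.ofReal_pow (norm_nonneg _)]
  rw [← ENNReal.ofReal_add (by positivity) (by positivity)]
  refine (ENNReal.ofReal_le_ofReal h).trans_eq ?_
  rw [ENNReal.ofReal_mul (by norm_num), ENNReal.ofReal_ofNat]

/-- Off the covering, `‖g - c‖` is at most the height `lam`. On a covering ball, `g - c` splits into
the oscillation about the mean over the doubled ball, governed by `Φ`, and a difference of means, at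
most `lam` by the stopping rule. The covering balls occupy at most a quarter of the volume, so `Φ`
returns with coefficient `1` against the `2` on the left. -/
theorem sq_oscillation_step {g : Sp d → ℝ} (hg : AEStronglyMeasurable g volume)
    {U : Set (Sp d)} {s₀ : ℝ} {A : ℝ≥0∞} (hA0 : A ≠ 0) (hAt : A ≠ ⊤) (hosc : OscBound g U s₀ A)
    (hint : ∀ x r, ball x r ⊆ U → IntegrableOn g (ball x r)) {Φ : ℝ≥0∞}
    (hΦ : ∀ x r, 0 < r → 2 * r ≤ s₀ → ball x (2 * r) ⊆ U →
      ∫⁻ y in ball x r, ‖g y - ⨍ z in ball x (2 * r), g z‖ₑ ^ 2 ≤ Φ * volume (ball x r))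
    {x : Sp d} {r : ℝ} (hr : 0 < r) (hrs : 2 * r ≤ s₀) (hU : ball x (2 * r) ⊆ U) :
    2 * ∫⁻ y in ball x r, ‖g y - ⨍ z in ball x (2 * r), g z‖ₑ ^ 2
      ≤ (3 * (4 * 20 ^ d * A) ^ 2 + Φ) * volume (ball x r) := by
  set lam : ℝ≥0∞ := 4 * 20 ^ d * A
  set c := ⨍ z in ball x (2 * r), g z
  have hm : AEMeasurable (fun y => ‖g y - c‖ₑ) volume := (hg.sub aestronglyMeasurable_const).enorm
  obtain ⟨u, s, hcount, hu, hsum, hae⟩ := exists_covering hr hm hA0 hAt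
    (hosc x (2 * r) (by positivity) hrs hU)
  have hball : ∀ b ∈ u, ∫⁻ y in ball b (5 * s b), ‖g y - c‖ₑ ^ 2
      ≤ 2 * (Φ + lam ^ 2) * volume (ball b (5 * s b)) := fun b hb => by
    obtain ⟨hb1, hb2, hb3, hb4⟩ := hu b hb
    have h10 : 2 * (5 * s b) = 10 * s b := by ring
    have hbU : ball b (10 * s b) ⊆ U := by
      refine Subset.trans (ball_subset_ball' ?_) hU
      have := mem_ball.1 hb1
      linarith
    set cb := ⨍ z in ball b (10 * s b), g z
    have hcb : ‖cb - c‖ₑ ≤ lam := by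
      have h1 := (enorm_average_sub_mul_le (by positivity) (hint b _ hbU) c).trans hb4
      exact (ENNReal.mul_le_mul_iff_left (measure_ball_pos _ _ (by positivity)).ne'
        measure_ball_lt_top.ne).1 h1
    have h2 := hΦ b (5 * s b) (by positivity) (by linarith) (by rwa [h10])
    rw [h10] at h2
    calc ∫⁻ y in ball b (5 * s b), ‖g y - c‖ₑ ^ 2
        ≤ ∫⁻ y in ball b (5 * s b), 2 * (‖g y - cb‖ₑ ^ 2 + ‖cb - c‖ₑ ^ 2) := by
          gcongr with y
          refine le_trans (le_of_eq ?_) (enorm_sq_le_two_mul _ _)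
          congr 2; ring
      _ = 2 * ((∫⁻ y in ball b (5 * s b), ‖g y - cb‖ₑ ^ 2) +
            ‖cb - c‖ₑ ^ 2 * volume (ball b (5 * s b))) := by
          rw [lintegral_const_mul' _ _ (by simp), lintegral_add_right _ measurable_const,
            setLIntegral_const]
      _ ≤ 2 * (Φ * volume (ball b (5 * s b)) + lam ^ 2 * volume (ball b (5 * s b))) := by
          gcongr
      _ = _ := by ring
  have : Countable u := hcount.to_subtype
  set W := ⋃ b : u, ball (b : Sp d) (5 * s b) with hW
  have hWm : MeasurableSet W := MeasurableSet.iUnion fun b => measurableSet_ball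
  have hmain : ∫⁻ y in ball x r, ‖g y - c‖ₑ ^ 2 ≤ lam ^ 2 * volume (ball x r) +
      2 * (Φ + lam ^ 2) * ∑' b : u, volume (ball (b : Sp d) (5 * s b)) := by
    calc ∫⁻ y in ball x r, ‖g y - c‖ₑ ^ 2
        ≤ ∫⁻ y in ball x r, (lam ^ 2 + W.indicator (fun y => ‖g y - c‖ₑ ^ 2) y) := by
          refine lintegral_mono_ae ?_
          rw [ae_restrict_iff' measurableSet_ball]
          filter_upwards [hae] with y hy hyr
          by_cases hyW : y ∈ W
          · rw [indicator_of_mem hyW]; exact le_add_self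
          · refine le_trans ?_ le_self_add
            gcongr
            refine hy hyr fun h' => hyW ?_
            rw [hW, iUnion_coe_set]; exact h'
      _ = lam ^ 2 * volume (ball x r) +
            ∫⁻ y in ball x r, W.indicator (fun y => ‖g y - c‖ₑ ^ 2) y := by
          rw [lintegral_add_left measurable_const, setLIntegral_const]
      _ ≤ lam ^ 2 * volume (ball x r) + ∫⁻ y in W, ‖g y - c‖ₑ ^ 2 := by
          refine add_le_add le_rfl ?_
          rw [← lintegral_indicator hWm]
          exact lintegral_mono' Measure.restrict_le_self le_rfl
      _ ≤ lam ^ 2 * volume (ball x r) +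
            ∑' b : u, ∫⁻ y in ball (b : Sp d) (5 * s b), ‖g y - c‖ₑ ^ 2 := by
          gcongr
          exact lintegral_iUnion_le _ _
      _ ≤ lam ^ 2 * volume (ball x r) +
            ∑' b : u, 2 * (Φ + lam ^ 2) * volume (ball (b : Sp d) (5 * s b)) := by
          gcongr with b
          exact hball b b.2
      _ = _ := by rw [ENNReal.tsum_mul_left]
  set T := ∑' b : u, volume (ball (b : Sp d) (5 * s b))
  calc 2 * ∫⁻ y in ball x r, ‖g y - c‖ₑ ^ 2
      ≤ 2 * (lam ^ 2 * volume (ball x r) + 2 * (Φ + lam ^ 2) * T) := by gcongr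
    _ = 2 * lam ^ 2 * volume (ball x r) + (Φ + lam ^ 2) * (4 * T) := by ring
    _ ≤ 2 * lam ^ 2 * volume (ball x r) + (Φ + lam ^ 2) * volume (ball x r) := by gcongr
    _ = _ := by ring


theorem lintegral_enorm_sub_average_le {g : Sp d → ℝ} {x : Sp d} {r : ℝ} (hr : 0 < r)
    (hg : IntegrableOn g (ball x r)) (c : ℝ) :
    ∫⁻ y in ball x r, ‖g y - ⨍ z in ball x r, g z‖ₑ ≤ 2 * ∫⁻ y in ball x r, ‖g y - c‖ₑ := by
  set a := ⨍ z in ball x r, g z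
  calc ∫⁻ y in ball x r, ‖g y - a‖ₑ ≤ ∫⁻ y in ball x r, (‖g y - c‖ₑ + ‖a - c‖ₑ) := by
        refine lintegral_mono fun y => ?_
        have := enorm_sub_le (a := g y - c) (b := a - c)
        rwa [sub_sub_sub_cancel_right] at this
    _ = (∫⁻ y in ball x r, ‖g y - c‖ₑ) + ‖a - c‖ₑ * volume (ball x r) := by
        rw [lintegral_add_right _ measurable_const, setLIntegral_const]
    _ ≤ _ := by
        rw [two_mul]
        exact add_le_add le_rfl (enorm_average_sub_mul_le hr hg c)

/-- Let `Φ` be the best constant over all admissible balls. It is finite because `g` is bounded, and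
the step gives `2 * Φ ≤ 3 * lam ^ 2 + Φ` with `lam = 4 * 20 ^ d * A`. Subtracting `Φ` leaves a bound
independent of the size of `g`. -/
theorem sq_oscillation_of_bounded {g : Sp d → ℝ} (hg : Integrable g) {N : ℝ}
    (hN : ∀ y, ‖g y‖ ≤ N) {U : Set (Sp d)} {s₀ : ℝ} {A : ℝ≥0∞} (hA0 : A ≠ 0) (hAt : A ≠ ⊤)
    (hosc : OscBound g U s₀ A) {x : Sp d} {r : ℝ} (hr : 0 < r) (hrs : 2 * r ≤ s₀)
    (hU : ball x (2 * r) ⊆ U) :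
    ∫⁻ y in ball x r, ‖g y - ⨍ z in ball x (2 * r), g z‖ₑ ^ 2
      ≤ 3 * (4 * 20 ^ d * A) ^ 2 * volume (ball x r) := by
  set I : Sp d × ℝ → ℝ≥0∞ := fun p =>
    ∫⁻ y in ball p.1 p.2, ‖g y - ⨍ z in ball p.1 (2 * p.2), g z‖ₑ ^ 2
  set S : Set (Sp d × ℝ) := {p | 0 < p.2 ∧ 2 * p.2 ≤ s₀ ∧ ball p.1 (2 * p.2) ⊆ U}
  set Φ : ℝ≥0∞ := ⨆ p ∈ S, I p / volume (ball p.1 p.2)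
  have hdiv : ∀ p ∈ S, ∀ B, I p / volume (ball p.1 p.2) ≤ B ↔ I p ≤ B * volume (ball p.1 p.2) :=
    fun p hp B => ENNReal.div_le_iff (measure_ball_pos _ _ hp.1).ne' measure_ball_lt_top.ne
  have hNe : ∀ y, ‖g y‖ₑ ≤ ENNReal.ofReal N := fun y => by
    rw [← ofReal_norm]; exact ENNReal.ofReal_le_ofReal (hN y)
  have havg : ∀ (y : Sp d) (s : ℝ), 0 < s → ‖⨍ z in ball y s, g z‖ₑ ≤ ENNReal.ofReal N :=
    fun y s hs => by
      have h1 := enorm_average_sub_mul_le hs hg.integrableOn (x := y) 0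
      simp only [sub_zero] at h1
      have h2 : ∫⁻ z in ball y s, ‖g z‖ₑ ≤ ENNReal.ofReal N * volume (ball y s) := by
        rw [← setLIntegral_const]
        exact lintegral_mono hNe
      exact (ENNReal.mul_le_mul_iff_left (measure_ball_pos _ _ hs).ne'
        measure_ball_lt_top.ne).1 (h1.trans h2)
  have hΦt : Φ ≠ ⊤ := by
    refine ne_top_of_le_ne_top (b := (2 * ENNReal.ofReal N) ^ 2) (by finiteness)
      (iSup₂_le fun p hp => (hdiv p hp _).2 ?_)
    rw [← setLIntegral_const]
    refine lintegral_mono fun y => ?_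
    gcongr
    refine (enorm_sub_le.trans (add_le_add (hNe y) (havg _ _ ?_))).trans_eq (two_mul _).symm
    linarith [hp.1]
  have hΦle : ∀ p ∈ S, I p ≤ Φ * volume (ball p.1 p.2) := fun p hp =>
    (hdiv p hp _).1 (le_iSup₂ (f := fun p (_ : p ∈ S) => I p / volume (ball p.1 p.2)) p hp)
  have hstep : 2 * Φ ≤ 3 * (4 * 20 ^ d * A) ^ 2 + Φ := by
    rw [ENNReal.mul_iSup]
    refine iSup_le fun p => ?_
    rw [ENNReal.mul_iSup]
    refine iSup_le fun hp => ?_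
    rw [← mul_div_assoc,
      ENNReal.div_le_iff (measure_ball_pos _ _ hp.1).ne' measure_ball_lt_top.ne]
    exact sq_oscillation_step hg.aestronglyMeasurable hA0 hAt hosc (fun _ _ _ => hg.integrableOn)
      (fun y s h1 h2 h3 => hΦle (y, s) ⟨h1, h2, h3⟩) hp.1 hp.2.1 hp.2.2
  rw [two_mul] at hstep
  have hfin : Φ ≤ 3 * (4 * 20 ^ d * A) ^ 2 := (ENNReal.add_le_add_iff_right hΦt).1 hstep
  exact (hΦle (x, r) ⟨hr, hrs, hU⟩).trans (by gcongr)

/-- Truncation of a real number at height `N`. -/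
def clamp (N x : ℝ) : ℝ := max (-N) (min N x)

theorem continuous_clamp (N : ℝ) : Continuous (clamp N) := by unfold clamp; fun_prop

theorem abs_clamp_sub_le (N a b : ℝ) : |clamp N a - clamp N b| ≤ |a - b| := by
  have := ((LipschitzWith.id.const_min N).const_max (-N) : LipschitzWith 1 _).dist_le_mul a b
  simpa [Real.dist_eq, clamp] using this

theorem abs_clamp_le {N : ℝ} (hN : 0 ≤ N) (a : ℝ) : |clamp N a| ≤ N :=
  abs_le.2 ⟨le_max_left _ _, max_le (by linarith) (min_le_left _ _)⟩

theorem clamp_eq {N a : ℝ} (h : |a| ≤ N) : clamp N a = a := by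
  rw [clamp, min_eq_right (abs_le.1 h).2, max_eq_right (abs_le.1 h).1]

theorem abs_clamp_le_abs {N : ℝ} (hN : 0 ≤ N) (a : ℝ) : |clamp N a| ≤ |a| := by
  have := abs_clamp_sub_le N a 0
  rwa [clamp_eq (a := 0) (by simpa using hN), sub_zero, sub_zero] at this

/-- The John--Nirenberg inequality in `L²`. -/
theorem sq_oscillation_le {g : Sp d → ℝ} (hg : Integrable g)
    {U : Set (Sp d)} {s₀ : ℝ} {A : ℝ≥0∞} (hA0 : A ≠ 0) (hAt : A ≠ ⊤)
    (hosc : OscBound g U s₀ A) {x : Sp d} {r : ℝ} (hr : 0 < r) (hrs : 2 * r ≤ s₀)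
    (hU : ball x (2 * r) ⊆ U) :
    ∫⁻ y in ball x r, ‖g y - ⨍ z in ball x (2 * r), g z‖ₑ ^ 2
      ≤ 3 * (4 * 20 ^ d * (2 * A)) ^ 2 * volume (ball x r) := by
  set G : ℕ → Sp d → ℝ := fun n y => clamp n (g y)
  have hGi : ∀ n, Integrable (G n) := fun n => hg.mono
    ((continuous_clamp n).comp_aestronglyMeasurable hg.aestronglyMeasurable)
    (ae_of_all _ fun y => abs_clamp_le_abs (by positivity) _)
  have hlim : ∀ y, Tendsto (fun n => G n y) atTop (𝓝 (g y)) := fun y => by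
    obtain ⟨N, hN⟩ := exists_nat_ge |g y|
    refine tendsto_const_nhds.congr' ?_
    filter_upwards [eventually_ge_atTop N] with n hn
    exact (clamp_eq (hN.trans (by exact_mod_cast hn))).symm
  -- Truncation is `1`-Lipschitz, but the mean of the truncation is not the truncated mean;
  -- replacing one by the other costs the factor `2`, uniformly in `n`.
  have hosc' : ∀ n, OscBound (G n) U s₀ (2 * A) := fun n y s hs hss hsU => by
    refine (lintegral_enorm_sub_average_le hs (hGi n).integrableOn
      (clamp n (⨍ z in ball y s, g z))).trans ?_
    rw [mul_assoc]
    refine mul_le_mul_right ((lintegral_mono fun z => ?_).trans (hosc y s hs hss hsU)) _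
    rw [← ofReal_norm, ← ofReal_norm]
    exact ENNReal.ofReal_le_ofReal (abs_clamp_sub_le _ _ _)
  have hbd : ∀ n, ∫⁻ y in ball x r, ‖G n y - ⨍ z in ball x (2 * r), G n z‖ₑ ^ 2
      ≤ 3 * (4 * 20 ^ d * (2 * A)) ^ 2 * volume (ball x r) := fun n =>
    sq_oscillation_of_bounded (hGi n) (fun y => abs_clamp_le (Nat.cast_nonneg n) _)
      (mul_ne_zero two_ne_zero hA0) (by finiteness) (hosc' n) hr hrs hU
  have havg : Tendsto (fun n => ⨍ z in ball x (2 * r), G n z) atTop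
      (𝓝 (⨍ z in ball x (2 * r), g z)) := by
    simp only [setAverage_eq]
    refine Tendsto.const_smul ?_ _
    exact tendsto_integral_of_dominated_convergence (fun z => ‖g z‖)
      (fun n => (hGi n).aestronglyMeasurable.restrict) hg.integrableOn.norm
      (fun n => ae_of_all _ fun y => abs_clamp_le_abs (by positivity) _) (ae_of_all _ hlim)
  have hpt : ∀ y, liminf (fun n => ‖G n y - ⨍ z in ball x (2 * r), G n z‖ₑ ^ 2) atTop
      = ‖g y - ⨍ z in ball x (2 * r), g z‖ₑ ^ 2 := fun y =>
    (ENNReal.Tendsto.pow ((hlim y).sub havg).enorm).liminf_eq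
  calc ∫⁻ y in ball x r, ‖g y - ⨍ z in ball x (2 * r), g z‖ₑ ^ 2
      = ∫⁻ y in ball x r, liminf (fun n => ‖G n y - ⨍ z in ball x (2 * r), G n z‖ₑ ^ 2) atTop := by
        simp only [hpt]
    _ ≤ liminf (fun n => ∫⁻ y in ball x r, ‖G n y - ⨍ z in ball x (2 * r), G n z‖ₑ ^ 2) atTop :=
        lintegral_liminf_le' fun n =>
          (((hGi n).aestronglyMeasurable.sub aestronglyMeasurable_const).enorm.pow_const 2).restrict
    _ ≤ _ := liminf_le_of_frequently_le' (Frequently.of_forall hbd)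

theorem enorm_sq_eq_sum (w : Sp d) : ‖w‖ₑ ^ 2 = ∑ i, ‖w i‖ₑ ^ 2 := by
  simp only [← ofReal_norm, ← ENNReal.ofReal_pow (norm_nonneg _)]
  rw [← ENNReal.ofReal_sum_of_nonneg fun i _ => by positivity, EuclideanSpace.norm_sq_eq]

theorem average_coord {f : Sp d → Sp d} (hf : Integrable f) (s : Set (Sp d)) (i : Fin d) :
    (⨍ z in s, f z) i = ⨍ z in s, f z i := by
  rw [setAverage_eq, setAverage_eq]
  have h : ∫ z in s, f z i = (∫ z in s, f z) i :=
    (EuclideanSpace.proj (𝕜 := ℝ) i).integral_comp_comm (hf.integrableOn (s := s))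
  rw [h]
  rfl

/-- The John--Nirenberg inequality in `L²`, for vector fields. -/
theorem sq_oscillation_vector_le {f : Sp d → Sp d} (hf : Integrable f)
    {U : Set (Sp d)} {s₀ : ℝ} {A : ℝ≥0∞} (hA0 : A ≠ 0) (hAt : A ≠ ⊤)
    (hosc : ∀ x r, 0 < r → r ≤ s₀ → ball x r ⊆ U →
      ∫⁻ y in ball x r, ‖f y - ⨍ z in ball x r, f z‖ₑ ≤ A * volume (ball x r))
    {x : Sp d} {r : ℝ} (hr : 0 < r) (hrs : 2 * r ≤ s₀) (hU : ball x (2 * r) ⊆ U) :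
    ∫⁻ y in ball x r, ‖f y - ⨍ z in ball x (2 * r), f z‖ₑ ^ 2
      ≤ d * (3 * (4 * 20 ^ d * (2 * A)) ^ 2) * volume (ball x r) := by
  have hi : ∀ i, OscBound (fun y => f y i) U s₀ A := fun i y s hs hss hsU => by
    refine (lintegral_mono fun z => ?_).trans (hosc y s hs hss hsU)
    rw [← average_coord hf]
    exact enorm_coord_le (f z - ⨍ z in ball y s, f z) i
  simp only [enorm_sq_eq_sum]
  rw [lintegral_finsetSum' _ fun i _ => ?_]
  · calc _ ≤ ∑ i : Fin d, 3 * (4 * 20 ^ d * (2 * A)) ^ 2 * volume (ball x r) := by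
          refine Finset.sum_le_sum fun i _ => ?_
          have := sq_oscillation_le (integrable_coord hf i) hA0 hAt (hi i) hr hrs hU
          rw [← average_coord hf] at this
          exact this
      _ = _ := by simp [mul_assoc]
  · exact (((integrable_coord hf i).aestronglyMeasurable.sub
      aestronglyMeasurable_const).enorm.pow_const 2).restrict


/-! ### The Constantin--E--Titi approximation at a fixed time -/

theorem lintegral_enorm_sub_average_le_of_meanOsc {O : Set (Sp d)} {v : Sp d → Sp d} {x : Sp d}
    {r : ℝ} {a : ℝ≥0∞} (hr : 0 < r) (hO : ball x r ⊆ O) (ha : meanOsc O v r ≤ a) :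
    ∫⁻ y in ball x r, ‖O.indicator v y - ⨍ z in ball x r, O.indicator v z‖ₑ
      ≤ a * volume (ball x r) := by
  have h1 := (le_iSup₂ (f := fun (x : Sp d) (_ : ball x r ⊆ O) =>
    laverage (volume.restrict (ball x r)) fun y => ‖v y - ⨍ z in ball x r, v z‖ₑ) x hO).trans ha
  rw [laverage_eq, Measure.restrict_apply_univ,
    ENNReal.div_le_iff (measure_ball_pos _ _ hr).ne' measure_ball_lt_top.ne] at h1
  have h2 : ⨍ z in ball x r, O.indicator v z = ⨍ z in ball x r, v z := by
    rw [setAverage_eq, setAverage_eq, setIntegral_congr_fun measurableSet_ball fun z hz =>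
      indicator_of_mem (hO hz) v]
  rw [h2]
  refine le_trans (le_of_eq ?_) h1
  exact setLIntegral_congr_fun measurableSet_ball fun z hz => by rw [indicator_of_mem (hO hz)]

/-- Functions of bounded mean oscillation are square integrable inside the domain. -/
theorem memLp_two_of_meanOsc_le {K O : Set (Sp d)} {δ : ℝ} (hKO : IsInside K O δ) {v : Sp d → Sp d}
    (hv : Integrable (O.indicator v)) {a : ℝ≥0∞} (ha0 : a ≠ 0) (hat : a ≠ ⊤)
    (ha : ∀ s : ℝ, 0 < s → meanOsc O v s ≤ a) :
    MemLp ((thickening (δ / 2) K).indicator v) 2 := by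
  have hδ := hKO.pos
  set f := O.indicator v
  -- Square integrability near a compact set is phrased as finiteness of this measure, which is
  -- checked near each point with a ball adapted to the point.
  set μ := (volume : Measure (Sp d)).withDensity fun y => ‖f y‖ₑ ^ 2
  have hKc : IsCompact (cthickening (δ / 2) K) := hKO.compact.cthickening
  have hsubO : cthickening (δ / 2) K ⊆ O :=
    (cthickening_mono (by linarith) K).trans hKO.subset
  have hfin : μ (cthickening (δ / 2) K) < ⊤ := by
    refine hKc.measure_lt_top_of_nhdsWithin fun x hx => ?_
    obtain ⟨r, hr, hrO⟩ := Metric.isOpen_iff.1 hKO.isOpen x (hsubO hx)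
    refine ⟨ball x (r / 2), mem_nhdsWithin_of_mem_nhds (ball_mem_nhds x (by positivity)), ?_⟩
    rw [withDensity_apply _ measurableSet_ball]
    have h2 : 2 * (r / 2) = r := by ring
    have h1 := sq_oscillation_vector_le hv ha0 hat (U := O) (s₀ := r)
      (fun y s hs _ hy => lintegral_enorm_sub_average_le_of_meanOsc hs hy (ha s hs))
      (x := x) (r := r / 2) (by positivity) h2.le (by rwa [h2])
    set c := ⨍ z in ball x (2 * (r / 2)), f z
    calc ∫⁻ y in ball x (r / 2), ‖f y‖ₑ ^ 2
        ≤ ∫⁻ y in ball x (r / 2), 2 * (‖f y - c‖ₑ ^ 2 + ‖-c‖ₑ ^ 2) := by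
          refine lintegral_mono fun y => ?_
          simpa using enorm_sub_sq_le (f y - c) (-c)
      _ = 2 * ((∫⁻ y in ball x (r / 2), ‖f y - c‖ₑ ^ 2) + ‖-c‖ₑ ^ 2 * volume (ball x (r / 2))) := by
          rw [lintegral_const_mul' _ _ (by simp), lintegral_add_right _ measurable_const,
            setLIntegral_const]
      _ < ⊤ := by
          have h3 := ne_top_of_le_ne_top (b := _)
            (ENNReal.mul_ne_top (by finiteness) measure_ball_lt_top.ne) h1
          have h4 : volume (ball x (r / 2)) ≠ ⊤ := measure_ball_lt_top.ne
          finiteness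
  have hO₁ := hKO.thickening_subset
  have hmeas := isOpen_thickening (δ := δ / 2) (E := K) |>.measurableSet
  rw [memLp_indicator_iff_restrict hmeas]
  have hv' : AEStronglyMeasurable v (volume.restrict (thickening (δ / 2) K)) :=
    ((aestronglyMeasurable_indicator_iff hKO.isOpen.measurableSet).1
      hv.aestronglyMeasurable).mono_measure (Measure.restrict_mono hO₁ le_rfl)
  refine ⟨hv', ?_⟩
  have h5 : ∫⁻ y in thickening (δ / 2) K, ‖v y‖ₑ ^ 2 < ⊤ := by
    refine lt_of_le_of_lt ?_ hfin
    rw [withDensity_apply _ isClosed_cthickening.measurableSet]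
    refine le_trans (le_of_eq ?_) (lintegral_mono_set (thickening_subset_cthickening _ _))
    exact setLIntegral_congr_fun hmeas fun y hy => by simp only [f, indicator_of_mem (hO₁ hy)]
  rw [lintegral_enorm_sq_eq] at h5
  by_contra hcon
  rw [not_lt, top_le_iff] at hcon
  simp [hcon] at h5

theorem enorm_stress_le_of_meanOsc (hρ : IsKernel ρ R C) (h1 : ∫ z, ρ z = 1) :
    ∃ C' : ℝ≥0∞, C' ≠ ⊤ ∧ ∀ (K O : Set (Sp d)) (δ : ℝ), IsInside K O δ → ∀ (v : Sp d → Sp d),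
      Integrable (O.indicator v) → MemLp ((thickening (δ / 2) K).indicator v) 2 →
      ∀ ℓ : ℝ, 0 < ℓ → R * ℓ ≤ δ / 4 → ∀ a : ℝ≥0∞, a ≠ 0 → a ≠ ⊤ →
      (∀ s : ℝ, 0 < s → s ≤ 2 * (R * ℓ) → meanOsc O v s ≤ a) → ∀ x ∈ K, ∀ i j,
      ‖stress ρ ℓ ((thickening (δ / 2) K).indicator v) i j x‖ₑ ≤ C' * (a * a) := by
  obtain ⟨C', hC', h⟩ := enorm_stress_le hρ h1
  have hR := hρ.pos
  have hV : volume (ball (0 : Sp d) 1) ≠ ⊤ := measure_ball_lt_top.ne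
  refine ⟨C' * (d * (3 * (4 * 20 ^ d * 2) ^ 2) * (ENNReal.ofReal R ^ d *
    volume (ball (0 : Sp d) 1))), by finiteness,
    fun K O δ hKO v hv hv2 ℓ hℓ hRℓ a ha0 hat ha x hx i j => ?_⟩
  have hδ := hKO.pos
  have hRl : 0 < R * ℓ := by positivity
  set f := O.indicator v
  set O₁ := thickening (δ / 2) K
  set f₁ := O₁.indicator v
  have hmeas : MeasurableSet O₁ := isOpen_thickening.measurableSet
  have hsubO : O₁ ⊆ O := hKO.thickening_subset
  have hball : ball x (2 * (R * ℓ)) ⊆ O := fun y hy => hsubO <| by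
    rw [mem_thickening_iff]
    exact ⟨x, hx, (mem_ball.1 hy).trans_le (by linarith)⟩
  have hball' : ball x (R * ℓ) ⊆ O₁ := fun y hy => by
    rw [mem_thickening_iff]
    exact ⟨x, hx, (mem_ball.1 hy).trans_le (by linarith)⟩
  have hf₁ : Integrable f₁ := memLp_one_iff_integrable.1
    (memLp_indicator_of_le hmeas hKO.thickening.volume_ne_top hv2 (by norm_num))
  -- The free constant in the stress bound is the mean over the ball of twice the kernel radius, as
  -- in the John--Nirenberg estimate.
  set c := ⨍ z in ball x (2 * (R * ℓ)), f z
  refine (h f₁ hf₁ hv2 ℓ hℓ x c i j).trans ?_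
  rw [lintegral_comp_smul_closedBall (fun y => ‖f₁ (x + y) - c‖ₑ ^ 2) hℓ hR, mul_assoc C']
  refine mul_le_mul_right ?_ _
  have h2 : ∫⁻ y in ball (0 : Sp d) (R * ℓ), ‖f₁ (x + y) - c‖ₑ ^ 2
      = ∫⁻ y in ball x (R * ℓ), ‖f y - c‖ₑ ^ 2 := by
    rw [← lintegral_indicator measurableSet_ball, ← lintegral_indicator measurableSet_ball,
      ← lintegral_add_left_eq_self ((ball x (R * ℓ)).indicator fun y => ‖f y - c‖ₑ ^ 2) x]
    refine lintegral_congr fun y => ?_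
    by_cases hy : x + y ∈ ball x (R * ℓ)
    · have hy0 : y ∈ ball (0 : Sp d) (R * ℓ) := by simpa using hy
      rw [indicator_of_mem hy, indicator_of_mem hy0]
      simp only [f₁, f]
      rw [indicator_of_mem (hball' hy), indicator_of_mem (hsubO (hball' hy))]
    · have hy0 : y ∉ ball (0 : Sp d) (R * ℓ) := by simpa using hy
      rw [indicator_of_notMem hy, indicator_of_notMem hy0]
  rw [h2]
  have h3 := sq_oscillation_vector_le hv ha0 hat (U := O) (s₀ := 2 * (R * ℓ))
    (fun y s hs hs' hy => lintegral_enorm_sub_average_le_of_meanOsc hs hy (ha s hs hs'))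
    (x := x) hRl le_rfl hball
  rw [volume_ball_eq x hRl, ENNReal.ofReal_mul hR.le, mul_pow] at h3
  have hℓd : ENNReal.ofReal (ℓ ^ d) ≠ 0 := by
    rw [Ne, ENNReal.ofReal_eq_zero, not_le]; positivity
  calc (ENNReal.ofReal (ℓ ^ d))⁻¹ * ∫⁻ y in ball x (R * ℓ), ‖f y - c‖ₑ ^ 2
      ≤ (ENNReal.ofReal (ℓ ^ d))⁻¹ * _ := mul_le_mul_right h3 _
    _ = (ENNReal.ofReal (ℓ ^ d))⁻¹ * ENNReal.ofReal (ℓ ^ d) *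
        (d * (3 * (4 * 20 ^ d * 2) ^ 2) * (ENNReal.ofReal R ^ d * volume (ball (0 : Sp d) 1))
          * (a * a)) := by
        rw [ENNReal.ofReal_pow hℓ.le]; ring
    _ = _ := by rw [ENNReal.inv_mul_cancel hℓd ENNReal.ofReal_ne_top, one_mul]

/-- Fields of vanishing mean oscillation whose symmetric gradient is a finite measure. -/
theorem dissCET_vmo (hρ : IsKernel ρ R C) (h1 : ∫ z, ρ z = 1) :
    ∃ C' : ℝ≥0∞, C' ≠ ⊤ ∧ ∀ (K O : Set (Sp d)) (δ : ℝ), IsInside K O δ → ∀ (v : Sp d → Sp d),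
      Integrable (O.indicator v) → ∀ a : ℝ≥0∞, a ≠ 0 → a ≠ ⊤ → bmoNorm O v ≤ a →
      ∀ (ν : Measure (Sp d)) [IsFiniteMeasure ν], SymGradBound O v 0 ν →
      (∀ ℓ : ℝ, 0 < ℓ → R * ℓ ≤ δ / 8 →
        ∫⁻ x in K, ‖dissCET ρ (fun y _ => v y) ℓ (x, 0)‖ₑ ≤ C' * (ν univ * (a * a))) ∧
      (VMOVanishing O v → Tendsto (fun ℓ => ∫⁻ x in K, ‖dissCET ρ (fun y _ => v y) ℓ (x, 0)‖ₑ)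
        (𝓝[>] 0) (𝓝 0)) := by
  obtain ⟨C₁, hC₁, hstress⟩ := enorm_stress_le_of_meanOsc hρ h1
  obtain ⟨C₂, hC₂, h⟩ := lintegral_dissCET_le_of_stress_le hρ
  refine ⟨C₂ * C₁, by finiteness, fun K O δ hKO v hv a ha0 hat ha ν _ hb => ?_⟩
  have hδ := hKO.pos
  have ha' : ∀ s : ℝ, 0 < s → meanOsc O v s ≤ a := fun s hs =>
    (le_iSup₂ (f := fun (s : ℝ) (_ : 0 < s) => meanOsc O v s) s hs).trans ha
  have hv2 := memLp_two_of_meanOsc_le hKO hv ha0 hat ha'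
  set O₁ := thickening (δ / 2) K
  have hsubO : O₁ ⊆ O := hKO.thickening_subset
  have hb1 : SymGradBound O₁ v 0 ν := fun φ hφ => hb φ ⟨hφ.1, hφ.2.1, hφ.2.2.trans hsubO⟩
  have hf₁ : Integrable (O₁.indicator v) := memLp_one_iff_integrable.1
    (memLp_indicator_of_le isOpen_thickening.measurableSet
      hKO.thickening.volume_ne_top hv2 (by norm_num))
  have hmain : ∀ ℓ : ℝ, 0 < ℓ → R * ℓ ≤ δ / 8 → ∀ e : ℝ≥0∞, e ≠ 0 → e ≠ ⊤ →
      (∀ s : ℝ, 0 < s → s ≤ 2 * (R * ℓ) → meanOsc O v s ≤ e) →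
      ∫⁻ x in K, ‖dissCET ρ (fun y _ => v y) ℓ (x, 0)‖ₑ ≤ C₂ * C₁ * (ν univ * (e * e)) :=
    fun ℓ hℓ hRℓ e he0 het he => by
      refine (h O₁ K (δ / 4) hKO.thickening.subset
        hKO.compact.measurableSet v ν hf₁ hb1 ℓ hℓ (by linarith) (C₁ * (e * e)) (by finiteness)
        (hstress K O δ hKO v hv hv2 ℓ hℓ (by linarith) e he0 het he)).trans_eq ?_
      ring
  refine ⟨fun ℓ hℓ hRℓ => hmain ℓ hℓ hRℓ a ha0 hat fun s hs _ => ha' s hs, fun hvmo => ?_⟩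
  rw [ENNReal.tendsto_nhds_zero]
  intro ε hε
  obtain ⟨e, he, hee⟩ := exists_small_mul (B := C₂ * C₁ * ν univ) (by finiteness) hε
  have he0 : 0 < ENNReal.ofReal e := ENNReal.ofReal_pos.2 he
  -- Below the scale `r` the oscillation is at most `e`. The stress at scale `ℓ` uses radii up to `2
  -- * (R * ℓ)`, so `R * ℓ ≤ r / 2` suffices.
  obtain ⟨r, hr, hrs⟩ := mem_nhdsGT_iff_exists_Ioc_subset.1 (ENNReal.tendsto_nhds_zero.1 hvmo _ he0)
  filter_upwards [eventually_scale_le R (by positivity : 0 < δ / 8),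
    eventually_scale_le R (half_pos hr)] with ℓ h2 h3
  refine (hmain ℓ h2.1 h2.2 _ he0.ne' (by simp) fun s hs hs' => hrs ⟨hs, ?_⟩).trans
    (le_trans (le_of_eq ?_) hee)
  · linarith [h3.2]
  · ring

/-- Square integrable fields whose symmetric gradient is bounded. -/
theorem dissCET_symGrad_bounded (hρ : IsKernel ρ R C) (h1 : ∫ z, ρ z = 1) :
    ∃ C' : ℝ≥0∞, C' ≠ ⊤ ∧ ∀ (K O : Set (Sp d)) (δ : ℝ), IsInside K O δ → ∀ (v : Sp d → Sp d),
      AEStronglyMeasurable v (volume.restrict O) → lebNorm 2 O v ≠ ⊤ →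
      ∀ b : ℝ≥0∞, b ≠ ⊤ → SymGradBound O v b 0 →
      (∀ ℓ : ℝ, 0 < ℓ → R * ℓ ≤ δ / 8 →
        ∫⁻ x in K, ‖dissCET ρ (fun y _ => v y) ℓ (x, 0)‖ₑ
          ≤ C' * (b * (lebNorm 2 O v * lebNorm 2 O v))) ∧
      Tendsto (fun ℓ => ∫⁻ x in K, ‖dissCET ρ (fun y _ => v y) ℓ (x, 0)‖ₑ) (𝓝[>] 0) (𝓝 0) := by
  obtain ⟨C', hC', h⟩ := lintegral_dissCET_le_incrementSq hρ h1
  have hV : volume (closedBall (0 : Sp d) R) ≠ ⊤ := measure_closedBall_lt_top.ne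
  refine ⟨C' * (4 * volume (closedBall (0 : Sp d) R)), by finiteness,
    fun K O δ hKO v hv hv2 b hbt hb => ?_⟩
  have hδ := hKO.pos
  have hOm := hKO.isOpen.measurableSet
  have hf2 := memLp_indicator_of_eLpNorm_ne_top hOm hv hv2
  have hf1 : Integrable (O.indicator v) := memLp_one_iff_integrable.1
    (memLp_indicator_of_le hOm hKO.volume_ne_top hf2 (by norm_num))
  have hmain : ∀ ℓ : ℝ, 0 < ℓ → R * ℓ ≤ δ / 8 →
      ∫⁻ x in K, ‖dissCET ρ (fun y _ => v y) ℓ (x, 0)‖ₑ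
        ≤ C' * b * incrementSq (O.indicator v) R ℓ := fun ℓ hℓ hRℓ =>
    (h O K δ hKO.subset hKO.compact.measurableSet v b hbt hf1 hf2 hb ℓ hℓ
      (by linarith)).trans_eq (mul_assoc _ _ _).symm
  constructor
  · intro ℓ hℓ hRℓ
    refine (hmain ℓ hℓ hRℓ).trans ?_
    have h2 := incrementSq_le hf2.aestronglyMeasurable R ℓ
    rw [lintegral_enorm_sq_eq, eLpNorm_indicator_eq_eLpNorm_restrict hOm] at h2
    calc _ ≤ C' * b * (4 * volume (closedBall (0 : Sp d) R) * (lebNorm 2 O v) ^ 2) :=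
          mul_le_mul_right h2 _
      _ = _ := by ring
  · refine tendsto_of_tendsto_of_tendsto_of_le_of_le' tendsto_const_nhds
      (tendsto_const_mul_add (tendsto_incrementSq hf2 R) (A := C' * b) (by finiteness))
      (Eventually.of_forall fun _ => zero_le) ?_
    filter_upwards [eventually_scale_le R (by positivity : 0 < δ / 8)] with ℓ hℓ
    exact hmain ℓ hℓ.1 hℓ.2

/-- The conditions under which the Constantin--E--Titi approximation is defined at a point. -/
theorem exists_mollify_of_memLp (hρ : IsKernel ρ R C) {K O : Set (Sp d)} {δ : ℝ}
    (hKO : IsInside K O δ) {v : Sp d → Sp d} (hv : MemLp (O.indicator v) 2) {ℓ : ℝ} (hℓ : 0 < ℓ)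
    (hRℓ : R * ℓ < δ) {x : Sp d} (hx : x ∈ K) :
    ConvolutionExistsAt (scaledKernel ρ ℓ) v x (ContinuousLinearMap.lsmul ℝ ℝ) volume ∧
      (∀ i j, ConvolutionExistsAt (scaledKernel ρ ℓ) (fun y => v y i * v y j) x
        (ContinuousLinearMap.lsmul ℝ ℝ) volume) ∧
      DifferentiableAt ℝ (mollify ρ ℓ v) x := by
  have hf : Integrable (O.indicator v) := memLp_one_iff_integrable.1
    (memLp_indicator_of_le hKO.isOpen.measurableSet hKO.volume_ne_top hv (by norm_num))
  have heq := eqOn_indicator hKO.subset v hx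
  have hks := hasCompactSupport_scaledKernel hρ hℓ
  have hkc := contDiff_scaledKernel hρ.smooth ℓ
  refine ⟨?_, fun i j => ?_, ?_⟩
  · exact convolutionExistsAt_congr hρ hℓ hRℓ.le heq
      (hks.convolutionExists_left _ hkc.continuous hf.locallyIntegrable x)
  · refine convolutionExistsAt_congr hρ hℓ hRℓ.le
      (f := fun y => O.indicator v y i * O.indicator v y j) (fun y hy => ?_)
      (hks.convolutionExists_left _ hkc.continuous (integrable_coord_mul hv i j).locallyIntegrable x)
    simp only [heq hy]
  · exact ((fderiv_convolution_apply hkc hks hf.locallyIntegrable x 0).1.differentiableAt).congr_of_eventuallyEq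
      (mollify_eventuallyEq hρ hℓ hRℓ heq)


/-! ### From almost every time to space-time -/

theorem exists_isInside {Ω A : Set (Sp d)} (hΩ : IsOpen Ω) (hA : IsCompact A) (hAΩ : A ⊆ Ω) :
    ∃ (O : Set (Sp d)) (δ : ℝ), CompactlyInside O Ω ∧ IsInside A O δ := by
  obtain ⟨δ, hδ, h⟩ := hA.exists_cthickening_subset_open hΩ hAΩ
  have hc : IsCompact (cthickening δ A) := hA.cthickening
  have hcl : closure (thickening δ A) ⊆ cthickening δ A := closure_thickening_subset_cthickening δ A
  exact ⟨thickening δ A, δ / 2,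
    ⟨isOpen_thickening, hc.of_isClosed_subset isClosed_closure hcl, hcl.trans h⟩,
    ⟨half_pos hδ, cthickening_subset_thickening' hδ (by linarith) A, hA, isOpen_thickening,
      ne_top_of_le_ne_top hc.measure_lt_top.ne (measure_mono (thickening_subset_cthickening _ _))⟩⟩

theorem IsInside.add_smul_mem {K O : Set (Sp d)} {δ ℓ : ℝ} (h : IsInside K O δ) (hℓ : 0 < ℓ)
    (hRℓ : R * ℓ ≤ δ) {x : Sp d} (hx : x ∈ K) {z : Sp d} (hz : z ∈ closedBall (0 : Sp d) R) :
    x + ℓ • z ∈ O :=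
  h.subset (closedBall_subset_cthickening hx δ (add_smul_mem_closedBall hℓ hRℓ x hz))

theorem aestronglyMeasurable_dissDR_prod (hρ : IsKernel ρ R C) {Ω : Set (Sp d)} {T : ℝ}
    {u : Sp d → ℝ → Sp d} (hΩ : IsOpen Ω)
    (hu : AEStronglyMeasurable (fun p : Sp d × ℝ => u p.1 p.2) (volume.restrict (cylinder Ω T)))
    {A O : Set (Sp d)} {J : Set ℝ} {δ : ℝ} (hAO : IsInside A O δ) (hOΩ : O ⊆ Ω) (hJ : IsCompact J)
    (hJT : J ⊆ Ioo 0 T) {ℓ : ℝ} (hℓ : 0 < ℓ) (hRℓ : R * ℓ ≤ δ) :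
    AEStronglyMeasurable (dissDR ρ u ℓ) (volume.restrict (A ×ˢ J)) := by
  have hAΩ : A ⊆ Ω := ((self_subset_cthickening A).trans hAO.subset).trans hOΩ
  have h := aestronglyMeasurable_integral_comp_increment hΩ hu hAO.compact hAΩ hJ hJT hℓ.ne'
    (R := R) (fun x hx z hz => hOΩ (hAO.add_smul_mem hℓ hRℓ hx hz))
    (Φ := fun q => fderiv ℝ ρ q.1 ((1 / (4 * ℓ)) • (q.2.1 - q.2.2)) * ‖q.2.1 - q.2.2‖ ^ 2) ?_ ?_
  · refine h.congr (ae_of_all _ fun p => ?_)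
    simp only [dissDR, integrandDR, increment, inner_gradient_eq_fderiv]
  · have : Continuous (fderiv ℝ ρ) := hρ.smooth.continuous_fderiv (by simp)
    fun_prop
  · intro z hz a b
    simp only [hρ.fderiv_eq_zero hz]
    simp

theorem kernelAvg_congr {k : Sp d → ℝ} (hk : ∀ z ∉ closedBall (0 : Sp d) R, k z = 0)
    {f g : Sp d → ℝ} {x : Sp d} {δ ℓ : ℝ} (hℓ : 0 < ℓ) (hRℓ : R * ℓ ≤ δ)
    (h : EqOn f g (closedBall x δ)) : kernelAvg k ℓ f x = kernelAvg k ℓ g x := by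
  refine integral_congr_ae (ae_of_all _ fun z => ?_)
  by_cases hz : z ∈ closedBall (0 : Sp d) R
  · simp only [h (add_smul_mem_closedBall hℓ hRℓ x hz)]
  · simp only [hk z hz, zero_mul]

/-- With the derivative moved to the kernel, the expression contains only averages of `u` and its
products, whose joint measurability in space and time is available. -/
theorem dissCET_eq_kernelAvg (hρ : IsKernel ρ R C) {K O : Set (Sp d)} {δ : ℝ}
    (hKO : IsInside K O δ) {v : Sp d → Sp d} (hv : MemLp (O.indicator v) 2) {ℓ : ℝ} (hℓ : 0 < ℓ)
    (hRℓ : R * ℓ < δ) {x : Sp d} (hx : x ∈ K) :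
    dissCET ρ (fun y _ => v y) ℓ (x, 0) = ∑ i, ∑ j,
      (kernelAvg ρ ℓ (fun y => v y i) x * kernelAvg ρ ℓ (fun y => v y j) x
        - kernelAvg ρ ℓ (fun y => v y i * v y j) x) *
      (-ℓ⁻¹ * kernelAvg (partialDeriv j ρ) ℓ (fun y => v y i) x) := by
  have heq := eqOn_indicator hKO.subset v hx
  have hf : Integrable (O.indicator v) := memLp_one_iff_integrable.1
    (memLp_indicator_of_le hKO.isOpen.measurableSet hKO.volume_ne_top hv (by norm_num))
  have hi : ∀ i, EqOn (fun y => v y i) (fun y => O.indicator v y i) (closedBall x δ) :=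
    fun i y hy => by simp only [heq hy]
  have hij : ∀ i j, EqOn (fun y => v y i * v y j)
      (fun y => O.indicator v y i * O.indicator v y j) (closedBall x δ) :=
    fun i j y hy => by simp only [heq hy]
  have k0 : ∀ z ∉ closedBall (0 : Sp d) R, ρ z = 0 := fun z hz => hρ.eq_zero hz
  have k1 : ∀ j, ∀ z ∉ closedBall (0 : Sp d) R, partialDeriv j ρ z = 0 :=
    fun j z hz => hρ.partialDeriv_eq_zero j hz
  rw [dissCET_congr hρ hℓ hRℓ heq]
  simp only [dissCET, stress, mollify_coord hρ hℓ hf, fderiv_mollify_coord hρ hℓ hf,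
    mollify_apply hρ.even hℓ (fun y => O.indicator v y _ * O.indicator v y _),
    kernelAvg_congr k0 hℓ hRℓ.le (hi _), kernelAvg_congr k0 hℓ hRℓ.le (hij _ _),
    kernelAvg_congr (k1 _) hℓ hRℓ.le (hi _)]
  rfl

theorem aestronglyMeasurable_dissCET_prod (hρ : IsKernel ρ R C) {Ω : Set (Sp d)} {T : ℝ}
    {u : Sp d → ℝ → Sp d} (hΩ : IsOpen Ω)
    (hu : AEStronglyMeasurable (fun p : Sp d × ℝ => u p.1 p.2) (volume.restrict (cylinder Ω T)))
    {A O : Set (Sp d)} {J : Set ℝ} {δ : ℝ} (hAO : IsInside A O δ) (hOΩ : O ⊆ Ω) (hJ : IsCompact J)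
    (hJT : J ⊆ Ioo 0 T)
    (hv : ∀ᵐ t ∂(volume.restrict J), MemLp (O.indicator fun y => u y t) 2)
    {ℓ : ℝ} (hℓ : 0 < ℓ) (hRℓ : R * ℓ < δ) :
    AEStronglyMeasurable (dissCET ρ u ℓ) (volume.restrict (A ×ˢ J)) := by
  have hAΩ : A ⊆ Ω := ((self_subset_cthickening A).trans hAO.subset).trans hOΩ
  have hmeas : ∀ (k : Sp d → ℝ) (q : Sp d → ℝ), Continuous k → Continuous q →
      (∀ z ∉ closedBall (0 : Sp d) R, k z = 0) → AEStronglyMeasurable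
        (fun p : Sp d × ℝ => kernelAvg k ℓ (fun y => q (u y p.2)) p.1)
        (volume.restrict (A ×ˢ J)) := fun k q hk hq hkR =>
    aestronglyMeasurable_integral_comp_increment hΩ hu hAO.compact hAΩ hJ hJT hℓ.ne'
      (R := R) (fun x hx z hz => hOΩ (hAO.add_smul_mem hℓ hRℓ.le hx hz))
      (Φ := fun s => k s.1 * q s.2.1) (by fun_prop) fun z hz a b => by simp [hkR z hz]
  have k0 : ∀ z ∉ closedBall (0 : Sp d) R, ρ z = 0 := fun z hz => hρ.eq_zero hz
  have m1 := fun i : Fin d =>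
    hmeas ρ (fun w => w i) hρ.smooth.continuous (by fun_prop) k0
  have m2 := fun i j : Fin d =>
    hmeas ρ (fun w => w i * w j) hρ.smooth.continuous (by fun_prop) k0
  have m3 := fun i j : Fin d => hmeas (partialDeriv j ρ) (fun w => w i)
    (hρ.continuous_partialDeriv j) (by fun_prop) fun z hz => hρ.partialDeriv_eq_zero j hz
  have hQ : AEStronglyMeasurable (fun p : Sp d × ℝ => ∑ i, ∑ j,
      (kernelAvg ρ ℓ (fun y => u y p.2 i) p.1 * kernelAvg ρ ℓ (fun y => u y p.2 j) p.1
        - kernelAvg ρ ℓ (fun y => u y p.2 i * u y p.2 j) p.1) *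
      (-ℓ⁻¹ * kernelAvg (partialDeriv j ρ) ℓ (fun y => u y p.2 i) p.1))
      (volume.restrict (A ×ˢ J)) := by
    refine Finset.aestronglyMeasurable_fun_sum _ fun i _ =>
      Finset.aestronglyMeasurable_fun_sum _ fun j _ => ?_
    exact (((m1 i).mul (m1 j)).sub (m2 i j)).mul ((m3 i j).const_mul _)
  refine hQ.congr ?_
  filter_upwards [ae_restrict_prod_of_ae_time hv, ae_restrict_mem
    (μ := (volume : Measure (Sp d × ℝ))) (hAO.compact.measurableSet.prod hJ.measurableSet)]
    with p hp1 hp2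
  exact (dissCET_eq_kernelAvg hρ hAO hp1 hℓ hRℓ hp2.1).symm

theorem vanishesDR_of_ae_time (hρ : IsKernel ρ R C) {Ω : Set (Sp d)} {T : ℝ}
    {u : Sp d → ℝ → Sp d} (hΩ : IsOpen Ω)
    (hu : AEStronglyMeasurable (fun p : Sp d × ℝ => u p.1 p.2) (volume.restrict (cylinder Ω T)))
    (h : ∀ (A : Set (Sp d)) (J : Set ℝ), IsCompact A → A ⊆ Ω → IsCompact J → J ⊆ Ioo 0 T →
      ∃ (O : Set (Sp d)) (δ : ℝ) (g : ℝ → ℝ≥0∞), IsInside A O δ ∧ O ⊆ Ω ∧ ∫⁻ t in J, g t ≠ ⊤ ∧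
        ∀ᵐ t ∂(volume.restrict J), MemLp (O.indicator fun y => u y t) 3 ∧
          (∀ ℓ : ℝ, 0 < ℓ → R * ℓ ≤ δ → ∫⁻ x in A, ‖dissDR ρ u ℓ (x, t)‖ₑ ≤ g t) ∧
          Tendsto (fun ℓ => ∫⁻ x in A, ‖dissDR ρ u ℓ (x, t)‖ₑ) (𝓝[>] 0) (𝓝 0)) :
    VanishesDR Ω T ρ u := by
  constructor
  · intro K hK hKΩ
    obtain ⟨A, J, hA, hAΩ, hJ, hJT, hKAJ⟩ := exists_compact_prod hK hKΩ
    obtain ⟨O, δ, g, hAO, hOΩ, hg, hae⟩ := h A J hA hAΩ hJ hJT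
    filter_upwards [eventually_scale_le R hAO.pos] with ℓ hℓ
    refine ae_restrict_of_ae_restrict_of_subset hKAJ ?_
    filter_upwards [ae_restrict_prod_of_ae_time hae, ae_restrict_mem
      (μ := (volume : Measure (Sp d × ℝ))) (hA.measurableSet.prod hJ.measurableSet)]
      with p hp1 hp2
    exact integrable_integrandDR_of_memLp hρ hAO hp1.1 hℓ.1 hℓ.2 hp2.1
  · refine tendstoZeroL1_of_ae_time fun A J hA hAΩ hJ hJT => ?_
    obtain ⟨O, δ, g, hAO, hOΩ, hg, hae⟩ := h A J hA hAΩ hJ hJT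
    refine ⟨g, hg, ?_, hae.mono fun t ht => ht.2.2⟩
    filter_upwards [eventually_scale_le R hAO.pos] with ℓ hℓ
    exact ⟨aestronglyMeasurable_dissDR_prod hρ hΩ hu hAO hOΩ hJ hJT hℓ.1 hℓ.2,
      hae.mono fun t ht => ht.2.1 ℓ hℓ.1 hℓ.2⟩

theorem vanishesCET_of_ae_time (hρ : IsKernel ρ R C) {Ω : Set (Sp d)} {T : ℝ}
    {u : Sp d → ℝ → Sp d} (hΩ : IsOpen Ω)
    (hu : AEStronglyMeasurable (fun p : Sp d × ℝ => u p.1 p.2) (volume.restrict (cylinder Ω T)))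
    (h : ∀ (A : Set (Sp d)) (J : Set ℝ), IsCompact A → A ⊆ Ω → IsCompact J → J ⊆ Ioo 0 T →
      ∃ (O : Set (Sp d)) (δ : ℝ) (g : ℝ → ℝ≥0∞), IsInside A O δ ∧ O ⊆ Ω ∧ ∫⁻ t in J, g t ≠ ⊤ ∧
        ∀ᵐ t ∂(volume.restrict J), MemLp (O.indicator fun y => u y t) 2 ∧
          (∀ ℓ : ℝ, 0 < ℓ → R * ℓ ≤ δ / 2 → ∫⁻ x in A, ‖dissCET ρ u ℓ (x, t)‖ₑ ≤ g t) ∧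
          Tendsto (fun ℓ => ∫⁻ x in A, ‖dissCET ρ u ℓ (x, t)‖ₑ) (𝓝[>] 0) (𝓝 0)) :
    VanishesCET Ω T ρ u := by
  constructor
  · intro K hK hKΩ
    obtain ⟨A, J, hA, hAΩ, hJ, hJT, hKAJ⟩ := exists_compact_prod hK hKΩ
    obtain ⟨O, δ, g, hAO, hOΩ, hg, hae⟩ := h A J hA hAΩ hJ hJT
    -- Half the margin provides the strict inequality needed for differentiability of the
    -- mollification.
    filter_upwards [eventually_scale_le R (half_pos hAO.pos)] with ℓ hℓ
    refine ae_restrict_of_ae_restrict_of_subset hKAJ ?_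
    filter_upwards [ae_restrict_prod_of_ae_time hae, ae_restrict_mem
      (μ := (volume : Measure (Sp d × ℝ))) (hA.measurableSet.prod hJ.measurableSet)]
      with p hp1 hp2
    exact exists_mollify_of_memLp hρ hAO hp1.1 hℓ.1 (by linarith [hAO.pos]) hp2.1
  · refine tendstoZeroL1_of_ae_time fun A J hA hAΩ hJ hJT => ?_
    obtain ⟨O, δ, g, hAO, hOΩ, hg, hae⟩ := h A J hA hAΩ hJ hJT
    refine ⟨g, hg, ?_, hae.mono fun t ht => ht.2.2⟩
    filter_upwards [eventually_scale_le R (half_pos hAO.pos)] with ℓ hℓ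
    exact ⟨aestronglyMeasurable_dissCET_prod hρ hΩ hu hAO hOΩ hJ hJT (hae.mono fun t ht => ht.1) hℓ.1
      (by linarith [hAO.pos]), hae.mono fun t ht => ht.2.1 ℓ hℓ.1 hℓ.2⟩

/-- Hölder's inequality for the majorants in time. -/
theorem lintegral_majorant_ne_top {J : Set ℝ} (hJ : volume J ≠ ⊤) {p₁ p₂ : ℝ≥0∞}
    (hp : p₁⁻¹ + 2 * p₂⁻¹ = 1) {g₁ g₂ : ℝ → ℝ} (h₁ : MemLp g₁ p₁ (volume.restrict J))
    (h₂ : MemLp g₂ p₂ (volume.restrict J)) {B : ℝ≥0∞} (hB : B ≠ ⊤) :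
    ∫⁻ t in J, B * ((ENNReal.ofReal (g₁ t) + 1) *
      ((ENNReal.ofReal (g₂ t) + 1) * (ENNReal.ofReal (g₂ t) + 1))) ≠ ⊤ := by
  have : IsFiniteMeasure (volume.restrict J) := ⟨by simpa using hJ.lt_top⟩
  -- The added constants allow for infima that are not attained and for oscillation bounds that must
  -- be nonzero; they lie in every `L^p` because `J` has finite measure.
  have m₁ : MemLp (fun t => ‖g₁ t‖ + 1) p₁ (volume.restrict J) := h₁.norm.add (memLp_const 1)
  have m₂ : MemLp (fun t => ‖g₂ t‖ + 1) p₂ (volume.restrict J) := h₂.norm.add (memLp_const 1)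
  -- Hölder is applied twice: the two factors in `L^{p₂}` have a product with reciprocal exponent `2
  -- / p₂`, which is conjugate to `p₁`.
  have : ENNReal.HolderTriple p₂ p₂ (2 * p₂⁻¹)⁻¹ := ⟨by rw [inv_inv, two_mul]⟩
  have : ENNReal.HolderTriple p₁ (2 * p₂⁻¹)⁻¹ 1 := ⟨by rw [inv_inv, hp, inv_one]⟩
  have m₃ : MemLp (fun t => (‖g₁ t‖ + 1) * ((‖g₂ t‖ + 1) * (‖g₂ t‖ + 1))) 1
      (volume.restrict J) := by
    have m₄ : MemLp (fun t => (‖g₂ t‖ + 1) * (‖g₂ t‖ + 1)) (2 * p₂⁻¹)⁻¹ (volume.restrict J) :=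
      m₂.mul m₂
    exact m₄.mul m₁
  have h := m₃.eLpNorm_ne_top
  rw [eLpNorm_one_eq_lintegral_enorm] at h
  rw [lintegral_const_mul' _ _ hB]
  refine ENNReal.mul_ne_top hB (ne_top_of_le_ne_top h (lintegral_mono fun t => ?_))
  have hb : ∀ x : ℝ, ENNReal.ofReal x + 1 ≤ ‖‖x‖ + 1‖ₑ := fun x => by
    rw [← ofReal_norm, Real.norm_of_nonneg (by positivity),
      ENNReal.ofReal_add (norm_nonneg _) zero_le_one, ENNReal.ofReal_one]
    gcongr
    exact le_abs_self x
  simp only [enorm_mul]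
  exact mul_le_mul' (hb _) (mul_le_mul' (hb _) (hb _))


/-! ### The space-time classes -/

/-- The slack `1` makes the inequality strict, so that a representative can be extracted from the
infimum. Finiteness of the infimum also rules out the empty case. -/
theorem exists_isSymGradFun_of_symGradNorm_le {q : ℝ≥0∞} {O : Set (Sp d)} {v : Sp d → Sp d} {b : ℝ}
    (h : symGradNorm q O v ≤ ENNReal.ofReal b) :
    ∃ G, IsSymGradFun O v G ∧ eLpNorm G q (volume.restrict O) ≤ ENNReal.ofReal b + 1 := by
  have h1 : symGradNorm q O v < ENNReal.ofReal b + 1 :=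
    h.trans_lt (ENNReal.lt_add_right ENNReal.ofReal_ne_top one_ne_zero)
  obtain ⟨G, hG⟩ := iInf_lt_iff.1 h1
  obtain ⟨hG1, hG2⟩ := iInf_lt_iff.1 hG
  exact ⟨G, hG1, hG2.le⟩

theorem exists_symGradBound_of_bdNorm_le {O : Set (Sp d)} {v : Sp d → Sp d} {b : ℝ}
    (h : bdNorm O v ≤ ENNReal.ofReal b) :
    ∃ ν : Measure (Sp d), IsFiniteMeasure ν ∧ SymGradBound O v 0 ν ∧
      ν univ ≤ ENNReal.ofReal b + 1 := by
  have h1 : (⨅ (μ : VectorMeasure (Sp d) (Mat d)) (_ : IsSymGradMeasure O v μ), μ.variation O)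
      < ENNReal.ofReal b + 1 :=
    (le_add_self.trans h).trans_lt (ENNReal.lt_add_right ENNReal.ofReal_ne_top one_ne_zero)
  obtain ⟨μ, hμ⟩ := iInf_lt_iff.1 h1
  obtain ⟨hμ1, hμ2⟩ := iInf_lt_iff.1 hμ
  refine ⟨μ.variation.restrict O, ⟨?_⟩, symGradBound_of_isSymGradMeasure hμ1, ?_⟩
  · rw [Measure.restrict_apply_univ]
    exact hμ2.trans (by finiteness)
  · rw [Measure.restrict_apply_univ]
    exact hμ2.le

section

variable {Ω : Set (Sp d)} {T : ℝ} {u : Sp d → ℝ → Sp d}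

theorem ae_aestronglyMeasurable_restrict
    (hu : AEStronglyMeasurable (fun p : Sp d × ℝ => u p.1 p.2) (volume.restrict (cylinder Ω T)))
    {O : Set (Sp d)} {J : Set ℝ} (hO : O ⊆ Ω) (hJ : J ⊆ Ioo 0 T) :
    ∀ᵐ t ∂(volume.restrict J), AEStronglyMeasurable (fun y => u y t) (volume.restrict O) :=
  ae_restrict_of_ae_restrict_of_subset hJ ((ae_aestronglyMeasurable_slice hu).mono fun _ h =>
    h.mono_measure (Measure.restrict_mono hO le_rfl))

theorem CompactlyInside.subset {O : Set (Sp d)} (h : CompactlyInside O Ω) : O ⊆ Ω :=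
  subset_closure.trans h.2.2

theorem AlmostAllTimes.ae_restrict {P : Set (Sp d) → (Sp d → Sp d) → Prop}
    (h : AlmostAllTimes Ω T P u) {O : Set (Sp d)} (hO : CompactlyInside O Ω) {J : Set ℝ}
    (hJ : J ⊆ Ioo 0 T) : ∀ᵐ t ∂(volume.restrict J), P O fun x => u x t :=
  ae_restrict_of_ae_restrict_of_subset hJ (h.mono fun _ h => h O hO)

theorem lintegral_ofReal_pow_three_ne_top {J : Set ℝ} {g : ℝ → ℝ}
    (hg : MemLp g 3 (volume.restrict J)) {B : ℝ≥0∞} (hB : B ≠ ⊤) :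
    ∫⁻ t in J, B * ENNReal.ofReal (g t) ^ 3 ≠ ⊤ := by
  have h := lintegral_rpow_enorm_lt_top_of_eLpNorm_lt_top (by simp) (by simp) hg.2
  rw [lintegral_const_mul' _ _ hB]
  refine ENNReal.mul_ne_top hB (ne_top_of_le_ne_top h.ne (lintegral_mono fun t => ?_))
  rw [ENNReal.toReal_ofNat, ← ENNReal.rpow_natCast, ← ofReal_norm]
  exact ENNReal.rpow_le_rpow (ENNReal.ofReal_le_ofReal (le_abs_self _)) (by positivity)

theorem besovModulus_le_besovNorm (α p : ℝ) (O : Set (Sp d)) (v : Sp d → Sp d) {ℓ : ℝ}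
    (hℓ : 0 < ℓ) : besovModulus α p O v ℓ ≤ besovNorm α p O v :=
  (le_iSup₂ (f := fun (ℓ : ℝ) (_ : 0 < ℓ) => besovModulus α p O v ℓ) ℓ hℓ).trans le_add_self

theorem BesovVanishing.tendsto_scale (hR : 0 < R) {α p : ℝ} {O : Set (Sp d)} {v : Sp d → Sp d}
    (h : BesovVanishing α p O v) {B : ℝ≥0∞} (hB : B ≠ ⊤) :
    Tendsto (fun ℓ => B * besovModulus α p O v (R * ℓ) ^ 3) (𝓝[>] 0) (𝓝 0) := by
  have h1 : Tendsto (fun ℓ : ℝ => R * ℓ) (𝓝[>] 0) (𝓝[>] 0) := by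
    refine tendsto_nhdsWithin_iff.2 ⟨?_, ?_⟩
    · have : Continuous fun ℓ : ℝ => R * ℓ := by fun_prop
      simpa using (this.tendsto 0).mono_left nhdsWithin_le_nhds
    · filter_upwards [self_mem_nhdsWithin] with ℓ hℓ
      exact mul_pos hR hℓ
  have h2 := ENNReal.Tendsto.pow (n := 3) (Tendsto.comp h h1)
  rw [zero_pow (by norm_num)] at h2
  exact tendsto_const_mul_add h2 hB

theorem memLp_three_of_besovNorm_le {O : Set (Sp d)} (hO : MeasurableSet O) {v : Sp d → Sp d}
    (hv : AEStronglyMeasurable v (volume.restrict O)) {b : ℝ}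
    (h : besovNorm (1 / 3) 3 O v ≤ ENNReal.ofReal b) : MemLp (O.indicator v) 3 := by
  have h1 := le_self_add.trans h
  rw [ENNReal.ofReal_ofNat] at h1
  exact memLp_indicator_of_eLpNorm_ne_top hO hv (ne_top_of_le_ne_top ENNReal.ofReal_ne_top h1)

/-! ### The seven cases in space-time. -/

theorem vanishesDR_besov (hρ : IsKernel ρ R C) (hΩ : IsOpen Ω)
    (hu : AEStronglyMeasurable (fun p : Sp d × ℝ => u p.1 p.2) (volume.restrict (cylinder Ω T)))
    (h : InLpBesovVMO Ω T 3 (1 / 3) 3 u) : VanishesDR Ω T ρ u := by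
  refine vanishesDR_of_ae_time hρ hΩ hu fun A J hA hAΩ hJ hJT => ?_
  obtain ⟨O, δ, hOΩ, hAO⟩ := exists_isInside hΩ hA hAΩ
  obtain ⟨g, hg, hgt⟩ := h.1 O hOΩ J hJ hJT
  obtain ⟨B, hB, hb⟩ := lintegral_dissDR_le_besov hρ hAO.subset hA.measurableSet
  refine ⟨O, δ, _, hAO, hOΩ.subset, lintegral_ofReal_pow_three_ne_top hg hB, ?_⟩
  filter_upwards [hgt, h.2.ae_restrict hOΩ hJT, ae_aestronglyMeasurable_restrict hu hOΩ.subset hJT]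
    with t h1 h2 h3
  refine ⟨memLp_three_of_besovNorm_le hAO.isOpen.measurableSet h3 h1, fun ℓ hℓ hRℓ => ?_, ?_⟩
  · refine (hb (fun y => u y t) ℓ hℓ hRℓ).trans (mul_le_mul_right (pow_le_pow_left' ?_ 3) _)
    exact (besovModulus_le_besovNorm _ _ _ _ (mul_pos hρ.pos hℓ)).trans h1
  · refine tendsto_of_tendsto_of_tendsto_of_le_of_le' tendsto_const_nhds
      (BesovVanishing.tendsto_scale hρ.pos h2 hB) (Eventually.of_forall fun _ => zero_le) ?_
    filter_upwards [eventually_scale_le R hAO.pos] with ℓ hℓ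
    exact hb (fun y => u y t) ℓ hℓ.1 hℓ.2

theorem vanishesCET_besov (hρ : IsKernel ρ R C) (hΩ : IsOpen Ω)
    (hu : AEStronglyMeasurable (fun p : Sp d × ℝ => u p.1 p.2) (volume.restrict (cylinder Ω T)))
    (hρ1 : ∫ z, ρ z = 1) (h : InLpBesovVMO Ω T 3 (1 / 3) 3 u) :
    VanishesCET Ω T ρ u := by
  refine vanishesCET_of_ae_time hρ hΩ hu fun A J hA hAΩ hJ hJT => ?_
  obtain ⟨O, δ, hOΩ, hAO⟩ := exists_isInside hΩ hA hAΩ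
  have hδ := hAO.pos
  obtain ⟨g, hg, hgt⟩ := h.1 O hOΩ J hJ hJT
  obtain ⟨B, hB, hb⟩ := lintegral_dissCET_le_besov hρ hρ1 hAO.subset hA.measurableSet
  refine ⟨O, δ, _, hAO, hOΩ.subset, lintegral_ofReal_pow_three_ne_top hg hB, ?_⟩
  filter_upwards [hgt, h.2.ae_restrict hOΩ hJT, ae_aestronglyMeasurable_restrict hu hOΩ.subset hJT]
    with t h1 h2 h3
  have hv := memLp_three_of_besovNorm_le hAO.isOpen.measurableSet h3 h1
  have hv2 : MemLp (O.indicator fun y => u y t) 2 :=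
    memLp_indicator_of_le hAO.isOpen.measurableSet hAO.volume_ne_top hv (by norm_num)
  have hv1 : Integrable (O.indicator fun y => u y t) := memLp_one_iff_integrable.1
    (memLp_indicator_of_le hAO.isOpen.measurableSet hAO.volume_ne_top hv (by norm_num))
  refine ⟨hv2, fun ℓ hℓ hRℓ => ?_, ?_⟩
  · refine (hb (fun y => u y t) hv1 hv2 ℓ hℓ (by linarith)).trans
      (mul_le_mul_right (pow_le_pow_left' ?_ 3) _)
    exact (besovModulus_le_besovNorm _ _ _ _ (mul_pos hρ.pos hℓ)).trans h1
  · refine tendsto_of_tendsto_of_tendsto_of_le_of_le' tendsto_const_nhds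
      (BesovVanishing.tendsto_scale hρ.pos h2 hB) (Eventually.of_forall fun _ => zero_le) ?_
    filter_upwards [eventually_scale_le R (half_pos hδ)] with ℓ hℓ
    exact hb (fun y => u y t) hv1 hv2 ℓ hℓ.1 (by linarith)

theorem vanishesDR_BD_C0 (hρ : IsKernel ρ R C) (hΩ : IsOpen Ω)
    (hu : AEStronglyMeasurable (fun p : Sp d × ℝ => u p.1 p.2) (volume.restrict (cylinder Ω T)))
    {p₁ p₂ : ℝ≥0∞} (hp : p₁⁻¹ + 2 * p₂⁻¹ = 1)
    (h₁ : InLpBD Ω T p₁ u) (h₂ : InLpC0 Ω T p₂ u) : VanishesDR Ω T ρ u := by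
  obtain ⟨B, hB, hb⟩ := dissDR_continuous hρ
  refine vanishesDR_of_ae_time hρ hΩ hu fun A J hA hAΩ hJ hJT => ?_
  obtain ⟨O, δ, hOΩ, hAO⟩ := exists_isInside hΩ hA hAΩ
  have hδ := hAO.pos
  obtain ⟨g₁, hg₁, hgt₁⟩ := h₁ O hOΩ J hJ hJT
  obtain ⟨g₂, hg₂, hgt₂⟩ := h₂.1 O hOΩ J hJ hJT
  refine ⟨O, δ / 2, _, hAO.mono (by positivity) (by linarith), hOΩ.subset,
    lintegral_majorant_ne_top hJ.measure_lt_top.ne hp hg₁ hg₂ hB, ?_⟩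
  filter_upwards [hgt₁, hgt₂, h₂.2.ae_restrict hOΩ hJT,
    ae_aestronglyMeasurable_restrict hu hOΩ.subset hJT] with t h3 h4 h5 h6
  obtain ⟨ν, hν, hν1, hν2⟩ := exists_symGradBound_of_bdNorm_le h3
  have h7 := hb A O δ hAO _ h6 _ ENNReal.ofReal_ne_top h4 ν hν1
  refine ⟨memLp_indicator_of_le hAO.isOpen.measurableSet hAO.volume_ne_top
    (memLp_indicator_of_eLpNorm_ne_top hAO.isOpen.measurableSet h6
      (ne_top_of_le_ne_top ENNReal.ofReal_ne_top h4)) le_top, fun ℓ hℓ hRℓ => ?_, h7.2 h5⟩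
  exact (h7.1 ℓ hℓ hRℓ).trans (mul_le_mul_right
    (mul_le_mul' hν2 (mul_le_mul' le_self_add le_self_add)) _)

theorem vanishesDR_bounded (hρ : IsKernel ρ R C) (hΩ : IsOpen Ω)
    (hu : AEStronglyMeasurable (fun p : Sp d × ℝ => u p.1 p.2) (volume.restrict (cylinder Ω T)))
    {p₁ p₂ : ℝ≥0∞} (hp : p₁⁻¹ + 2 * p₂⁻¹ = 1)
    (h₂ : InLpLq Ω T p₂ ⊤ u) (h₁ : SymGradInLpLq Ω T p₁ 1 u) :
    VanishesDR Ω T ρ u := by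
  obtain ⟨B, hB, hb⟩ := dissDR_bounded hρ
  refine vanishesDR_of_ae_time hρ hΩ hu fun A J hA hAΩ hJ hJT => ?_
  obtain ⟨O, δ, hOΩ, hAO⟩ := exists_isInside hΩ hA hAΩ
  have hδ := hAO.pos
  obtain ⟨g₁, hg₁, hgt₁⟩ := h₁ O hOΩ J hJ hJT
  obtain ⟨g₂, hg₂, hgt₂⟩ := h₂ O hOΩ J hJ hJT
  refine ⟨O, δ / 2, _, hAO.mono (by positivity) (by linarith), hOΩ.subset,
    lintegral_majorant_ne_top hJ.measure_lt_top.ne hp hg₁ hg₂ hB, ?_⟩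
  filter_upwards [hgt₁, hgt₂, ae_aestronglyMeasurable_restrict hu hOΩ.subset hJT] with t h3 h4 h6
  obtain ⟨G, hG, hG1⟩ := exists_isSymGradFun_of_symGradNorm_le h3
  have h7 := hb A O δ hAO _ h6 _ ENNReal.ofReal_ne_top h4 G hG
    (ne_top_of_le_ne_top (by finiteness) hG1)
  refine ⟨memLp_indicator_of_le hAO.isOpen.measurableSet hAO.volume_ne_top
    (memLp_indicator_of_eLpNorm_ne_top hAO.isOpen.measurableSet h6
      (ne_top_of_le_ne_top ENNReal.ofReal_ne_top h4)) le_top, fun ℓ hℓ hRℓ => ?_, h7.2⟩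
  exact (h7.1 ℓ hℓ hRℓ).trans (mul_le_mul_right
    (mul_le_mul' hG1 (mul_le_mul' le_self_add le_self_add)) _)

theorem vanishesDR_symGrad_bounded (hρ : IsKernel ρ R C) (hΩ : IsOpen Ω)
    (hu : AEStronglyMeasurable (fun p : Sp d × ℝ => u p.1 p.2) (volume.restrict (cylinder Ω T)))
    {p₁ p₂ : ℝ≥0∞} (hp : p₁⁻¹ + 2 * p₂⁻¹ = 1)
    (h₂ : InLpLq Ω T p₂ 2 u) (h₁ : SymGradInLpLq Ω T p₁ ⊤ u) :
    VanishesDR Ω T ρ u := by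
  obtain ⟨B, hB, hb⟩ := dissDR_symGrad_bounded hρ
  refine vanishesDR_of_ae_time hρ hΩ hu fun A J hA hAΩ hJ hJT => ?_
  obtain ⟨O, δ, hOΩ, hAO⟩ := exists_isInside hΩ hA hAΩ
  have hδ := hAO.pos
  have hAO' := hAO.thickening
  obtain ⟨g₁, hg₁, hgt₁⟩ := h₁ O hOΩ J hJ hJT
  obtain ⟨g₂, hg₂, hgt₂⟩ := h₂ O hOΩ J hJ hJT
  -- The cubic integrability of the field comes from its local boundedness, which holds only on this
  -- smaller neighbourhood.
  refine ⟨thickening (δ / 2) A, δ / 8, _, hAO'.mono (by positivity) (by linarith),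
    hAO.thickening_subset.trans hOΩ.subset,
    lintegral_majorant_ne_top hJ.measure_lt_top.ne hp hg₁ hg₂ hB, ?_⟩
  filter_upwards [hgt₁, hgt₂, ae_aestronglyMeasurable_restrict hu hOΩ.subset hJT] with t h3 h4 h6
  obtain ⟨G, hG, hG1⟩ := exists_isSymGradFun_of_symGradNorm_le h3
  have hbd := symGradBound_of_eLpNorm_top_le hG hG1
  have hv2 := ne_top_of_le_ne_top ENNReal.ofReal_ne_top h4
  have h7 := hb A O δ hAO _ h6 hv2 _ (by finiteness) hbd
  obtain ⟨a, ha, hva⟩ := exists_lebNorm_top_le_of_symGradBound hAO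
    (memLp_indicator_of_eLpNorm_ne_top hAO.isOpen.measurableSet h6 hv2) (by finiteness) hbd
  refine ⟨memLp_indicator_of_le hAO'.isOpen.measurableSet hAO'.volume_ne_top
    (memLp_indicator_of_eLpNorm_ne_top hAO'.isOpen.measurableSet
      (h6.mono_measure (Measure.restrict_mono hAO.thickening_subset le_rfl))
      (ne_top_of_le_ne_top ha hva)) le_top, fun ℓ hℓ hRℓ => ?_, h7.2⟩
  have h8 := h4.trans (le_self_add (a := ENNReal.ofReal (g₂ t)) (b := 1))
  exact (h7.1 ℓ hℓ hRℓ).trans (mul_le_mul_right (mul_le_mul' le_rfl (mul_le_mul' h8 h8)) _)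

theorem vanishesCET_BD_VMO (hρ : IsKernel ρ R C) (hΩ : IsOpen Ω)
    (hu : AEStronglyMeasurable (fun p : Sp d × ℝ => u p.1 p.2) (volume.restrict (cylinder Ω T)))
    {p₁ p₂ : ℝ≥0∞} (hp : p₁⁻¹ + 2 * p₂⁻¹ = 1)
    (hρ1 : ∫ z, ρ z = 1) (h₁ : InLpBD Ω T p₁ u) (h₂ : InLpVMO Ω T p₂ u) :
    VanishesCET Ω T ρ u := by
  obtain ⟨B, hB, hb⟩ := dissCET_vmo hρ hρ1
  refine vanishesCET_of_ae_time hρ hΩ hu fun A J hA hAΩ hJ hJT => ?_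
  obtain ⟨O, δ, hOΩ, hAO⟩ := exists_isInside hΩ hA hAΩ
  have hOm := hAO.isOpen.measurableSet
  obtain ⟨g₁, hg₁, hgt₁⟩ := h₁ O hOΩ J hJ hJT
  obtain ⟨g₂, hg₂, hgt₂⟩ := h₂.1 O hOΩ J hJ hJT
  refine ⟨thickening (δ / 2) A, δ / 4, _, hAO.thickening,
    hAO.thickening_subset.trans hOΩ.subset,
    lintegral_majorant_ne_top hJ.measure_lt_top.ne hp hg₁ hg₂ hB, ?_⟩
  filter_upwards [hgt₁, hgt₂, h₂.2.ae_restrict hOΩ hJT,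
    ae_aestronglyMeasurable_restrict hu hOΩ.subset hJT] with t h3 h4 h5 h6
  obtain ⟨ν, hν, hν1, hν2⟩ := exists_symGradBound_of_bdNorm_le h3
  have hv : Integrable (O.indicator fun y => u y t) := memLp_one_iff_integrable.1
    (memLp_indicator_of_eLpNorm_ne_top hOm h6
      (ne_top_of_le_ne_top ENNReal.ofReal_ne_top (le_self_add.trans h3)))
  -- The covering argument divides by the oscillation bound, so it must be nonzero even if `g₂ t` is
  -- not positive.
  have h0 : ENNReal.ofReal (g₂ t) + 1 ≠ 0 := by simp
  have h4' := h4.trans (le_self_add (a := ENNReal.ofReal (g₂ t)) (b := 1))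
  have h7 := hb A O δ hAO _ hv _ h0 (by finiteness) h4' ν hν1
  refine ⟨memLp_two_of_meanOsc_le hAO hv h0 (by finiteness) fun s hs =>
    (le_iSup₂ (f := fun (s : ℝ) (_ : 0 < s) => meanOsc O (fun y => u y t) s) s hs).trans h4',
    fun ℓ hℓ hRℓ => ?_, h7.2 h5⟩
  exact (h7.1 ℓ hℓ (by linarith)).trans (mul_le_mul_right (mul_le_mul' hν2 le_rfl) _)

theorem vanishesCET_symGrad_bounded (hρ : IsKernel ρ R C) (hΩ : IsOpen Ω)
    (hu : AEStronglyMeasurable (fun p : Sp d × ℝ => u p.1 p.2) (volume.restrict (cylinder Ω T)))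
    {p₁ p₂ : ℝ≥0∞} (hp : p₁⁻¹ + 2 * p₂⁻¹ = 1)
    (hρ1 : ∫ z, ρ z = 1) (h₂ : InLpLq Ω T p₂ 2 u)
    (h₁ : SymGradInLpLq Ω T p₁ ⊤ u) : VanishesCET Ω T ρ u := by
  obtain ⟨B, hB, hb⟩ := dissCET_symGrad_bounded hρ hρ1
  refine vanishesCET_of_ae_time hρ hΩ hu fun A J hA hAΩ hJ hJT => ?_
  obtain ⟨O, δ, hOΩ, hAO⟩ := exists_isInside hΩ hA hAΩ
  have hδ := hAO.pos
  obtain ⟨g₁, hg₁, hgt₁⟩ := h₁ O hOΩ J hJ hJT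
  obtain ⟨g₂, hg₂, hgt₂⟩ := h₂ O hOΩ J hJ hJT
  refine ⟨O, δ / 4, _, hAO.mono (by positivity) (by linarith), hOΩ.subset,
    lintegral_majorant_ne_top hJ.measure_lt_top.ne hp hg₁ hg₂ hB, ?_⟩
  filter_upwards [hgt₁, hgt₂, ae_aestronglyMeasurable_restrict hu hOΩ.subset hJT] with t h3 h4 h6
  obtain ⟨G, hG, hG1⟩ := exists_isSymGradFun_of_symGradNorm_le h3
  have hv2 := ne_top_of_le_ne_top ENNReal.ofReal_ne_top h4
  have h7 := hb A O δ hAO _ h6 hv2 _ (by finiteness) (symGradBound_of_eLpNorm_top_le hG hG1)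
  refine ⟨memLp_indicator_of_eLpNorm_ne_top hAO.isOpen.measurableSet h6 hv2,
    fun ℓ hℓ hRℓ => ?_, h7.2⟩
  have h8 := h4.trans (le_self_add (a := ENNReal.ofReal (g₂ t)) (b := 1))
  exact (h7.1 ℓ hℓ (by linarith)).trans
    (mul_le_mul_right (mul_le_mul' le_rfl (mul_le_mul' h8 h8)) _)

end

end Onsager

end

theorem mainTheorem4 (d : ℕ) (Ω : Set (Onsager.Sp d)) (hΩ : IsOpen Ω) (T : ℝ)
    (ρ : Onsager.Sp d → ℝ) (hρ_smooth : ContDiff ℝ ∞ ρ) (hρ_supp : HasCompactSupport ρ)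
    (hρ_even : ∀ z, ρ (-z) = ρ z)
    (u : Onsager.Sp d → ℝ → Onsager.Sp d)
    (hu : AEStronglyMeasurable (fun p : Onsager.Sp d × ℝ => u p.1 p.2)
      (volume.restrict (Onsager.cylinder Ω T))) :
    ((Onsager.InLpBesovVMO Ω T 3 (1 / 3) 3 u → Onsager.VanishesDR Ω T ρ u) ∧
      (∀ p₁ p₂ : ℝ≥0∞, p₁⁻¹ + 2 * p₂⁻¹ = 1 →
        Onsager.InLpBD Ω T p₁ u → Onsager.InLpC0 Ω T p₂ u → Onsager.VanishesDR Ω T ρ u) ∧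
      (∀ p₁ p₂ : ℝ≥0∞, p₁⁻¹ + 2 * p₂⁻¹ = 1 →
        Onsager.InLpLq Ω T p₂ ∞ u → Onsager.SymGradInLpLq Ω T p₁ 1 u →
          Onsager.VanishesDR Ω T ρ u) ∧
      (∀ p₁ p₂ : ℝ≥0∞, p₁⁻¹ + 2 * p₂⁻¹ = 1 →
        Onsager.InLpLq Ω T p₂ 2 u → Onsager.SymGradInLpLq Ω T p₁ ∞ u →
          Onsager.VanishesDR Ω T ρ u)) ∧
    ((∫ z, ρ z) = 1 →
      (Onsager.InLpBesovVMO Ω T 3 (1 / 3) 3 u → Onsager.VanishesCET Ω T ρ u) ∧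
      (∀ p₁ p₂ : ℝ≥0∞, p₁⁻¹ + 2 * p₂⁻¹ = 1 →
        Onsager.InLpBD Ω T p₁ u → Onsager.InLpVMO Ω T p₂ u → Onsager.VanishesCET Ω T ρ u) ∧
      (∀ p₁ p₂ : ℝ≥0∞, p₁⁻¹ + 2 * p₂⁻¹ = 1 →
        Onsager.InLpLq Ω T p₂ 2 u → Onsager.SymGradInLpLq Ω T p₁ ∞ u →
          Onsager.VanishesCET Ω T ρ u)) := by
  obtain ⟨R, C, hρ⟩ := Onsager.exists_isKernel hρ_smooth hρ_supp hρ_even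
  refine ⟨⟨Onsager.vanishesDR_besov hρ hΩ hu,
    fun p₁ p₂ hp => Onsager.vanishesDR_BD_C0 hρ hΩ hu hp,
    fun p₁ p₂ hp => Onsager.vanishesDR_bounded hρ hΩ hu hp,
    fun p₁ p₂ hp => Onsager.vanishesDR_symGrad_bounded hρ hΩ hu hp⟩, fun hρ1 => ⟨
    Onsager.vanishesCET_besov hρ hΩ hu hρ1,
    fun p₁ p₂ hp => Onsager.vanishesCET_BD_VMO hρ hΩ hu hp hρ1,
    fun p₁ p₂ hp => Onsager.vanishesCET_symGrad_bounded hρ hΩ hu hp hρ1⟩⟩
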